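/- Fix a real number $d>1$ and equip $\mathbb{C}(q)$ with the $q^{-1}$-adic norm $|f/g|=d^{\deg_q f-\deg_q g}$. Let $\mathcal{C}$ be the smallest complete algebraically closed normed extension of $\mathbb{C}(q)$, i.e. the completion of an algebraic closure of the completion of $\mathbb{C}(q)$. Let $\mathcal{M}$ be the field of meromorphic functions on $\mathcal{C}\smallsetminus\{0\}$, i.e. the field of quotients of Laurent series $\sum_{n\in\mathbb{Z}}a_nx^n$ with $a_n\in\mathcal{C}$ that converge for every $x\in\mathcal{C}\smallsetminus\{0\}$. Let $\sigma_q:f(x)\mapsto f(qx)$ and $\partial_x=x\frac{d}{dx}$ on $\mathcal{M}$, and let $\partial_q$ be the derivation of $\mathcal{M}$ that acts on Laurent series coefficientwise by the continuous extension to $\mathcal{C}$ of $q\frac{d}{dq}$. Put $$\theta_q(x)=\sum_{n\in\mathbb{Z}}q^{-n(n-1)/2}x^n,\qquad \ell_q=\frac{\partial_x\theta_q}{\theta_q},\qquad \delta=\ell_q\,\partial_x+\partial_q .$$ Let $\mathcal{E}_q=\{f\in\mathcal{M}:\sigma_q(f)=f\}$ and $\mathcal{F}=\mathcal{E}_q(x,\ell_q)\subset\mathcal{M}$.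 For a derivation $D$ of $\mathcal{M}$ and a subfield $F\subset\mathcal{M}$, say that $u\in\mathcal{M}$ is *differentially algebraic over $(F,D)$* if $P(u,Du,\dots,D^nu)=0$ for some $n\ge 0$ and some nonzero polynomial $P$ with coefficients in $F$. Let $a(x)\in\mathbb{C}(q,x)$ and let $u\in\mathcal{M}$, $u\neq0$, be a solution of $y(qx)=a(x)y(x)$. The following are equivalent: 1. there exist $r\in\mathbb{Z}$, a nonzero $g(x)\in\mathbb{C}(q,x)$ and $\mu\in\mathbb{C}(q)$ such that $a(x)=\mu\,x^r\,g(qx)/g(x)$; 2. $u$ is differentially algebraic over $(\mathcal{F},\partial_x)$; 3. $u$ is differentially algebraic over $(\mathcal{C}(x),\partial_x)$; 4. $u$ is differentially algebraic over $(\mathcal{F},\delta)$; 5. $u$ is differentially algebraic over $(\mathcal{C}(x),\delta)$, that is, $u$ satisfies a nontrivial algebraic equation in $u,\delta u,\delta^2u,\dots$ with coefficients in $\mathcal{C}(x)$ (a field that is not itself stable under $\delta$). -/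

import Mathlib

namespace QDiff
noncomputable section

/-- Derivations (additive maps satisfying the Leibniz rule) of a commutative ring. -/
abbrev Der (R : Type*) [CommRing R] := Derivation ℤ R R

/-- A derivation from an additive map with the Leibniz rule. -/
def Der.mk {R : Type*} [CommRing R] (f : R →+ R) (h : ∀ a b, f (a * b) = a * f b + b * f a) :
    Der R :=
  Derivation.mk' f.toIntLinearMap h

theorem Der.mk_apply {R : Type*} [CommRing R] (f : R →+ R)
    (h : ∀ a b, f (a * b) = a * f b + b * f a) (a : R) : Der.mk f h a = f a := rfl

/-- The extension of a derivation `D` of `S` to a formally étale `S`-algebra `T`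
(used for algebraic extensions of fields and for fields of fractions, where it is the unique
derivation of `T` extending `D`). -/
def extendDerivation {S : Type*} (T : Type*) [CommRing S] [CommRing T] [Algebra S T]
    [Algebra.FormallyEtale S T] (D : Der S) : Der T :=
  ((((Algebra.linearMap S T).compDer D).liftKaehlerDifferential.liftBaseChange T).comp
    (KaehlerDifferential.tensorKaehlerEquivOfFormallyEtale ℤ S T).symm.toLinearMap).compDer
      (KaehlerDifferential.D ℤ T)

theorem extendDerivation_algebraMap {S : Type*} (T : Type*) [CommRing S] [CommRing T] [Algebra S T]
    [Algebra.FormallyEtale S T] (D : Der S) (s : S) :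
    extendDerivation T D (algebraMap S T s) = algebraMap S T (D s) := by
  simp [extendDerivation, KaehlerDifferential.tensorKaehlerEquivOfFormallyEtale_symm_D_algebraMap]

theorem continuous_of_norm_le {k : Type*} [NormedField k] (D : Der k)
    (hD : ∀ x, ‖D x‖ ≤ ‖x‖) : Continuous (D : k →+ k) :=
  (AddMonoidHomClass.lipschitz_of_bound (D : k →+ k) 1 (by simpa using hD)).continuous

/-- The continuous extension to the completion of a derivation that does not increase the norm. -/
def completeDerivation {k : Type*} [NormedField k] (D : Der k)
    (hD : ∀ x, ‖D x‖ ≤ ‖x‖) :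
    Der (UniformSpace.Completion k) :=
  Der.mk ((D : k →+ k).completion (continuous_of_norm_le D hD)) (by
    intro a b
    have hC := AddMonoidHom.continuous_completion (D : k →+ k) (continuous_of_norm_le D hD)
    induction a, b using UniformSpace.Completion.induction_on₂ with
    | hp =>
      exact isClosed_eq (hC.comp continuous_mul)
        ((continuous_fst.mul (hC.comp continuous_snd)).add
          (continuous_snd.mul (hC.comp continuous_fst)))
    | ih a b =>
      rw [← UniformSpace.Completion.coe_mul]
      simp only [AddMonoidHom.completion_coe]
      norm_cast
      simp)

theorem completeDerivation_coe {k : Type*} [NormedField k] (D : Der k)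
    (hD : ∀ x, ‖D x‖ ≤ ‖x‖) (x : k) :
    completeDerivation D hD (x : UniformSpace.Completion k) = (D x : UniformSpace.Completion k) :=
  AddMonoidHom.completion_coe _ (continuous_of_norm_le D hD) x

theorem norm_completeDerivation_le {k : Type*} [NormedField k] (D : Der k)
    (hD : ∀ x, ‖D x‖ ≤ ‖x‖) (x : UniformSpace.Completion k) :
    ‖completeDerivation D hD x‖ ≤ ‖x‖ := by
  have hC := AddMonoidHom.continuous_completion (D : k →+ k) (continuous_of_norm_le D hD)
  induction x using UniformSpace.Completion.induction_on with
  | hp => exact isClosed_le (continuous_norm.comp hC) continuous_norm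
  | ih x => rw [completeDerivation_coe]; simpa using hD x

theorem isUltrametricDist_completion {k : Type*} [NormedField k] [IsUltrametricDist k] :
    IsUltrametricDist (UniformSpace.Completion k) := by
  refine IsUltrametricDist.isUltrametricDist_of_forall_norm_add_le_max_norm fun x y => ?_
  induction x, y using UniformSpace.Completion.induction_on₂ with
  | hp => exact isClosed_le (by fun_prop) (by fun_prop)
  | ih x y =>
    rw [← UniformSpace.Completion.coe_add]
    simpa using IsUltrametricDist.norm_add_le_max x y


section bound

variable {K L : Type*} [NontriviallyNormedField K] [CompleteSpace K] [IsUltrametricDist K]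
  [NormedField L] [NormedAlgebra K L] [Algebra.IsAlgebraic K L]

theorem norm_pow_natDegree (y : L) :
    ‖y‖ ^ (minpoly K y).natDegree = ‖(minpoly K y).coeff 0‖ := by
  rw [NormedAlgebra.norm_eq_spectralNorm K y, spectralNorm.spectralNorm_eq_norm_coeff_zero_rpow,
    ← Real.rpow_natCast, ← Real.rpow_mul (norm_nonneg _), one_div, inv_mul_cancel₀, Real.rpow_one]
  exact_mod_cast (minpoly.natDegree_pos (Algebra.IsIntegral.isIntegral y)).ne'

theorem exists_const_near [IsUltrametricDist L] (c : ℂ →+* K)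
    (happ : ∀ x : K, ‖x‖ ≤ 1 → ∃ z, ‖x - c z‖ < 1) (u : L) (hu : ‖u‖ ≤ 1) :
    ∃ z, ‖u - algebraMap K L (c z)‖ < 1 := by
  have hint : IsIntegral K u := Algebra.IsIntegral.isIntegral u
  set p := minpoly K u with hp
  have hmon : p.Monic := minpoly.monic hint
  have hcoef : ∀ n, ‖p.coeff n‖ ≤ 1 := by
    intro n
    have h1 : spectralValue p ≤ 1 := by
      rw [NormedAlgebra.norm_eq_spectralNorm K u] at hu; exact hu
    exact (spectralValue_le_one_iff hmon).1 h1 n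
  choose z hz using fun n => happ (p.coeff n) (hcoef n)
  let p0 : Polynomial ℂ := Polynomial.X ^ p.natDegree +
    ∑ i ∈ Finset.range p.natDegree, Polynomial.C (z i) * Polynomial.X ^ i
  have hdeg : (∑ i ∈ Finset.range p.natDegree, Polynomial.C (z i) * Polynomial.X ^ i).degree
      < (p.natDegree : WithBot ℕ) := by
    refine lt_of_le_of_lt (Polynomial.degree_sum_le _ _) ?_
    rw [Finset.sup_lt_iff (WithBot.bot_lt_coe _)]
    intro i hi
    exact lt_of_le_of_lt (Polynomial.degree_C_mul_X_pow_le _ _)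
      (by exact_mod_cast Finset.mem_range.1 hi)
  have hp0 : p0.Monic := Polynomial.monic_X_pow_add hdeg
  let φ : ℂ →+* L := (algebraMap K L).comp c
  have hev : ‖p0.eval₂ φ u‖ < 1 := by
    have e : p0.eval₂ φ u = ∑ i ∈ Finset.range p.natDegree,
        (algebraMap K L (c (z i) - p.coeff i)) * u ^ i := by
      have h0 : Polynomial.aeval u p = 0 := minpoly.aeval K u
      rw [hmon.as_sum] at h0
      simp only [map_add, map_sum, map_mul, map_pow, Polynomial.aeval_X, Polynomial.aeval_C] at h0
      simp only [p0, Polynomial.eval₂_add, Polynomial.eval₂_finsetSum, Polynomial.eval₂_mul,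
        Polynomial.eval₂_pow, Polynomial.eval₂_X, Polynomial.eval₂_C, φ, RingHom.comp_apply,
        map_sub, sub_mul, Finset.sum_sub_distrib]
      linear_combination h0
    rw [e]
    obtain h0 | hne := (Finset.range p.natDegree).eq_empty_or_nonempty
    · rw [h0]; simp
    · obtain ⟨i, -, hi⟩ := IsUltrametricDist.exists_norm_finsetSum_le
        (Finset.range p.natDegree) (fun i => (algebraMap K L (c (z i) - p.coeff i)) * u ^ i)
      refine lt_of_le_of_lt hi ?_
      rw [norm_mul, norm_pow, norm_algebraMap', norm_sub_rev]
      calc _ ≤ ‖p.coeff i - c (z i)‖ * 1 := by gcongr; exact pow_le_one₀ (norm_nonneg _) hu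
        _ < 1 := by simpa using hz i
  have hsplit := (IsAlgClosed.splits p0).eq_prod_roots_of_monic hp0
  rw [hsplit, Polynomial.eval₂_multiset_prod, Multiset.map_map] at hev
  by_contra! hcon
  have : ∀ s : Multiset ℂ, 1 ≤ ‖(s.map ((Polynomial.eval₂ φ u) ∘
      fun a => Polynomial.X - Polynomial.C a)).prod‖ := by
    intro s
    induction s using Multiset.induction_on with
    | empty => simp
    | cons a s ih =>
      rw [Multiset.map_cons, Multiset.prod_cons, norm_mul]
      refine one_le_mul_of_one_le_of_one_le ?_ ih
      simpa [φ] using hcon a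
  exact absurd hev (not_lt.2 (this _))

theorem norm_extendDerivation_le [IsUltrametricDist L] [Algebra.FormallyEtale K L]
    (D : Der K) (hD : ∀ x, ‖D x‖ ≤ ‖x‖) (d : ℝ) (hd : 1 < d)
    (hval : ∀ x : K, x ≠ 0 → ∃ n : ℤ, ‖x‖ = d ^ n)
    (c : ℂ →+* K) (hc : ∀ z, z ≠ 0 → ‖c z‖ = 1) (hDc : ∀ z, D (c z) = 0)
    (happ : ∀ x : K, ‖x‖ ≤ 1 → ∃ z, ‖x - c z‖ < 1) (x : L) :
    ‖extendDerivation L D x‖ ≤ ‖x‖ := by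
  set D' := extendDerivation L D with hD'
  have hext : ∀ s, D' (algebraMap K L s) = algebraMap K L (D s) := extendDerivation_algebraMap L D
  let E : IntermediateField K L := IntermediateField.adjoin K {x}
  have hfin : FiniteDimensional K E :=
    IntermediateField.adjoin.finiteDimensional (Algebra.IsIntegral.isIntegral x)
  -- the derivation is bounded on `E`
  obtain ⟨C, hC0, hC⟩ : ∃ C : ℝ, 0 ≤ C ∧ ∀ y ∈ E, ‖D' y‖ ≤ C * ‖y‖ := by
    let b := Module.finBasis K E
    let f : ∀ i, E →L[K] K := fun i => LinearMap.toContinuousLinearMap (b.coord i)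
    refine ⟨∑ i, ‖f i‖ * (‖(b i : L)‖ + ‖D' (b i)‖), by positivity, fun y hy => ?_⟩
    have hy' : y = ∑ i, algebraMap K L (f i ⟨y, hy⟩) * (b i : L) := by
      have := congrArg (Subtype.val) (b.sum_repr ⟨y, hy⟩).symm
      simpa [f, Algebra.smul_def] using this
    conv_lhs => rw [hy']
    rw [map_sum, Finset.sum_mul]
    refine (norm_sum_le _ _).trans (Finset.sum_le_sum fun i _ => ?_)
    have h1 : ‖f i ⟨y, hy⟩‖ ≤ ‖f i‖ * ‖y‖ := (f i).le_opNorm ⟨y, hy⟩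
    rw [Derivation.leibniz, hext, smul_eq_mul, smul_eq_mul]
    calc _ ≤ ‖f i ⟨y, hy⟩‖ * ‖D' (b i)‖ + ‖(b i : L)‖ * ‖D (f i ⟨y, hy⟩)‖ := by
          refine (norm_add_le _ _).trans ?_
          simp [norm_mul, norm_algebraMap']
      _ ≤ (‖f i‖ * ‖y‖) * ‖D' (b i)‖ + ‖(b i : L)‖ * (‖f i‖ * ‖y‖) := by
          gcongr
          exact (hD _).trans h1
      _ = _ := by ring
  -- a gap below `1` in the set of norms of elements of `E`
  obtain ⟨ρ, hρ0, hρ1, hρ⟩ : ∃ ρ : ℝ, 0 ≤ ρ ∧ ρ < 1 ∧ ∀ v ∈ E, ‖v‖ < 1 → ‖v‖ ≤ ρ := by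
    let N := Module.finrank K E
    have hN : N ≠ 0 := Module.finrank_pos.ne'
    have hd0 : 0 < d := by linarith
    refine ⟨(d⁻¹) ^ ((N : ℝ)⁻¹), by positivity,
      Real.rpow_lt_one (by positivity) (inv_lt_one_of_one_lt₀ hd) (by positivity),
      fun v hv hv1 => ?_⟩
    rcases eq_or_ne v 0 with rfl | hv0
    · simp; positivity
    rw [Real.le_rpow_inv_iff_of_pos (norm_nonneg _) (by positivity) (by positivity),
      Real.rpow_natCast]
    have hdeg : (minpoly K v).natDegree ≤ N := by
      have := minpoly.natDegree_le (A := K) (⟨v, hv⟩ : E)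
      rwa [IntermediateField.minpoly_eq] at this
    refine (pow_le_pow_of_le_one (norm_nonneg _) hv1.le hdeg).trans ?_
    have hc0 : (minpoly K v).coeff 0 ≠ 0 :=
      minpoly.coeff_zero_ne_zero (Algebra.IsIntegral.isIntegral v) hv0
    obtain ⟨n, hn⟩ := hval _ hc0
    rw [norm_pow_natDegree, hn]
    have : ‖v‖ ^ (minpoly K v).natDegree < 1 :=
      pow_lt_one₀ (norm_nonneg _) hv1
        (minpoly.natDegree_pos (Algebra.IsIntegral.isIntegral v)).ne'
    rw [norm_pow_natDegree, hn, zpow_lt_one_iff_right₀ hd] at this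
    rw [← zpow_neg_one]
    exact zpow_le_zpow_right₀ hd.le (by omega)
  have hnat : ∀ m : ℕ, m ≠ 0 → ‖(m : L)‖ = 1 := by
    intro m hm
    have := hc m (by exact_mod_cast hm)
    rw [map_natCast] at this
    rw [← map_natCast (algebraMap K L), norm_algebraMap', this]
  -- improving a bound
  have step : ∀ C : ℝ, 0 ≤ C → (∀ y ∈ E, ‖D' y‖ ≤ C * ‖y‖) →
      ∀ y ∈ E, ‖D' y‖ ≤ max 1 (ρ * C) * ‖y‖ := by
    intro C hC0 hC y hy
    rcases eq_or_ne y 0 with rfl | hy0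
    · simp
    set m := (minpoly K y).natDegree with hm
    have hm0 : m ≠ 0 := (minpoly.natDegree_pos (Algebra.IsIntegral.isIntegral y)).ne'
    set e := (minpoly K y).coeff 0 with he
    have he0 : e ≠ 0 := minpoly.coeff_zero_ne_zero (Algebra.IsIntegral.isIntegral y) hy0
    have hye : ‖y‖ ^ m = ‖e‖ := norm_pow_natDegree y
    have heL : algebraMap K L e ≠ 0 := by simpa using he0
    set w := y ^ m / algebraMap K L e with hw
    have hwE : w ∈ E := E.div_mem (pow_mem hy m) (E.algebraMap_mem e)
    have hw1 : ‖w‖ = 1 := by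
      rw [hw, norm_div, norm_pow, hye, norm_algebraMap', div_self (norm_ne_zero_iff.2 he0)]
    obtain ⟨z, hz⟩ := exists_const_near c happ w hw1.le
    have hz0 : z ≠ 0 := by
      rintro rfl
      simp [hw1] at hz
    have hDw : ‖D' w‖ ≤ ρ * C := by
      have h1 : D' w = D' (w - algebraMap K L (c z)) := by
        rw [map_sub, hext, hDc, map_zero, sub_zero]
      have hmem : w - algebraMap K L (c z) ∈ E := E.sub_mem hwE (E.algebraMap_mem _)
      rw [h1, mul_comm]
      exact (hC _ hmem).trans (mul_le_mul_of_nonneg_left (hρ _ hmem hz) hC0)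
    have hprod : y ^ m = algebraMap K L e * w := by rw [hw]; field_simp
    have hder := congrArg D' hprod
    rw [Derivation.leibniz_pow, Derivation.leibniz, hext] at hder
    simp only [smul_eq_mul, nsmul_eq_mul] at hder
    have hn := congrArg norm hder
    rw [norm_mul, norm_mul, norm_pow, hnat m hm0, one_mul] at hn
    have hle : ‖y‖ ^ (m - 1) * ‖D' y‖ ≤ ‖e‖ * max 1 (ρ * C) := by
      rw [hn]
      refine (IsUltrametricDist.norm_add_le_max _ _).trans (max_le ?_ ?_)
      · rw [norm_mul, norm_algebraMap']
        gcongr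
        exact hDw.trans (le_max_right _ _)
      · rw [norm_mul, hw1, one_mul, norm_algebraMap']
        calc _ ≤ ‖e‖ * 1 := by simpa using hD e
          _ ≤ _ := by gcongr; exact le_max_left _ _
    have hypos : 0 < ‖y‖ ^ (m - 1) := pow_pos (norm_pos_iff.2 hy0) _
    refine le_of_mul_le_mul_left (hle.trans_eq ?_) hypos
    rw [← hye]
    have hpow : ‖y‖ ^ m = ‖y‖ ^ (m - 1) * ‖y‖ := by
      rw [← pow_succ, Nat.sub_add_cancel (Nat.pos_of_ne_zero hm0)]
    rw [hpow]; ring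
  have iter : ∀ n : ℕ, ∀ y ∈ E, ‖D' y‖ ≤ max 1 (ρ ^ n * C) * ‖y‖ := by
    intro n
    induction n with
    | zero =>
      intro y hy
      refine (hC y hy).trans ?_
      gcongr
      simp
    | succ n ih =>
      intro y hy
      refine (step _ (by positivity) ih y hy).trans (mul_le_mul_of_nonneg_right ?_ (norm_nonneg _))
      refine max_le (le_max_left _ _) ?_
      rw [mul_max_of_nonneg _ _ hρ0]
      refine max_le (le_max_of_le_left (by linarith)) (le_max_of_le_right (le_of_eq (by ring)))
  have hlim : Filter.Tendsto (fun n : ℕ => ρ ^ n * C) Filter.atTop (nhds 0) := by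
    simpa using (tendsto_pow_atTop_nhds_zero_of_lt_one hρ0 hρ1).mul_const C
  obtain ⟨n, hn⟩ := (hlim.eventually (gt_mem_nhds one_pos)).exists
  have := iter n x (IntermediateField.mem_adjoin_simple_self K x)
  rwa [max_eq_left hn.le, one_mul] at this

end bound

/-! ### The field `ℂ(q)` with the `q⁻¹`-adic norm -/

/-- The field `ℂ(q)`, to be normed by `|f / g| = d ^ (deg f - deg g)`. -/
def RatC (_d : ℝ) : Type := RatFunc ℂ

instance (d : ℝ) : Field (RatC d) := inferInstanceAs (Field (RatFunc ℂ))
instance (d : ℝ) : Algebra (Polynomial ℂ) (RatC d) :=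
  inferInstanceAs (Algebra (Polynomial ℂ) (RatFunc ℂ))
instance (d : ℝ) : IsFractionRing (Polynomial ℂ) (RatC d) :=
  inferInstanceAs (IsFractionRing (Polynomial ℂ) (RatFunc ℂ))
instance (d : ℝ) : Algebra.FormallyEtale (Polynomial ℂ) (RatC d) :=
  Algebra.FormallyEtale.of_isLocalization (nonZeroDivisors (Polynomial ℂ))

/-- The `q⁻¹`-adic norm on `ℂ(q)`. -/
def ratNorm (d : ℝ) (f : RatC d) : ℝ :=
  open Classical in if f = 0 then 0 else d ^ RatFunc.intDegree f

theorem ratNorm_of_ne (d : ℝ) {f : RatC d} (hf : f ≠ 0) : ratNorm d f = d ^ RatFunc.intDegree f :=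
  if_neg hf

theorem ratNorm_zero (d : ℝ) : ratNorm d 0 = 0 := if_pos rfl

theorem ratNorm_pos (d : ℝ) [hd : Fact (1 < d)] {f : RatC d} (hf : f ≠ 0) : 0 < ratNorm d f := by
  rw [ratNorm_of_ne d hf]; exact zpow_pos (by linarith [hd.out]) _

theorem ratNorm_nonneg (d : ℝ) [hd : Fact (1 < d)] (f : RatC d) : 0 ≤ ratNorm d f := by
  rcases eq_or_ne f 0 with rfl | hf
  · rw [ratNorm_zero]
  · exact (ratNorm_pos d hf).le

theorem ratNorm_neg (d : ℝ) (f : RatC d) : ratNorm d (-f) = ratNorm d f := by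
  rcases eq_or_ne f 0 with rfl | hf
  · rw [neg_zero]
  · rw [ratNorm_of_ne d hf, ratNorm_of_ne d (neg_ne_zero.2 hf)]
    exact congrArg (d ^ ·) (RatFunc.intDegree_neg _)

theorem ratNorm_add (d : ℝ) [hd : Fact (1 < d)] (f g : RatC d) : ratNorm d (f + g) ≤ max (ratNorm d f) (ratNorm d g) := by
  rcases eq_or_ne f 0 with rfl | hf
  · simp
  rcases eq_or_ne g 0 with rfl | hg
  · simp
  rcases eq_or_ne (f + g) 0 with h | h
  · rw [h, ratNorm_zero]; exact le_max_of_le_left (ratNorm_nonneg d f)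
  rw [ratNorm_of_ne d hf, ratNorm_of_ne d hg, ratNorm_of_ne d h]
  have h1 : 1 < d := hd.out
  rcases le_max_iff.1 (RatFunc.intDegree_add_le hg h) with h2 | h2
  · exact le_max_of_le_left (zpow_le_zpow_right₀ h1.le h2)
  · exact le_max_of_le_right (zpow_le_zpow_right₀ h1.le h2)

theorem ratNorm_mul (d : ℝ) [hd : Fact (1 < d)] (f g : RatC d) : ratNorm d (f * g) = ratNorm d f * ratNorm d g := by
  rcases eq_or_ne f 0 with rfl | hf
  · simp [ratNorm_zero]
  rcases eq_or_ne g 0 with rfl | hg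
  · simp [ratNorm_zero]
  rw [ratNorm_of_ne d hf, ratNorm_of_ne d hg, ratNorm_of_ne d (mul_ne_zero hf hg),
    ← zpow_add₀ (by linarith [hd.out])]
  exact congrArg (d ^ ·) (RatFunc.intDegree_mul hf hg)

section

variable (d : ℝ) [hd : Fact (1 < d)]

instance : NormedField (RatC d) where
  norm := ratNorm d
  dist f g := ratNorm d (f - g)
  dist_self f := by rw [sub_self, ratNorm_zero]
  dist_comm f g := by rw [← neg_sub, ratNorm_neg]
  dist_triangle f g h := by
    rw [← sub_add_sub_cancel f g h]
    exact (ratNorm_add d _ _).trans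
      (max_le_add_of_nonneg (ratNorm_nonneg d _) (ratNorm_nonneg d _))
  eq_of_dist_eq_zero {f g} h := by
    by_contra hne
    exact (ratNorm_pos d (sub_ne_zero.2 hne)).ne' h
  dist_eq f g := by rw [neg_add_eq_sub, ← neg_sub, ratNorm_neg]
  norm_mul := ratNorm_mul d

theorem RatC.norm_def {f : RatC d} (hf : f ≠ 0) : ‖f‖ = d ^ RatFunc.intDegree f :=
  ratNorm_of_ne d hf

instance : IsUltrametricDist (RatC d) :=
  IsUltrametricDist.isUltrametricDist_of_forall_norm_add_le_max_norm (ratNorm_add d)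

/-- The constants `ℂ ⊆ ℂ(q)`. -/
def RatC.const : ℂ →+* RatC d := (algebraMap (Polynomial ℂ) (RatC d)).comp Polynomial.C

/-- The element `q` of `ℂ(q)`. -/
def RatC.q : RatC d := algebraMap (Polynomial ℂ) (RatC d) Polynomial.X

theorem RatC.norm_poly {p : Polynomial ℂ} (hp : p ≠ 0) :
    ‖algebraMap (Polynomial ℂ) (RatC d) p‖ = d ^ p.natDegree := by
  have h0 : algebraMap (Polynomial ℂ) (RatC d) p ≠ 0 := by
    rwa [Ne, FaithfulSMul.algebraMap_eq_zero_iff]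
  rw [RatC.norm_def d h0, ← zpow_natCast]
  exact congrArg (d ^ ·) RatFunc.intDegree_polynomial

theorem RatC.norm_q : ‖RatC.q d‖ = d := by
  rw [RatC.q, RatC.norm_poly d Polynomial.X_ne_zero]; simp

theorem RatC.norm_const {z : ℂ} (hz : z ≠ 0) : ‖RatC.const d z‖ = 1 := by
  rw [RatC.const, RingHom.comp_apply, RatC.norm_poly d (Polynomial.C_ne_zero.2 hz)]; simp

/-- The derivation `X d/dX` of `ℂ[X]`. -/
def polyDeriv : Der (Polynomial ℂ) :=
  Der.mk ((AddMonoidHom.mulLeft Polynomial.X).comp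
    (Polynomial.derivative (R := ℂ)).toAddMonoidHom) fun p s => by
      simp [Polynomial.derivative_mul]; ring

/-- The derivation `∂_q = q d/dq` of `ℂ(q)`. -/
def RatC.deriv : Der (RatC d) :=
  extendDerivation (RatC d) polyDeriv

theorem RatC.deriv_poly (p : Polynomial ℂ) :
    RatC.deriv d (algebraMap (Polynomial ℂ) (RatC d) p) =
      algebraMap (Polynomial ℂ) (RatC d) (Polynomial.X * Polynomial.derivative p) := by
  rw [RatC.deriv, extendDerivation_algebraMap]; rfl

theorem RatC.norm_deriv_poly_le (p : Polynomial ℂ) :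
    ‖RatC.deriv d (algebraMap (Polynomial ℂ) (RatC d) p)‖ ≤
      ‖algebraMap (Polynomial ℂ) (RatC d) p‖ := by
  rw [RatC.deriv_poly]
  rcases eq_or_ne (Polynomial.X * Polynomial.derivative p) 0 with h | h
  · rw [h, map_zero, norm_zero]; exact norm_nonneg _
  have hp : p ≠ 0 := by rintro rfl; simp at h
  rw [RatC.norm_poly d h, RatC.norm_poly d hp]
  have hd' : Polynomial.derivative p ≠ 0 := right_ne_zero_of_mul h
  have hn : p.natDegree ≠ 0 := by
    intro h0
    exact hd' (Polynomial.derivative_of_natDegree_zero h0)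
  refine pow_le_pow_right₀ hd.out.le ?_
  rw [Polynomial.natDegree_X_mul hd']
  have := Polynomial.natDegree_derivative_lt hn
  omega

theorem RatC.norm_deriv_le (f : RatC d) : ‖RatC.deriv d f‖ ≤ ‖f‖ := by
  obtain ⟨p, s, hs, rfl⟩ := IsFractionRing.div_surjective (A := Polynomial ℂ) f
  set P := algebraMap (Polynomial ℂ) (RatC d) p
  set S := algebraMap (Polynomial ℂ) (RatC d) s
  have hS : S ≠ 0 := by
    rw [Ne, FaithfulSMul.algebraMap_eq_zero_iff]; exact nonZeroDivisors.ne_zero hs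
  have h := congrArg (RatC.deriv d) (div_mul_cancel₀ P hS)
  rw [Derivation.leibniz, smul_eq_mul, smul_eq_mul] at h
  have h2 : S * RatC.deriv d (P / S) = RatC.deriv d P - P / S * RatC.deriv d S := by
    rw [← h]; ring
  have h3 : ‖S‖ * ‖RatC.deriv d (P / S)‖ ≤ ‖S‖ * ‖P / S‖ := by
    rw [← norm_mul, h2, sub_eq_add_neg]
    refine (IsUltrametricDist.norm_add_le_max _ _).trans (max_le ?_ ?_)
    · refine (RatC.norm_deriv_poly_le d p).trans_eq ?_
      rw [← norm_mul, mul_div_cancel₀ _ hS]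
    · rw [norm_neg, norm_mul, mul_comm]
      gcongr
      exact RatC.norm_deriv_poly_le d s
  exact le_of_mul_le_mul_left h3 (norm_pos_iff.2 hS)

theorem RatC.exists_const_near (f : RatC d) (hf : ‖f‖ ≤ 1) :
    ∃ z, ‖f - RatC.const d z‖ < 1 := by
  obtain ⟨p, s, hs, rfl⟩ := IsFractionRing.div_surjective (A := Polynomial ℂ) f
  have hs0 : s ≠ 0 := nonZeroDivisors.ne_zero hs
  set S := algebraMap (Polynomial ℂ) (RatC d) s with hSdef
  have hS : S ≠ 0 := by
    rw [Ne, FaithfulSMul.algebraMap_eq_zero_iff]; exact hs0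
  have hS' : 0 < ‖S‖ := norm_pos_iff.2 hS
  set z := p.coeff s.natDegree / s.leadingCoeff with hz
  refine ⟨z, ?_⟩
  have key : algebraMap (Polynomial ℂ) (RatC d) p / S - RatC.const d z =
      algebraMap (Polynomial ℂ) (RatC d) (p - Polynomial.C z * s) / S := by
    rw [map_sub, map_mul, sub_div, mul_div_assoc, ← hSdef, div_self hS, mul_one]; rfl
  rw [key, norm_div, div_lt_one hS']
  rcases eq_or_ne (p - Polynomial.C z * s) 0 with h | h
  · rw [h, map_zero, norm_zero]; exact hS'
  have hpdeg : p.natDegree ≤ s.natDegree := by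
    rcases eq_or_ne p 0 with rfl | hp
    · simp
    rw [norm_div, div_le_one hS', hSdef, RatC.norm_poly d hp, RatC.norm_poly d hs0] at hf
    exact (pow_le_pow_iff_right₀ hd.out).1 hf
  rw [hSdef, RatC.norm_poly d h, RatC.norm_poly d hs0]
  refine pow_lt_pow_right₀ hd.out ?_
  have hle : (p - Polynomial.C z * s).natDegree ≤ s.natDegree :=
    (Polynomial.natDegree_sub_le _ _).trans
      (max_le hpdeg (Polynomial.natDegree_C_mul_le _ _))
  refine lt_of_le_of_ne hle fun heq => h ?_
  rw [← Polynomial.leadingCoeff_eq_zero, Polynomial.leadingCoeff, heq, Polynomial.coeff_sub,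
    Polynomial.coeff_C_mul, hz]
  change _ - _ * s.leadingCoeff = 0
  rw [div_mul_cancel₀ _ (Polynomial.leadingCoeff_ne_zero.2 hs0), sub_self]

/-! ### The complete algebraically closed field `𝒞` -/

/-- The completion of `ℂ(q)`. -/
abbrev RatCompl := UniformSpace.Completion (RatC d)

instance : IsUltrametricDist (RatCompl d) := isUltrametricDist_completion

instance : NontriviallyNormedField (RatCompl d) where
  non_trivial := ⟨(RatC.q d : RatCompl d), by
    rw [UniformSpace.Completion.norm_coe, RatC.norm_q]; exact hd.out⟩

instance : CharZero (RatC d) := charZero_of_injective_algebraMap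
  (R := Polynomial ℂ) (FaithfulSMul.algebraMap_injective _ _)

/-- The ring homomorphism of a normed field into its completion. -/
abbrev toCompl (k : Type*) [NormedField k] : k →+* UniformSpace.Completion k :=
  UniformSpace.Completion.coeRingHom

instance : CharZero (RatCompl d) := charZero_of_injective_ringHom (toCompl (RatC d)).injective

/-- An algebraic closure of the completion of `ℂ(q)`. -/
abbrev RatAlg := AlgebraicClosure (RatCompl d)

/-- The unique extension of the norm to the algebraic closure. -/
instance : NormedField (RatAlg d) := spectralNorm.normedField (RatCompl d) (RatAlg d)

instance : NormedAlgebra (RatCompl d) (RatAlg d) :=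
  spectralNorm.normedAlgebra (RatCompl d) (RatAlg d)

instance : IsUltrametricDist (RatAlg d) := IsUltrametricDist.of_normedAlgebra (RatCompl d)

/-- The field `𝒞`: the smallest normed extension of `ℂ(q)` that is complete and algebraically
closed, that is, the completion of an algebraic closure of the completion of `ℂ(q)`. -/
abbrev CC := UniformSpace.Completion (RatAlg d)

instance : IsUltrametricDist (CC d) := isUltrametricDist_completion

/-- The embedding of `ℂ(q)` in `𝒞`. -/
def ratToCC : RatC d →+* CC d :=
  (toCompl (RatAlg d)).comp ((algebraMap (RatCompl d) (RatAlg d)).comp (toCompl (RatC d)))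

theorem norm_ratToCC (f : RatC d) : ‖ratToCC d f‖ = ‖f‖ := by
  change ‖((algebraMap (RatCompl d) (RatAlg d) (f : RatCompl d) : RatAlg d) : CC d)‖ = _
  rw [UniformSpace.Completion.norm_coe, norm_algebraMap', UniformSpace.Completion.norm_coe]

/-- The element `q` of `𝒞`. -/
def qC : CC d := ratToCC d (RatC.q d)

theorem norm_qC : ‖qC d‖ = d := by rw [qC, norm_ratToCC, RatC.norm_q]

instance : NontriviallyNormedField (CC d) where
  non_trivial := ⟨qC d, by rw [norm_qC]; exact hd.out⟩

instance : CharZero (CC d) := charZero_of_injective_ringHom (ratToCC d).injective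

theorem isAlgClosed_CC : IsAlgClosed (CC d) :=
  IsAlgClosed.of_denseRange UniformSpace.Completion.denseRange_coe

instance : Algebra.FormallyEtale (RatCompl d) (RatAlg d) :=
  Algebra.FormallyEtale.of_isSeparable _ _

/-- The derivation `∂_q` on the completion of `ℂ(q)`. -/
def derivCompl : Der (RatCompl d) :=
  completeDerivation (RatC.deriv d) (RatC.norm_deriv_le d)

/-- The derivation `∂_q` on the algebraic closure. -/
def derivAlg : Der (RatAlg d) :=
  extendDerivation (RatAlg d) (derivCompl d)

theorem RatCompl.exists_coe_near (x : RatCompl d) (ε : ℝ) (hε : 0 < ε) :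
    ∃ f : RatC d, ‖x - f‖ < ε := by
  obtain ⟨f, hf⟩ := (UniformSpace.Completion.denseRange_coe (α := RatC d)).exists_dist_lt x hε
  exact ⟨f, by rwa [← dist_eq_norm]⟩

theorem norm_derivAlg_le (x : RatAlg d) : ‖derivAlg d x‖ ≤ ‖x‖ := by
  refine norm_extendDerivation_le (derivCompl d) (norm_completeDerivation_le _ _) d hd.out ?_
    ((toCompl (RatC d)).comp (RatC.const d)) ?_ ?_ ?_ x
  · intro x hx
    obtain ⟨f, hf⟩ := RatCompl.exists_coe_near d x ‖x‖ (norm_pos_iff.2 hx)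
    have h1 : ‖x‖ = ‖f‖ := by
      have := IsUltrametricDist.norm_eq_of_add_norm_lt_max (x := -x) (y := (f : RatCompl d))
      rw [norm_neg, UniformSpace.Completion.norm_coe] at this
      refine this ?_
      rw [neg_add_eq_sub, norm_sub_rev]
      exact lt_max_of_lt_left hf
    have hf0 : f ≠ 0 := by
      rintro rfl
      rw [norm_zero, norm_eq_zero] at h1
      exact hx h1
    exact ⟨_, h1.trans (RatC.norm_def d hf0)⟩
  · intro z hz
    change ‖((RatC.const d z : RatC d) : RatCompl d)‖ = 1
    rw [UniformSpace.Completion.norm_coe, RatC.norm_const d hz]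
  · intro z
    change completeDerivation _ _ ((RatC.const d z : RatC d) : RatCompl d) = 0
    rw [completeDerivation_coe, RatC.const, RingHom.comp_apply, RatC.deriv_poly]
    simp
  · intro x hx
    obtain ⟨f, hf⟩ := RatCompl.exists_coe_near d x 1 one_pos
    have h1 : ‖f‖ ≤ 1 := by
      have h := IsUltrametricDist.norm_add_le_max x (-(x - (f : RatCompl d)))
      rw [norm_neg, ← sub_eq_add_neg, sub_sub_cancel, UniformSpace.Completion.norm_coe] at h
      exact h.trans (max_le hx hf.le)
    obtain ⟨z, hz⟩ := RatC.exists_const_near d f h1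
    refine ⟨z, ?_⟩
    change ‖x - ((RatC.const d z : RatC d) : RatCompl d)‖ < 1
    rw [← sub_add_sub_cancel x (f : RatCompl d)]
    refine (IsUltrametricDist.norm_add_le_max _ _).trans_lt (max_lt hf ?_)
    rwa [← UniformSpace.Completion.coe_sub, UniformSpace.Completion.norm_coe]

/-- The derivation `∂_q` on `𝒞`: the continuous extension of `q d/dq`. -/
def derivCC : Der (CC d) := completeDerivation (derivAlg d) (norm_derivAlg_le d)

theorem norm_derivCC_le (x : CC d) : ‖derivCC d x‖ ≤ ‖x‖ :=
  norm_completeDerivation_le _ _ x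

theorem derivCC_rat (f : RatC d) : derivCC d (ratToCC d f) = ratToCC d (RatC.deriv d f) := by
  change completeDerivation _ _ ((algebraMap (RatCompl d) (RatAlg d) (f : RatCompl d) : RatAlg d) :
    CC d) = _
  rw [completeDerivation_coe, derivAlg, extendDerivation_algebraMap, derivCompl,
    completeDerivation_coe]
  rfl

end
/-! ### Analytic and meromorphic functions on the punctured line -/

section laurent

variable (C : Type*) [NontriviallyNormedField C]

/-- The (coefficient sequences of) Laurent series `∑ a n * x ^ n`, `n ∈ ℤ`, that converge for all
`x ≠ 0`. -/
def laurentGroup : AddSubgroup (ℤ → C) where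
  carrier := {a | ∀ x : C, x ≠ 0 → Summable fun n : ℤ => a n * x ^ n}
  zero_mem' x _ := by simp
  add_mem' ha hb x hx := by simpa [add_mul] using (ha x hx).add (hb x hx)
  neg_mem' ha x hx := by simpa using (ha x hx).neg

/-- The analytic functions on `C ∖ {0}`, given by their everywhere convergent Laurent series. -/
abbrev AnFun : Type _ := laurentGroup C

variable {C}

theorem summable_half_pow_natAbs : Summable fun n : ℤ => ((1 : ℝ) / 2) ^ n.natAbs :=
  Summable.of_nat_of_neg (by simpa using summable_geometric_two)
    (by simpa using summable_geometric_two)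

/-- Absolute convergence on all circles. -/
theorem AnFun.summable_norm (a : AnFun C) (R : ℝ) (hR : 0 < R) :
    Summable fun n : ℤ => ‖a.1 n‖ * R ^ n := by
  obtain ⟨x, hx⟩ := NormedField.exists_lt_norm C (2 * R)
  obtain ⟨y, hy0, hy⟩ := NormedField.exists_norm_lt C (half_pos hR)
  have hx0 : 0 < ‖x‖ := by linarith
  have bdd : ∀ z : C, z ≠ 0 → ∃ M : ℝ, ∀ n, ‖a.1 n‖ * ‖z‖ ^ n ≤ M := by
    intro z hz
    have h := Metric.isBounded_range_of_tendsto_cofinite (a.2 z hz).tendsto_cofinite_zero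
    obtain ⟨M, hM⟩ := h.exists_norm_le
    exact ⟨M, fun n => by simpa using hM _ (Set.mem_range_self n)⟩
  obtain ⟨M, hM⟩ := bdd x (norm_pos_iff.1 hx0)
  obtain ⟨M', hM'⟩ := bdd y (norm_pos_iff.1 hy0)
  have hM0 : 0 ≤ M := le_trans (by positivity) (hM 0)
  have hM0' : 0 ≤ M' := le_trans (by positivity) (hM' 0)
  refine Summable.of_nonneg_of_le (fun n => by positivity) (fun n => ?_)
    (summable_half_pow_natAbs.mul_left (M + M'))
  obtain ⟨k, rfl | rfl⟩ := n.eq_nat_or_neg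
  · rw [zpow_natCast, Int.natAbs_natCast]
    have h1 : R ^ k ≤ ‖x‖ ^ k * (1 / 2) ^ k := by
      rw [← mul_pow]; exact pow_le_pow_left₀ hR.le (by linarith) _
    have h2 := hM k
    rw [zpow_natCast] at h2
    calc _ ≤ ‖a.1 k‖ * (‖x‖ ^ k * (1 / 2) ^ k) := by gcongr
      _ = (‖a.1 k‖ * ‖x‖ ^ k) * (1 / 2) ^ k := by ring
      _ ≤ (M + M') * (1 / 2) ^ k := by gcongr; linarith
  · rw [zpow_neg, zpow_natCast, Int.natAbs_neg, Int.natAbs_natCast]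
    have h1 : (R ^ k)⁻¹ ≤ (‖y‖ ^ k)⁻¹ * (1 / 2) ^ k := by
      rw [← inv_pow, ← inv_pow, ← mul_pow]
      refine pow_le_pow_left₀ (by positivity) ?_ _
      rw [← div_eq_inv_mul, le_div_iff₀ hy0, ← div_eq_inv_mul, div_le_iff₀ hR]
      linarith
    have h2 := hM' (-(k : ℤ))
    rw [zpow_neg, zpow_natCast] at h2
    calc _ ≤ ‖a.1 (-(k : ℤ))‖ * ((‖y‖ ^ k)⁻¹ * (1 / 2) ^ k) := by gcongr
      _ = (‖a.1 (-(k : ℤ))‖ * (‖y‖ ^ k)⁻¹) * (1 / 2) ^ k := by ring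
      _ ≤ (M + M') * (1 / 2) ^ k := by gcongr; linarith

theorem AnFun.add_coeff (a b : AnFun C) (n : ℤ) : (a + b).1 n = a.1 n + b.1 n := rfl

theorem AnFun.summable_norm_one (a : AnFun C) : Summable fun n : ℤ => ‖a.1 n‖ := by
  simpa using a.summable_norm 1 one_pos

/-- The bijection `(n, k) ↦ (k, n - k)`. -/
def convEquiv : ℤ × ℤ ≃ ℤ × ℤ where
  toFun p := (p.2, p.1 - p.2)
  invFun p := (p.1 + p.2, p.1)
  left_inv p := by ext <;> simp
  right_inv p := by ext <;> simp

theorem AnFun.summable_conv_norm (a b : AnFun C) (R : ℝ) (hR : 0 < R) :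
    Summable fun p : ℤ × ℤ => ‖a.1 p.2 * b.1 (p.1 - p.2)‖ * R ^ p.1 := by
  have h := (a.summable_norm R hR).mul_of_nonneg (b.summable_norm R hR)
    (fun n => by positivity) (fun n => by positivity)
  refine (convEquiv.summable_iff.2 h).congr fun p => ?_
  simp only [Function.comp, convEquiv, Equiv.coe_fn_mk, norm_mul]
  rw [show R ^ p.1 = R ^ p.2 * R ^ (p.1 - p.2) by rw [← zpow_add₀ hR.ne']; simp]
  ring

variable [CompleteSpace C]

theorem mem_AnFun_of_summable_norm {a : ℤ → C}
    (h : ∀ R : ℝ, 0 < R → Summable fun n : ℤ => ‖a n‖ * R ^ n) : a ∈ laurentGroup C := fun x hx =>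
  Summable.of_norm (by simpa [norm_mul, norm_zpow] using h ‖x‖ (norm_pos_iff.2 hx))

theorem AnFun.bounded (a : AnFun C) : ∃ M : ℝ, ∀ n, ‖a.1 n‖ ≤ M := by
  obtain ⟨M, hM⟩ := (Metric.isBounded_range_of_tendsto_cofinite
    a.summable_norm_one.of_norm.tendsto_cofinite_zero).exists_norm_le
  exact ⟨M, fun n => hM _ (Set.mem_range_self n)⟩

theorem AnFun.summable_conv (a b : AnFun C) (n : ℤ) :
    Summable fun k : ℤ => a.1 k * b.1 (n - k) := by
  have h := (a.summable_conv_norm b 1 one_pos).prod_factor n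
  simp only [one_zpow, mul_one] at h
  exact h.of_norm

/-- The product of Laurent series. -/
instance : Mul (AnFun C) where
  mul a b := ⟨fun n => ∑' k : ℤ, a.1 k * b.1 (n - k), mem_AnFun_of_summable_norm fun R hR => by
    have h := a.summable_conv_norm b R hR
    refine Summable.of_nonneg_of_le (fun n => by positivity) (fun n => ?_) h.prod
    dsimp only
    rw [tsum_mul_right]
    gcongr
    refine norm_tsum_le_tsum_norm ?_
    have h := (a.summable_conv_norm b 1 one_pos).prod_factor n
    simpa only [one_zpow, mul_one] using h⟩

theorem AnFun.mul_coeff (a b : AnFun C) (n : ℤ) :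
    (a * b).1 n = ∑' k : ℤ, a.1 k * b.1 (n - k) := rfl

/-- The Laurent monomial `c * x ^ m`. -/
def AnFun.monomial (m : ℤ) (c : C) : AnFun C :=
  ⟨Pi.single m c, fun x _ => summable_of_ne_finset_zero (s := {m}) fun n hn => by
    rw [Pi.single_eq_of_ne (by simpa using hn), zero_mul]⟩

theorem AnFun.monomial_mul_coeff (m : ℤ) (c : C) (a : AnFun C) (n : ℤ) :
    (AnFun.monomial m c * a).1 n = c * a.1 (n - m) := by
  rw [AnFun.mul_coeff, tsum_eq_single m]
  · simp [AnFun.monomial]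
  · intro k hk
    simp [AnFun.monomial, Pi.single_eq_of_ne hk]

theorem AnFun.mul_comm' (a b : AnFun C) : a * b = b * a := by
  ext n
  rw [AnFun.mul_coeff, AnFun.mul_coeff, ← (Equiv.subLeft n).tsum_eq]
  exact tsum_congr fun k => by simp [mul_comm]

theorem AnFun.mul_assoc' (a b c : AnFun C) : a * b * c = a * (b * c) := by
  ext n
  obtain ⟨M, hM⟩ := c.bounded
  have hs : Summable fun p : ℤ × ℤ => a.1 p.1 * b.1 p.2 * c.1 (n - p.1 - p.2) := by
    refine Summable.of_norm_bounded ((a.summable_norm_one.mul_of_nonneg b.summable_norm_one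
      (fun _ => norm_nonneg _) (fun _ => norm_nonneg _)).mul_right M) fun p => ?_
    rw [norm_mul, norm_mul]
    gcongr
    exact hM _
  have h1 : (a * (b * c)).1 n = ∑' p : ℤ × ℤ, a.1 p.1 * b.1 p.2 * c.1 (n - p.1 - p.2) := by
    rw [hs.tsum_prod, AnFun.mul_coeff]
    refine tsum_congr fun k => ?_
    rw [AnFun.mul_coeff, ← tsum_mul_left]
    exact tsum_congr fun l => by ring
  have hs' := convEquiv.summable_iff.2 hs
  simp only [Function.comp_def] at hs'
  rw [h1, ← convEquiv.tsum_eq, hs'.tsum_prod, AnFun.mul_coeff]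
  refine tsum_congr fun m => ?_
  rw [AnFun.mul_coeff, ← tsum_mul_right]
  refine tsum_congr fun k => ?_
  simp [convEquiv]

theorem AnFun.one_mul' (a : AnFun C) : AnFun.monomial 0 1 * a = a := by
  ext n; simp [AnFun.monomial_mul_coeff]

theorem AnFun.mul_add' (a b c : AnFun C) : a * (b + c) = a * b + a * c := by
  ext n
  change (a * (b + c)).1 n = (a * b).1 n + (a * c).1 n
  rw [AnFun.mul_coeff, AnFun.mul_coeff, AnFun.mul_coeff,
    ← (a.summable_conv b n).tsum_add (a.summable_conv c n)]
  exact tsum_congr fun k => by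
    rw [← mul_add]; rfl

theorem AnFun.mul_zero' (a : AnFun C) : a * 0 = 0 := by
  ext n
  rw [AnFun.mul_coeff]
  simp

instance : CommRing (AnFun C) :=
  { (inferInstance : AddCommGroup (AnFun C)) with
    mul := (· * ·)
    one := AnFun.monomial 0 1
    mul_assoc := AnFun.mul_assoc'
    mul_comm := AnFun.mul_comm'
    one_mul := AnFun.one_mul'
    mul_one := fun a => (AnFun.mul_comm' _ _).trans (AnFun.one_mul' a)
    left_distrib := AnFun.mul_add'
    right_distrib := fun a b c => by
      rw [AnFun.mul_comm', AnFun.mul_add', AnFun.mul_comm' c a, AnFun.mul_comm' c b]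
    zero_mul := fun a => (AnFun.mul_comm' _ _).trans (AnFun.mul_zero' a)
    mul_zero := AnFun.mul_zero' }

theorem AnFun.one_def : (1 : AnFun C) = AnFun.monomial 0 1 := rfl

instance : Nontrivial (AnFun C) := ⟨1, 0, fun h => by
  have := congrArg (fun a : AnFun C => a.1 0) h
  simp [AnFun.one_def, AnFun.monomial] at this⟩

/-- There is a last coefficient of maximal norm. -/
theorem AnFun.exists_last_max (a : AnFun C) (ha : a ≠ 0) :
    ∃ i, a.1 i ≠ 0 ∧ (∀ k, ‖a.1 k‖ ≤ ‖a.1 i‖) ∧ ∀ k, i < k → ‖a.1 k‖ < ‖a.1 i‖ := by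
  obtain ⟨j, hj⟩ : ∃ j, a.1 j ≠ 0 := by
    by_contra! h
    exact ha (Subtype.ext (funext h))
  have hfin : {k : ℤ | ‖a.1 j‖ ≤ ‖a.1 k‖}.Finite := by
    have h := a.summable_norm_one.tendsto_cofinite_zero.eventually
      (gt_mem_nhds (norm_pos_iff.2 hj))
    rw [Filter.eventually_cofinite] at h
    exact h.subset fun k hk => not_lt.2 hk
  obtain ⟨i0, hi0, hmax⟩ := Set.exists_max_image _ (fun k => ‖a.1 k‖) hfin ⟨j, le_refl ‖a.1 j‖⟩
  have hall : ∀ k, ‖a.1 k‖ ≤ ‖a.1 i0‖ := fun k => by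
    by_cases hk : ‖a.1 j‖ ≤ ‖a.1 k‖
    · exact hmax k hk
    · exact (not_le.1 hk).le.trans hi0
  have hfin' : {k : ℤ | ‖a.1 i0‖ ≤ ‖a.1 k‖}.Finite :=
    hfin.subset fun k (hk : ‖a.1 i0‖ ≤ ‖a.1 k‖) => le_trans (b := ‖a.1 i0‖) hi0 hk
  obtain ⟨i, hi, hlast⟩ := Set.exists_max_image _ (fun k => k) hfin' ⟨i0, le_refl ‖a.1 i0‖⟩
  have heq : ‖a.1 i‖ = ‖a.1 i0‖ := le_antisymm (hall i) hi
  refine ⟨i, ?_, fun k => heq ▸ hall k, fun k hk => ?_⟩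
  · rw [← norm_pos_iff, heq]; exact (norm_pos_iff.2 hj).trans_le hi0
  · rw [heq]
    by_contra! h
    exact absurd (hlast k h) (not_le.2 hk)

instance [IsUltrametricDist C] : NoZeroDivisors (AnFun C) where
  eq_zero_or_eq_zero_of_mul_eq_zero {a b} hab := by
    by_contra! hne
    obtain ⟨i, hi0, hi, hi'⟩ := a.exists_last_max hne.1
    obtain ⟨j, hj0, hj, hj'⟩ := b.exists_last_max hne.2
    set t : ℤ → C := fun k => a.1 k * b.1 (i + j - k) with ht
    have hsum : Summable t := a.summable_conv b (i + j)
    have hti : t i = a.1 i * b.1 j := by simp [ht]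
    have hti0 : 0 < ‖t i‖ := by rw [hti]; exact norm_pos_iff.2 (mul_ne_zero hi0 hj0)
    have hlt : ∀ k, k ≠ i → ‖t k‖ < ‖t i‖ := by
      intro k hk
      rw [hti, norm_mul, norm_mul]
      rcases lt_or_gt_of_ne hk with h | h
      · exact mul_lt_mul_of_le_of_lt_of_nonneg_of_pos (hi k) (hj' _ (by omega))
          (norm_nonneg _) (norm_pos_iff.2 hi0)
      · exact mul_lt_mul_of_lt_of_le_of_nonneg_of_pos (hi' k h) (hj _)
          (norm_nonneg _) (norm_pos_iff.2 hj0)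
    have h0 : HasSum t 0 := by
      have h1 : ∑' k, t k = 0 := congrArg (fun c : AnFun C => c.1 (i + j)) hab
      rw [← h1]; exact hsum.hasSum
    have h1 : ∀ᶠ s : Finset ℤ in Filter.atTop, ‖∑ k ∈ s, t k‖ < ‖t i‖ := by
      have := (h0.norm).eventually (gt_mem_nhds (by rwa [norm_zero]))
      exact this
    obtain ⟨s, hs⟩ := (h1.and (Filter.eventually_ge_atTop {i})).exists
    have his : i ∈ s := by simpa using hs.2
    have h2 : ‖∑ k ∈ s.erase i, t k‖ < ‖t i‖ := by
      rcases (s.erase i).eq_empty_or_nonempty with he | he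
      · rw [he]; simpa using hti0
      · obtain ⟨k, hk, hk'⟩ := IsUltrametricDist.exists_norm_finsetSum_le_of_nonempty he t
        exact hk'.trans_lt (hlt k (Finset.ne_of_mem_erase hk))
    rw [← Finset.add_sum_erase s t his, IsUltrametricDist.norm_add_eq_max_of_norm_ne_norm h2.ne',
      max_eq_left h2.le] at hs
    exact lt_irrefl _ hs.1

instance [IsUltrametricDist C] : IsDomain (AnFun C) := NoZeroDivisors.to_isDomain _

/-- The constant functions. -/
def AnFun.const : C →+* AnFun C where
  toFun := AnFun.monomial 0
  map_one' := rfl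
  map_mul' c c' := by
    ext n
    rw [AnFun.monomial_mul_coeff]
    simp only [AnFun.monomial, sub_zero, Pi.single_apply]
    split <;> simp
  map_zero' := by ext n; simp [AnFun.monomial]
  map_add' c c' := by ext n; simp [AnFun.monomial, Pi.single_add]

/-- The function `f(x) ↦ f(y * x)`: the coefficient `a n` becomes `y ^ n * a n`. -/
def AnFun.dilate (y : C) (hy : y ≠ 0) : AnFun C →+* AnFun C where
  toFun a := ⟨fun n => y ^ n * a.1 n, fun x hx =>
    (a.2 (y * x) (mul_ne_zero hy hx)).congr fun n => by rw [mul_zpow]; ring⟩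
  map_one' := by
    ext n
    simp only [AnFun.one_def, AnFun.monomial, Pi.single_apply]
    split <;> simp_all
  map_zero' := by ext n; simp
  map_add' a b := by
    ext n
    simp [mul_add]
  map_mul' a b := by
    ext n
    change y ^ n * (a * b).1 n = _
    rw [AnFun.mul_coeff, AnFun.mul_coeff, ← tsum_mul_left]
    refine tsum_congr fun k => ?_
    rw [show y ^ n = y ^ k * y ^ (n - k) by rw [← zpow_add₀ hy]; simp]
    ring

theorem AnFun.dilate_injective (y : C) (hy : y ≠ 0) :
    Function.Injective (AnFun.dilate y hy) := by
  rw [injective_iff_map_eq_zero]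
  intro a ha
  ext n
  have := congrArg (fun c : AnFun C => c.1 n) ha
  exact (mul_eq_zero.1 this).resolve_left (zpow_ne_zero _ hy)

/-- The derivation `x d/dx`: the coefficient `a n` becomes `n * a n`. -/
def AnFun.derivX : Der (AnFun C) :=
  Der.mk
    { toFun := fun a => ⟨fun n => (n : C) * a.1 n, mem_AnFun_of_summable_norm fun R hR => by
        have h1 := a.summable_norm (R * 2) (by positivity)
        have h2 := a.summable_norm (R * 2⁻¹) (by positivity)
        refine Summable.of_nonneg_of_le (fun n => by positivity) (fun n => ?_) (h1.add h2)
        have hn : ‖(n : C)‖ ≤ (2 : ℝ) ^ n + (2⁻¹ : ℝ) ^ n := by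
          have hcast : ∀ k : ℕ, ‖(k : C)‖ ≤ (2 : ℝ) ^ k := fun k => by
            refine (Nat.norm_cast_le k).trans ?_
            rw [norm_one, mul_one]
            exact_mod_cast Nat.lt_two_pow_self.le
          obtain ⟨k, rfl | rfl⟩ := n.eq_nat_or_neg
          · rw [Int.cast_natCast, zpow_natCast, zpow_natCast]
            exact (hcast k).trans (le_add_of_nonneg_right (by positivity))
          · rw [Int.cast_neg, norm_neg, Int.cast_natCast, inv_zpow', neg_neg, zpow_natCast]
            exact (hcast k).trans (le_add_of_nonneg_left (by positivity))
        rw [norm_mul, mul_zpow, mul_zpow]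
        calc _ ≤ ((2 : ℝ) ^ n + (2⁻¹ : ℝ) ^ n) * ‖a.1 n‖ * R ^ n := by gcongr
          _ = _ := by ring⟩
      map_zero' := by ext n; simp
      map_add' := fun a b => by ext n; simp [mul_add] }
    (fun a b => by
      ext n
      change (n : C) * (a * b).1 n = _
      rw [AnFun.add_coeff, mul_comm b, AnFun.mul_coeff, AnFun.mul_coeff, AnFun.mul_coeff,
        ← tsum_mul_left, ← (AnFun.summable_conv _ _ n).tsum_add (AnFun.summable_conv _ _ n)]
      refine tsum_congr fun k => ?_
      simp only [AddMonoidHom.coe_mk, ZeroHom.coe_mk]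
      push_cast
      ring)

/-- The derivation acting by a norm-non-increasing derivation `D` on the coefficients. -/
def AnFun.derivCoeff (D : Der C) (hD : ∀ c, ‖D c‖ ≤ ‖c‖) : Der (AnFun C) :=
  Der.mk
    { toFun := fun a => ⟨fun n => D (a.1 n), mem_AnFun_of_summable_norm fun R hR =>
        Summable.of_nonneg_of_le (fun n => by positivity)
          (fun n => mul_le_mul_of_nonneg_right (hD _) (by positivity)) (a.summable_norm R hR)⟩
      map_zero' := by ext n; simp
      map_add' := fun a b => by ext n; simp }
    (fun a b => by
      ext n
      have hc : Continuous (D : C →+ C) :=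
        (AddMonoidHomClass.lipschitz_of_bound (D : C →+ C) 1 (by simpa using hD)).continuous
      change (D : C →+ C) ((a * b).1 n) = _
      rw [AnFun.add_coeff, mul_comm b, AnFun.mul_coeff, AnFun.mul_coeff, AnFun.mul_coeff,
        (a.summable_conv b n).map_tsum (D : C →+ C) hc,
        ← (AnFun.summable_conv _ _ n).tsum_add (AnFun.summable_conv _ _ n)]
      refine tsum_congr fun k => ?_
      simp only [AddMonoidHom.coe_mk, ZeroHom.coe_mk, AddMonoidHom.coe_coe, Derivation.leibniz,
        smul_eq_mul]
      ring)

end laurent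
/-! ### The meromorphic functions and their operators -/

section

variable (d : ℝ) [hd : Fact (1 < d)]

/-- The ring of analytic functions on `𝒞 ∖ {0}`. -/
abbrev An := AnFun (CC d)

/-- The field `𝓜` of meromorphic functions on `𝒞 ∖ {0}`: the quotients of analytic functions. -/
abbrev Mer := FractionRing (An d)

instance : Algebra.FormallyEtale (An d) (Mer d) :=
  Algebra.FormallyEtale.of_isLocalization (nonZeroDivisors (An d))

theorem qC_ne_zero : qC d ≠ 0 := by
  rw [← norm_pos_iff, norm_qC]; linarith [hd.out]

/-- The operator `σ_q : f(x) ↦ f(q x)` of `𝓜`. -/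
def sigmaQ : Mer d →+* Mer d :=
  IsFractionRing.lift (A := An d)
    (g := (algebraMap (An d) (Mer d)).comp (AnFun.dilate (qC d) (qC_ne_zero d)))
    ((IsFractionRing.injective (An d) (Mer d)).comp (AnFun.dilate_injective (qC d) (qC_ne_zero d)))

/-- The derivation `∂_x = x d/dx` of `𝓜`. -/
def partialX : Der (Mer d) :=
  extendDerivation (Mer d) (AnFun.derivX : Der (An d))

/-- The derivation `∂_q = q d/dq` of `𝓜`. -/
def partialQ : Der (Mer d) :=
  extendDerivation (Mer d) (AnFun.derivCoeff (derivCC d) (norm_derivCC_le d))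

/-- The constants `𝒞 ⊆ 𝓜`. -/
def constMer : CC d →+* Mer d := (algebraMap (An d) (Mer d)).comp AnFun.const

/-- The function `x`. -/
def xMer : Mer d := algebraMap (An d) (Mer d) (AnFun.monomial 1 1)

theorem theta_mem : (fun n : ℤ => qC d ^ (-(n * (n - 1) / 2))) ∈ laurentGroup (CC d) := by
  refine mem_AnFun_of_summable_norm fun R hR => ?_
  have h1 : 1 < d := hd.out
  have h0 : 0 < d := by linarith
  obtain ⟨M, hM⟩ := pow_unbounded_of_one_lt (max R R⁻¹) h1
  have hM1 : R ≤ d ^ M := (le_max_left _ _).trans hM.le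
  have hM2 : R⁻¹ ≤ d ^ M := (le_max_right _ _).trans hM.le
  have hdi : d⁻¹ < 1 := inv_lt_one_of_one_lt₀ h1
  have hs : Summable fun n : ℤ => (d⁻¹) ^ n.natAbs :=
    Summable.of_nat_of_neg
      (by simpa using summable_geometric_of_lt_one (by positivity) hdi)
      (by simpa using summable_geometric_of_lt_one (by positivity) hdi)
  refine Summable.of_nonneg_of_le (fun n => by positivity) (fun n => ?_)
    (hs.mul_left (d ^ ((M + 2) ^ 2)))
  rw [norm_zpow, norm_qC]
  have hR' : R ^ n ≤ d ^ (M * |n|) := by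
    obtain ⟨k, rfl | rfl⟩ := n.eq_nat_or_neg
    · rw [Nat.abs_cast, zpow_natCast, zpow_mul, zpow_natCast, zpow_natCast]
      exact pow_le_pow_left₀ hR.le hM1 _
    · rw [abs_neg, Nat.abs_cast, zpow_neg, zpow_natCast, zpow_mul, zpow_natCast, zpow_natCast,
        ← inv_pow]
      exact pow_le_pow_left₀ (by positivity) hM2 _
  calc d ^ (-(n * (n - 1) / 2)) * R ^ n
      ≤ d ^ (-(n * (n - 1) / 2)) * d ^ (M * |n|) := by gcongr
    _ = d ^ (-(n * (n - 1) / 2) + M * |n|) := by rw [zpow_add₀ h0.ne']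
    _ ≤ d ^ (((M + 2) ^ 2 : ℕ) - (n.natAbs : ℤ)) := by
        refine zpow_le_zpow_right₀ h1.le ?_
        have hdiv : 2 * (n * (n - 1) / 2) = n * (n - 1) :=
          Int.mul_ediv_cancel' (Int.even_mul_pred_self n).two_dvd
        rw [Int.natCast_natAbs]
        push_cast
        have habs : |n| ^ 2 = n ^ 2 := sq_abs n
        have hle : n ≤ |n| := le_abs_self n
        nlinarith [sq_nonneg (2 * |n| - (2 * (M : ℤ) + 3))]
    _ = d ^ ((M + 2) ^ 2) * d⁻¹ ^ n.natAbs := by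
        rw [zpow_sub₀ h0.ne', zpow_natCast, zpow_natCast, inv_pow, div_eq_mul_inv]

/-- The Jacobi theta function `θ_q(x) = ∑ q ^ (-n(n-1)/2) x ^ n`, `n ∈ ℤ`. -/
def theta : An d :=
  ⟨fun n => qC d ^ (-(n * (n - 1) / 2)), theta_mem d⟩

/-- The logarithmic derivative `ℓ_q = ∂_x(θ_q) / θ_q`. -/
def ellQ : Mer d :=
  partialX d (algebraMap (An d) (Mer d) (theta d)) / algebraMap (An d) (Mer d) (theta d)

/-- The derivation `δ = ℓ_q ∂_x + ∂_q` of `𝓜`. -/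
def delta : Der (Mer d) := ellQ d • partialX d + partialQ d

/-- The field `ℂ(q)` inside `𝓜`. -/
def fieldCq : Subfield (Mer d) := ((constMer d).comp (ratToCC d)).fieldRange

/-- The field `ℂ(q, x)` inside `𝓜`. -/
def fieldCqx : Subfield (Mer d) := fieldCq d ⊔ Subfield.closure {xMer d}

/-- The field `𝒞(x)` inside `𝓜`. -/
def fieldCx : Subfield (Mer d) := (constMer d).fieldRange ⊔ Subfield.closure {xMer d}

/-- The field `𝓔_q` of elliptic functions: the `σ_q`-invariant elements of `𝓜`. -/
def fieldE : Subfield (Mer d) := (sigmaQ d).eqLocusField (RingHom.id (Mer d))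

/-- The field `𝓕 = 𝓔_q(x, ℓ_q)`. -/
def fieldF : Subfield (Mer d) := fieldE d ⊔ Subfield.closure {xMer d, ellQ d}

end

/-- `u` is a solution of a nontrivial algebraic differential equation with respect to the
derivation `D` and with coefficients in the subfield `F`: some nonzero polynomial over `F`
in `Y₀, Y₁, …` vanishes at `Yₙ = Dⁿ(u)`. -/
def IsDiffAlgebraic {M : Type*} [Field M] (D : Der M) (F : Subfield M) (u : M) : Prop :=
  ∃ P : MvPolynomial ℕ F, P ≠ 0 ∧ MvPolynomial.aeval (fun n => D^[n] u) P = 0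

end

end QDiff

/-! Both derivations are handled by one argument. `IsTateSystem` records what is needed: a
derivation D commuting with σ, with σx = qx, σℓ = ℓ + 1 and Dx = κx. For ∂_x one has κ = 1. For δ
one has κ = ℓ_q, and δ commutes with σ_q because the defect of ∂_q, namely ∂_q σ_q = σ_q(∂_q + ∂_x),
is cancelled by ℓ_q ↦ ℓ_q + 1.

From differential algebraicity to the form of a. If u is differentially algebraic over the D-stable
field F = L(x), L = E(ℓ), E the σ-invariants, then so many iterated derivatives of v = Du/u are
algebraically dependent over F (`exists_not_algebraicIndependent_logDeriv`). Since σv = v + Da/a,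
Ostrowski's argument (`exists_telescoper_of_not_algebraicIndependent`) yields σ-invariant c_i, not
all zero, and g ∈ F with ∑ c_i D^i(Da/a) = σg − g. Because x is transcendental over L
(`transcendental_x`), poles in x at points α ≠ 0 of the constant field make sense. At a zero or pole
of a, Da/a has a simple pole, and every D raises its order by exactly one, so the left side has a
pole there. But σg − g cannot have a pole at just one point of an orbit α q^ℤ, so every orbit that
meets the divisor of a away from 0 meets it twice (`exists_other_zero_or_pole`). Two irreducible
factors of a over ℂ(q) with roots in one orbit are rescalings of each other, so their quotient is a
constant times σ^n(w)/w with n ≥ 0, or the inverse of such an expression. Replacing one by the other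
changes a by a multiplier of the desired form, which preserves the telescoper and removes one
irreducible factor. Induction on the number of factors finishes (`isTrivialMultiplier_factorProd`);
no residues are computed.

Conversely, for a = μ x^r σ(g)/g one has Da/a = σs − s with an explicit s ∈ F
(`exists_logDeriv_eq`). Hence Du/u − s is σ-invariant and E(ℓ, x, u) is stable under D. It contains
all derivatives of u and has finite transcendence degree over 𝒞(x), because E has transcendence
degree at most one over 𝒞 (`pairwiseDependent_fieldE`). This only counts dimensions, so the
instability of 𝒞(x) under δ does no harm. The bound on E comes from a nonarchimedean count of zeros
in a fundamental annulus, read off from the indices of dominant Laurent coefficients. -/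

namespace QDiff

/-! ### Ostrowski's theorem on algebraically dependent solutions of σy = y + b -/

section Shift

open MvPolynomial
open scoped MonomialOrder

variable {F ι : Type*} [Field F]

/-- The semilinear substitution `P(Y) ↦ P^τ(Y + b)`. -/
noncomputable def shiftHom (τ : F →+* F) (b : ι → F) : MvPolynomial ι F →+* MvPolynomial ι F :=
  eval₂Hom (C.comp τ) fun i => X i + C (b i)

@[simp] theorem shiftHom_C (τ : F →+* F) (b : ι → F) (c : F) : shiftHom τ b (C c) = C (τ c) := by
  simp [shiftHom]

@[simp] theorem shiftHom_X (τ : F →+* F) (b : ι → F) (i : ι) :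
    shiftHom τ b (X i) = X i + C (b i) := by
  simp [shiftHom]

theorem shiftHom_pderiv (τ : F →+* F) (b : ι → F) (i : ι) (P : MvPolynomial ι F) :
    pderiv i (shiftHom τ b P) = shiftHom τ b (pderiv i P) := by
  classical
  induction P using MvPolynomial.induction_on with
  | C c => simp
  | add p s hp hs => simp [hp, hs]
  | mul_X p j hp =>
    simp only [map_mul, pderiv_mul, shiftHom_X, map_add, pderiv_C, pderiv_X, hp, add_zero]
    congr 2
    rcases eq_or_ne j i with rfl | h
    · simp
    · simp [Pi.single_eq_of_ne h]

variable [Fintype ι]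

/-- The image is the product of the (X_i + b_i)^{s_i}, and in any monomial order a constant lies
below X_i. -/
theorem shiftHom_monic (m : MonomialOrder ι) (τ : F →+* F) (b : ι → F) (s : ι →₀ ℕ) :
    m.degree (shiftHom τ b (monomial s 1)) = s ∧ m.Monic (shiftHom τ b (monomial s 1)) := by
  classical
  have hdeg : ∀ i, m.degree (C (b i) : MvPolynomial ι F) ≺[m] m.degree (X i : MvPolynomial ι F) :=
    fun i => by
      rw [m.degree_C, m.degree_X, map_zero, m.toSyn_lt_iff_ne_zero]
      simp
  have hX : ∀ i, m.Monic (X i + C (b i) : MvPolynomial ι F) := fun i =>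
    m.monic_X.add_of_lt (hdeg i)
  have hm : shiftHom τ b (monomial s 1) = ∏ i, (X i + C (b i)) ^ s i := by
    rw [monomial_eq, Finsupp.prod_fintype _ _ (by simp)]
    simp
  rw [hm]
  refine ⟨?_, MonomialOrder.Monic.prod fun i _ => (hX i).pow⟩
  rw [m.degree_prod fun i _ => ((hX i).pow).ne_zero]
  have : ∀ i, m.degree ((X i + C (b i)) ^ s i : MvPolynomial ι F) = Finsupp.single i (s i) := by
    intro i
    rw [m.degree_pow, m.degree_add_of_lt (hdeg i), m.degree_X]
    simp
  rw [Finset.sum_congr rfl fun i _ => this i]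
  exact Finsupp.univ_sum_single s

/-- A shift does not disturb the leading term beyond applying τ to its coefficient, so for a monic P
the difference between its shift and P drops in the order. -/
theorem shiftHom_degree_le (m : MonomialOrder ι) (τ : F →+* F) (b : ι → F) (P : MvPolynomial ι F) :
    m.degree (shiftHom τ b P) ≼[m] m.degree P ∧
      (shiftHom τ b P).coeff (m.degree P) = τ (P.coeff (m.degree P)) := by
  classical
  have hP : shiftHom τ b P =
      ∑ s ∈ P.support, C (τ (P.coeff s)) * shiftHom τ b (monomial s 1) := by
    conv_lhs => rw [P.as_sum]
    rw [map_sum]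
    refine Finset.sum_congr rfl fun s _ => ?_
    rw [← shiftHom_C τ b, ← map_mul, C_mul_monomial, mul_one]
  constructor
  · rw [hP]
    refine m.degree_sum_le.trans (Finset.sup_le fun s hs => ?_)
    refine m.degree_mul_le.trans ?_
    rw [m.degree_C, zero_add, (shiftHom_monic m τ b s).1]
    exact m.le_degree hs
  · rw [hP, coeff_sum]
    by_cases h0 : P = 0
    · simp [h0]
    rw [Finset.sum_eq_single (m.degree P)]
    · rw [coeff_C_mul]
      have h := shiftHom_monic m τ b (m.degree P)
      have := h.2.coeff_degree
      rw [h.1] at this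
      rw [this, mul_one]
    · intro s hs hne
      rw [coeff_C_mul, m.coeff_eq_zero_of_lt (f := shiftHom τ b (monomial s 1)), mul_zero]
      rw [(shiftHom_monic m τ b s).1]
      exact lt_of_le_of_ne (m.le_degree hs) fun h => hne (m.toSyn.injective h)
    · intro h
      exact absurd (m.degree_mem_support h0) h

/-- A shift-invariant nonconstant polynomial yields a telescoping linear combination. -/
theorem exists_linear_of_shift_invariant [CharZero F] (τ : F →+* F) (b : ι → F)
    (P : MvPolynomial ι F) (hP : shiftHom τ b P = P) (hd : P.totalDegree ≠ 0) :
    ∃ c : ι → F, (∃ i, c i ≠ 0) ∧ (∀ i, τ (c i) = c i) ∧ ∃ h, ∑ i, c i * b i = τ h - h := by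
  classical
  induction hn : P.totalDegree using Nat.strong_induction_on generalizing P with
  | _ n ih =>
    -- Partial derivatives of an invariant polynomial are again invariant. If all of them are
    -- constants, P is affine and comparing constant terms gives the claim; otherwise some
    -- nonconstant partial derivative replaces P.
    by_cases hall : ∀ i, (pderiv i P).totalDegree = 0
    · choose c hc' using fun i => (⟨_, totalDegree_eq_zero_iff_eq_C.1 (hall i)⟩ :
        ∃ c, pderiv i P = C c)
      have hτ : ∀ i, τ (c i) = c i := fun i => by
        have h := shiftHom_pderiv τ b i P
        rw [hP, hc', shiftHom_C] at h
        exact (C_injective _ _ h).symm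
      set R := P - ∑ i, C (c i) * X i with hR
      have hRd : ∀ i, pderiv i R = 0 := fun i => by
        rw [hR, map_sub, hc', map_sum, sub_eq_zero]
        simp only [pderiv_C_mul, pderiv_X, Pi.single_apply]
        simp
      -- In characteristic zero a polynomial with vanishing partial derivatives is constant.
      have hRC : R = C (R.coeff 0) := by
        ext s
        rw [coeff_C]
        split_ifs with hs
        · rw [hs]
        · obtain ⟨i, hi⟩ : ∃ i, s i ≠ 0 := by
            by_contra! h
            exact hs (Finsupp.ext fun i => (h i).symm)
          have h := coeff_pderiv (i := i) R (s - Finsupp.single i 1)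
          have hs' : s - Finsupp.single i 1 + Finsupp.single i 1 = s :=
            tsub_add_cancel_of_le (by simpa using Nat.one_le_iff_ne_zero.2 hi)
          rw [hRd, coeff_zero, hs'] at h
          exact (mul_eq_zero.1 h.symm).resolve_right (Nat.cast_add_one_ne_zero _)
      have hPe : P = C (R.coeff 0) + ∑ i, C (c i) * X i := by
        rw [← hRC, hR]; ring
      refine ⟨c, ?_, hτ, -R.coeff 0, ?_⟩
      · by_contra! h
        refine hd ?_
        rw [hPe]
        simp [h]
      · rw [hPe] at hP
        simp only [map_add, map_sum, map_mul, shiftHom_C, shiftHom_X, hτ, mul_add,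
          Finset.sum_add_distrib] at hP
        have h2 : C (τ (R.coeff 0)) + ∑ i, C (c i) * C (b i) = (C (R.coeff 0) : MvPolynomial ι F) := by
          linear_combination hP
        simp only [← C_mul, ← map_sum, ← C_add] at h2
        have h3 := C_injective _ _ h2
        rw [map_neg]
        linear_combination h3
    · push Not at hall
      obtain ⟨i, hi⟩ := hall
      refine ih _ ?_ (pderiv i P) (by rw [← shiftHom_pderiv, hP]) hi rfl
      rw [← hn]
      have hle : ∀ s ∈ (pderiv i P).support, (s.sum fun _ e => e) < P.totalDegree := by
        intro s hs
        have h1 : s + Finsupp.single i 1 ∈ P.support := by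
          rw [mem_support_iff] at hs ⊢
          rw [coeff_pderiv] at hs
          exact left_ne_zero_of_mul hs
        have h2 := le_totalDegree h1
        rw [Finsupp.sum_add_index' (by simp) (by simp)] at h2
        simp at h2
        omega
      exact (Finset.sup_lt_iff (Nat.pos_of_ne_zero hd)).2 hle

/-- **Ostrowski's theorem** for difference fields: algebraically dependent solutions of
`σ y = y + b` come from a telescoping linear combination of the right hand sides. -/
theorem exists_telescoper_of_not_algebraicIndependent {M : Type*} [Field M] [CharZero M]
    (σ : M →+* M) (F : Subfield M) (hF : ∀ z ∈ F, σ z ∈ F) {n : ℕ} (y b : Fin n → M)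
    (hb : ∀ i, b i ∈ F) (hy : ∀ i, σ (y i) = y i + b i) (hdep : ¬ AlgebraicIndependent F y) :
    ∃ c : Fin n → M, (∃ i, c i ≠ 0) ∧ (∀ i, c i ∈ F) ∧ (∀ i, σ (c i) = c i) ∧
      ∃ h ∈ F, ∑ i, c i * b i = σ h - h := by
  let τ : F →+* F := σ.restrict F F hF
  let b' : Fin n → F := fun i => ⟨b i, hb i⟩
  let m : MonomialOrder (Fin n) := MonomialOrder.degLex
  have haev : ∀ P : MvPolynomial (Fin n) F, aeval y (shiftHom τ b' P) = σ (aeval y P) := by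
    intro P
    induction P using MvPolynomial.induction_on with
    | C c => rw [shiftHom_C, aeval_C, aeval_C]; rfl
    | add p s hp hs => simp [hp, hs]
    | mul_X p j hp =>
      simp only [map_mul, hp, shiftHom_X, map_add, aeval_X, aeval_C, hy]
      rfl
  have hex : ∃ P : MvPolynomial (Fin n) F, P ≠ 0 ∧ aeval y P = 0 := by
    by_contra! h
    exact hdep (by
      rw [algebraicIndependent_iff]
      intro p hp
      by_contra h0
      exact h p h0 hp)
  -- A relation whose leading exponent is least possible, to be normalized to leading coefficient 1.
  obtain ⟨P, ⟨hP0, hPy⟩, hmin⟩ := WellFounded.has_min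
    (InvImage.wf (fun P : MvPolynomial (Fin n) F => m.toSyn (m.degree P)) wellFounded_lt)
    {P : MvPolynomial (Fin n) F | P ≠ 0 ∧ aeval y P = 0} hex
  set a := P.coeff (m.degree P) with ha
  have ha0 : a ≠ 0 := m.coeff_degree_ne_zero_iff.2 hP0
  set P1 := C a⁻¹ * P with hP1
  have hCa : (C a⁻¹ : MvPolynomial (Fin n) F) ≠ 0 := by simpa using ha0
  have hP1d : m.degree P1 = m.degree P := by
    rw [hP1, m.degree_mul hCa hP0, m.degree_C, zero_add]
  have hP1c : P1.coeff (m.degree P) = 1 := by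
    rw [hP1, coeff_C_mul, ← ha, inv_mul_cancel₀ ha0]
  have hP1y : aeval y P1 = 0 := by rw [hP1, map_mul, hPy, mul_zero]
  have hP10 : P1 ≠ 0 := mul_ne_zero hCa hP0
  -- Applying σ to the relation gives another one with the same leading term; the difference would
  -- have a smaller leading exponent.
  have hinv : shiftHom τ b' P1 = P1 := by
    by_contra hne
    have hQ0 : shiftHom τ b' P1 - P1 ≠ 0 := sub_ne_zero.2 hne
    have hQy : aeval y (shiftHom τ b' P1 - P1) = 0 := by rw [map_sub, haev, hP1y]; simp
    refine hmin _ ⟨hQ0, hQy⟩ ?_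
    obtain ⟨h1, h2⟩ := shiftHom_degree_le m τ b' P1
    rw [hP1d] at h1 h2
    refine lt_of_le_of_ne (m.degree_sub_le.trans (sup_le h1 (by rw [hP1d]))) fun h => ?_
    have h3 := m.coeff_degree_ne_zero_iff.2 hQ0
    rw [m.toSyn.injective h, coeff_sub, h2, hP1c, map_one, sub_self] at h3
    exact h3 rfl
  have hdeg : P1.totalDegree ≠ 0 := by
    intro h
    rw [totalDegree_eq_zero_iff_eq_C] at h
    rw [h, aeval_C] at hP1y
    refine hP10 ?_
    rw [h, (FaithfulSMul.algebraMap_eq_zero_iff F M).1 hP1y, C_0]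
  obtain ⟨c, ⟨i, hi⟩, hc, h, hh⟩ := exists_linear_of_shift_invariant τ b' P1 hinv hdeg
  refine ⟨fun i => c i, ⟨i, by simpa using hi⟩, fun i => (c i).2,
    fun i => congrArg Subtype.val (hc i), h, h.2, ?_⟩
  have := congrArg Subtype.val hh
  simp only [b', AddSubmonoidClass.coe_finsetSum, MulMemClass.coe_mul] at this
  exact this

end Shift

/-! ### Transcendence degree and derivations -/

section Transcendence

open Algebra

variable {M : Type*} [Field M]

/-- A family of more than `#S` elements algebraic over `F(S)` is algebraically dependent. -/
theorem not_algebraicIndependent_of_isAlgebraic_adjoin (F : Subfield M) (S : Finset M) {n : ℕ}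
    (hn : S.card < n) (y : Fin n → M) (hy : ∀ i, IsAlgebraic (adjoin F (S : Set M)) (y i)) :
    ¬ AlgebraicIndependent F y := by
  intro h
  have hinj := h.injective
  -- An independent set inside the closure of S in the algebraic matroid has at most as many
  -- elements as S.
  have h1 : (AlgebraicIndependent.matroid F M).Indep (Set.range y) := by
    rw [AlgebraicIndependent.matroid_indep_iff]
    exact h.to_subtype_range
  have h2 : Set.range y ⊆ (AlgebraicIndependent.matroid F M).closure (S : Set M) := by
    rw [AlgebraicIndependent.matroid_closure_eq]
    rintro _ ⟨i, rfl⟩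
    exact hy i
  have h3 := h1.encard_le_eRk_of_subset h2
  rw [Matroid.eRk_closure_eq] at h3
  have h4 := h3.trans ((AlgebraicIndependent.matroid F M).eRk_le_encard _)
  rw [Set.encard_coe_eq_coe_finsetCard, ← Set.image_univ, hinj.encard_image, Set.encard_univ] at h4
  simp at h4
  omega

/-- Differentiating a relation p(z) = 0 of least degree gives p^D(z) + p'(z) Dz = 0, where p'(z) ≠ 0
by minimality and characteristic zero. The ring R need not be stable under D: it suffices that D
maps it to elements algebraic over it. -/
theorem isAlgebraic_derivation {R : Type*} [CommRing R] [IsDomain R] [Algebra R M]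
    [CharZero M] [FaithfulSMul R M] (D : Der M)
    (hD : ∀ r : R, IsAlgebraic R (D (algebraMap R M r))) {z : M} (hz : IsAlgebraic R z) :
    IsAlgebraic R (D z) := by
  classical
  have hex : ∃ n, ∃ p : Polynomial R, p ≠ 0 ∧ Polynomial.aeval z p = 0 ∧ p.natDegree = n := by
    obtain ⟨p, hp, h⟩ := hz
    exact ⟨_, p, hp, h, rfl⟩
  obtain ⟨p, hp, hpz, hpd⟩ := Nat.find_spec hex
  have hCZ : CharZero R := by
    refine ⟨fun a b hab => ?_⟩
    have := congrArg (algebraMap R M) hab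
    simpa using this
  have hd0 : p.natDegree ≠ 0 := by
    intro h0
    rw [Polynomial.eq_C_of_natDegree_eq_zero h0, Polynomial.aeval_C,
      FaithfulSMul.algebraMap_eq_zero_iff] at hpz
    exact hp (by rw [Polynomial.eq_C_of_natDegree_eq_zero h0, hpz, Polynomial.C_0])
  have hder : Polynomial.aeval z (Polynomial.derivative p) ≠ 0 := by
    intro h0
    refine Nat.find_min hex (m := (Polynomial.derivative p).natDegree) ?_
      ⟨_, ?_, h0, rfl⟩
    · rw [← hpd]
      exact Polynomial.natDegree_derivative_lt hd0
    · intro h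
      exact hd0 (Polynomial.derivative_eq_zero.1 h)
  have key : ∀ s : Polynomial R, ∃ w, IsAlgebraic R w ∧
      D (Polynomial.aeval z s) = w + Polynomial.aeval z (Polynomial.derivative s) * D z := by
    intro s
    induction s using Polynomial.induction_on' with
    | add s t hs ht =>
      obtain ⟨w, hw, h1⟩ := hs
      obtain ⟨w', hw', h2⟩ := ht
      refine ⟨w + w', hw.add hw', ?_⟩
      simp only [map_add, h1, h2]
      ring
    | monomial n r =>
      refine ⟨z ^ n * D (algebraMap R M r), (hz.pow n).mul (hD r), ?_⟩
      rw [Polynomial.aeval_monomial, Polynomial.derivative_monomial, Polynomial.aeval_monomial,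
        Derivation.leibniz, Derivation.leibniz_pow]
      simp only [smul_eq_mul, nsmul_eq_mul, map_mul, map_natCast]
      ring
  obtain ⟨w, hw, h⟩ := key p
  rw [hpz, map_zero] at h
  have hDz : D z = -(w * (Polynomial.aeval z (Polynomial.derivative p))⁻¹) := by
    field_simp
    linear_combination -h
  rw [hDz]
  refine (hw.mul (IsAlgebraic.inv ?_)).neg
  induction Polynomial.derivative p using Polynomial.induction_on' with
  | add s t hs ht => rw [map_add]; exact hs.add ht
  | monomial n r =>
    rw [Polynomial.aeval_monomial]
    exact (isAlgebraic_algebraMap r).mul (hz.pow n)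

/-- If `u` is differentially algebraic over a differential field, the iterated derivatives of its
logarithmic derivative are algebraically dependent. -/
theorem exists_not_algebraicIndependent_logDeriv [CharZero M] (D : Der M) (F : Subfield M)
    (hF : ∀ z ∈ F, D z ∈ F) {u : M} (hu : IsDiffAlgebraic D F u) :
    ∃ n, ¬ AlgebraicIndependent F fun i : Fin n => D^[i] (D u / u) := by
  classical
  set v : ℕ → M := fun i => D^[i] u with hv
  have hdep : ¬ AlgebraicIndependent F v := by
    intro h
    obtain ⟨P, hP, hPv⟩ := hu
    exact hP (algebraicIndependent_iff.1 h P hPv)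
  -- Some derivative is algebraic over the preceding ones; otherwise adding them one at a time shows
  -- the whole sequence to be independent.
  obtain ⟨N, hN⟩ : ∃ N, IsAlgebraic (adjoin F (v '' Set.Iio N)) (v N) := by
    by_contra! hcon
    refine hdep (algebraicIndependent_of_finite_type fun t ht => ?_)
    have hind : ∀ N, AlgebraicIndepOn F v (Set.Iio N) := by
      intro N
      induction N with
      | zero =>
        have : IsEmpty (Set.Iio 0) := ⟨fun i => by simpa using i.2⟩
        exact algebraicIndependent_empty_type_iff.2 (algebraMap F M).injective
      | succ N ih =>
        have : Set.Iio (N + 1) = insert N (Set.Iio N) := by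
          ext; simp only [Set.mem_Iio, Set.mem_insert_iff]; omega
        rw [this, AlgebraicIndepOn.insert_iff (by simp)]
        exact ⟨ih, hcon N⟩
    obtain ⟨B, hB⟩ := ht.bddAbove
    exact (hind (B + 1)).mono fun i hi => Nat.lt_succ_of_le (hB hi)
  set S : Finset M := (Finset.range N).image v with hS
  have hSv : v '' Set.Iio N = (S : Set M) := by simp [hS]
  rw [hSv] at hN
  have hvS : ∀ i ≤ N, IsAlgebraic (adjoin F (S : Set M)) (v i) := by
    intro i hi
    rcases hi.lt_or_eq with h | rfl
    · exact isAlgebraic_algebraMap (⟨v i, subset_adjoin (by rw [← hSv]; exact ⟨i, h, rfl⟩)⟩ :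
        adjoin F (S : Set M))
    · exact hN
  have hmem : ∀ r ∈ adjoin F (S : Set M), IsAlgebraic (adjoin F (S : Set M)) r := fun r hr =>
    isAlgebraic_algebraMap (⟨r, hr⟩ : adjoin F (S : Set M))
  -- Only the last of the generators, the (N−1)-st derivative, has its derivative possibly outside
  -- the ring, and that derivative is algebraic over it by the choice of N.
  have hR : ∀ r ∈ adjoin F (S : Set M), IsAlgebraic (adjoin F (S : Set M)) (D r) := by
    intro r hr
    induction hr using adjoin_induction with
    | mem r hr =>
      rw [← hSv] at hr
      obtain ⟨i, hi, rfl⟩ := hr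
      have := hvS (i + 1) hi
      simp only [hv, Function.iterate_succ_apply'] at this
      exact this
    | algebraMap r => exact hmem _ ((adjoin F (S : Set M)).algebraMap_mem ⟨_, hF r r.2⟩)
    | add a b _ _ ha hb => rw [map_add]; exact ha.add hb
    | mul a b ha' hb' ha hb =>
      rw [Derivation.leibniz]
      exact ((hmem a ha').mul hb).add ((hmem b hb').mul ha)
  have hstep : ∀ {z : M}, IsAlgebraic (adjoin F (S : Set M)) z →
      IsAlgebraic (adjoin F (S : Set M)) (D z) := fun hz =>
    isAlgebraic_derivation D (fun r : adjoin F (S : Set M) => hR r r.2) hz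
  have hu' : IsAlgebraic (adjoin F (S : Set M)) u := hvS 0 N.zero_le
  refine ⟨S.card + 1, not_algebraicIndependent_of_isAlgebraic_adjoin F S (Nat.lt_succ_self _) _
    fun i => ?_⟩
  induction (i : ℕ) with
  | zero =>
    rw [Function.iterate_zero, _root_.id, div_eq_mul_inv]
    exact (hstep hu').mul hu'.inv
  | succ n ih => rw [Function.iterate_succ_apply']; exact hstep ih

end Transcendence

/-! ### Stability of generated subfields under derivations and endomorphisms -/

section Subfields

variable {M : Type*} [Field M]

theorem mem_sup_closure_singleton (L : Subfield M) (t z : M) :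
    z ∈ L ⊔ Subfield.closure {t} ↔
      ∃ p s : Polynomial L, z = Polynomial.aeval t p / Polynomial.aeval t s := by
  have h : L ⊔ Subfield.closure {t} = (IntermediateField.adjoin L {t}).toSubfield := by
    rw [IntermediateField.adjoin_toSubfield]
    have : Set.range (algebraMap L M) = (L : Set M) := Subtype.range_coe
    rw [this, Subfield.closure_union, Subfield.closure_eq]
  rw [h]
  exact IntermediateField.mem_adjoin_simple_iff L z

theorem map_mem_closure_of_forall {φ : M →+* M} {s : Set M}
    (h : ∀ z ∈ s, φ z ∈ Subfield.closure s) {z : M} (hz : z ∈ Subfield.closure s) :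
    φ z ∈ Subfield.closure s :=
  (Subfield.closure_le (t := (Subfield.closure s).comap φ)).2 h hz

theorem derivation_inv_eq (D : Der M) (z : M) : D z⁻¹ = -(D z * (z⁻¹ * z⁻¹)) := by
  rcases eq_or_ne z 0 with rfl | hz
  · simp
  have h := congrArg D (mul_inv_cancel₀ hz)
  rw [Derivation.leibniz, smul_eq_mul, smul_eq_mul, Derivation.map_one_eq_zero] at h
  field_simp at h ⊢
  linear_combination h

theorem derivation_mem_closure_of_forall (D : Der M) {s : Set M}
    (h : ∀ z ∈ s, D z ∈ Subfield.closure s) {z : M} (hz : z ∈ Subfield.closure s) :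
    D z ∈ Subfield.closure s := by
  induction hz using Subfield.closure_induction with
  | mem z hz => exact h z hz
  | one => rw [Derivation.map_one_eq_zero]; exact zero_mem _
  | add a b _ _ ha hb => rw [map_add]; exact add_mem ha hb
  | neg a _ ha => rw [map_neg]; exact neg_mem ha
  | inv a ha' ha =>
    rw [derivation_inv_eq]
    exact neg_mem (mul_mem ha (mul_mem (inv_mem ha') (inv_mem ha')))
  | mul a b ha' hb' ha hb =>
    rw [Derivation.leibniz]
    exact add_mem (mul_mem ha' hb) (mul_mem hb' ha)

theorem derivation_mem_sup_of_forall (D : Der M) (L : Subfield M) (s : Set M)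
    (hL : ∀ z ∈ L, D z ∈ L ⊔ Subfield.closure s) (hs : ∀ z ∈ s, D z ∈ L ⊔ Subfield.closure s)
    {z : M} (hz : z ∈ L ⊔ Subfield.closure s) : D z ∈ L ⊔ Subfield.closure s := by
  have h : L ⊔ Subfield.closure s = Subfield.closure ((L : Set M) ∪ s) := by
    rw [Subfield.closure_union, Subfield.closure_eq]
  rw [h] at hz hL hs ⊢
  exact derivation_mem_closure_of_forall D (fun z hz => hz.elim (hL z) (hs z)) hz

theorem map_mem_sup_of_forall {φ : M →+* M} (L : Subfield M) (s : Set M)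
    (hL : ∀ z ∈ L, φ z ∈ L ⊔ Subfield.closure s) (hs : ∀ z ∈ s, φ z ∈ L ⊔ Subfield.closure s)
    {z : M} (hz : z ∈ L ⊔ Subfield.closure s) : φ z ∈ L ⊔ Subfield.closure s := by
  have h : L ⊔ Subfield.closure s = Subfield.closure ((L : Set M) ∪ s) := by
    rw [Subfield.closure_union, Subfield.closure_eq]
  rw [h] at hz hL hs ⊢
  exact map_mem_closure_of_forall (fun z hz => hz.elim (hL z) (hs z)) hz

theorem subset_sup_closure (L : Subfield M) (s : Set M) {z : M} (hz : z ∈ s) :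
    z ∈ L ⊔ Subfield.closure s :=
  (le_sup_right : _ ≤ L ⊔ Subfield.closure s) (Subfield.subset_closure hz)

theorem left_sup_closure (L : Subfield M) (s : Set M) {z : M} (hz : z ∈ L) :
    z ∈ L ⊔ Subfield.closure s :=
  (le_sup_left : _ ≤ L ⊔ Subfield.closure s) hz

/-- The action of an endomorphism on polynomials over a stable subfield. -/
theorem map_aeval_restrict (φ : M →+* M) (L : Subfield M) (hL : ∀ z ∈ L, φ z ∈ L) (t : M)
    (p : Polynomial L) :
    φ (Polynomial.aeval t p) = Polynomial.aeval (φ t) (p.map (φ.restrict L L hL)) := by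
  rw [Polynomial.aeval_def, Polynomial.hom_eval₂, Polynomial.aeval_def, Polynomial.eval₂_map]
  rfl

end Subfields

/-! ### The common setting for both derivations, and transcendence of ℓ and x -/

section System

variable {M : Type*} [Field M]

/-- The subfield of invariants of an endomorphism. -/
abbrev fixedField (σ : M →+* M) : Subfield M := σ.eqLocusField (RingHom.id M)

theorem mem_fixedField {σ : M →+* M} {z : M} : z ∈ fixedField σ ↔ σ z = z := Iff.rfl

/-- A field with an endomorphism `σ` and a derivation `D` commuting with it, with `σ`-invariant
constants `k₀ ≤ k`, and two elements `x`, `ℓ` on which `σ` acts by `x ↦ q x` and `ℓ ↦ ℓ + 1`, the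
derivation being given on `x` by `D x = κ x`. -/
structure IsTateSystem (σ : M →+* M) (D : Der M) (k₀ k : Subfield M) (q x l κ : M) : Prop where
  comm : ∀ z, D (σ z) = σ (D z)
  k₀_le : k₀ ≤ k
  sigma_k : ∀ z ∈ k, σ z = z
  D_k : ∀ z ∈ k, D z ∈ k
  q_mem : q ∈ k₀
  q_ne_zero : q ≠ 0
  q_pow : ∀ n : ℕ, n ≠ 0 → q ^ n ≠ 1
  sigma_x : σ x = q * x
  x_ne_zero : x ≠ 0
  sigma_l : σ l = l + 1
  D_x : D x = κ * x
  -- κα − Dα is the value of D(x − α) at x = α; being nonzero, it makes D raise the order of a pole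
  -- at α by exactly one.
  kappa_ne : ∀ α ∈ k, α ≠ 0 → κ * α - D α ≠ 0
  kappa_mem : κ ∈ fixedField σ ⊔ Subfield.closure {l}
  -- The logarithmic derivative κ of x is itself a difference, which accounts for the factor x^r in
  -- the multipliers.
  kappa_eq : ∃ s ∈ fixedField σ ⊔ Subfield.closure {l}, σ s - s = κ
  root : ∀ p : Polynomial k₀, p.degree ≠ 0 → ∃ α ∈ k, Polynomial.aeval α p = 0

/-- The field of elements rational in `ℓ` over the invariants. -/
abbrev fieldL (σ : M →+* M) (l : M) : Subfield M := fixedField σ ⊔ Subfield.closure {l}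

namespace IsTateSystem

variable {σ : M →+* M} {D : Der M} {k₀ k : Subfield M} {q x l κ : M}

theorem sigma_q (h : IsTateSystem σ D k₀ k q x l κ) : σ q = q := h.sigma_k q (h.k₀_le h.q_mem)

theorem k_le (h : IsTateSystem σ D k₀ k q x l κ) : k ≤ fixedField σ := h.sigma_k

theorem k_le_L (h : IsTateSystem σ D k₀ k q x l κ) : k ≤ fieldL σ l := h.k_le.trans le_sup_left

theorem D_fixed (h : IsTateSystem σ D k₀ k q x l κ) {z : M} (hz : z ∈ fixedField σ) :
    D z ∈ fixedField σ := by
  rw [mem_fixedField, ← h.comm, mem_fixedField.1 hz]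

theorem D_l (h : IsTateSystem σ D k₀ k q x l κ) : D l ∈ fixedField σ := by
  rw [mem_fixedField, ← h.comm, h.sigma_l, map_add, Derivation.map_one_eq_zero, add_zero]

theorem D_L (h : IsTateSystem σ D k₀ k q x l κ) {z : M} (hz : z ∈ fieldL σ l) :
    D z ∈ fieldL σ l := by
  refine derivation_mem_sup_of_forall D _ _ (fun z hz => left_sup_closure _ _ (h.D_fixed hz)) ?_ hz
  rintro _ rfl
  exact left_sup_closure _ _ h.D_l

theorem l_mem_L : l ∈ fieldL σ l := subset_sup_closure _ _ rfl

theorem sigma_L (h : IsTateSystem σ D k₀ k q x l κ) {z : M} (hz : z ∈ fieldL σ l) :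
    σ z ∈ fieldL σ l := by
  refine map_mem_sup_of_forall _ _ (fun z hz => ?_) ?_ hz
  · rw [mem_fixedField.1 hz]; exact left_sup_closure _ _ hz
  · rintro _ rfl
    rw [h.sigma_l]
    exact add_mem l_mem_L (one_mem _)

theorem aeval_fixed {t : M} (p : Polynomial (fixedField σ)) :
    σ (Polynomial.aeval t p) = Polynomial.aeval (σ t) p := by
  rw [Polynomial.aeval_def, Polynomial.hom_eval₂, Polynomial.aeval_def]
  congr 1
  ext z
  exact z.2

/-- Applying σ to a relation over the invariants moves the root ℓ to ℓ + 1, so a relation would have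
the infinitely many roots ℓ + n. -/
theorem transcendental_l [CharZero M] (h : IsTateSystem σ D k₀ k q x l κ) :
    Transcendental (fixedField σ) l := by
  rw [transcendental_iff]
  intro p hp
  have hroot : ∀ n : ℕ, Polynomial.aeval (l + n) p = 0 := by
    intro n
    induction n with
    | zero => simpa using hp
    | succ n ih =>
      have h1 := congrArg σ ih
      rw [aeval_fixed, map_add, h.sigma_l, map_natCast, map_zero] at h1
      rw [← h1]
      congr 2
      push_cast
      ring
  have hp0 : p.map (algebraMap (fixedField σ) M) = 0 := by
    refine Polynomial.eq_zero_of_infinite_isRoot _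
      (Set.infinite_of_injective_forall_mem (f := fun n : ℕ => l + n) ?_ fun n => ?_)
    · intro a b hab
      simpa using hab
    · change Polynomial.eval _ _ = 0
      rw [Polynomial.eval_map_algebraMap]
      exact hroot n
  rwa [Polynomial.map_eq_zero] at hp0

/-- Write e = p(ℓ)/s(ℓ). The substitution ℓ ↦ ℓ + 1 preserves leading coefficients, so comparing
them in p(ℓ+1)s(ℓ) = q^n p(ℓ)s(ℓ+1) would force q^n = 1. -/
theorem eq_zero_of_sigma_eq [CharZero M] (h : IsTateSystem σ D k₀ k q x l κ) {n : ℕ} (hn : n ≠ 0)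
    {e : M} (he : e ∈ fieldL σ l) (hσ : σ e = q ^ n * e) : e = 0 := by
  by_contra he0
  obtain ⟨p, s, rfl⟩ := (mem_sup_closure_singleton _ _ _).1 he
  have hs : Polynomial.aeval l s ≠ 0 := fun h0 => he0 (by rw [h0, div_zero])
  have hp : Polynomial.aeval l p ≠ 0 := fun h0 => he0 (by rw [h0, zero_div])
  have hp0 : p ≠ 0 := by rintro rfl; simp at hp
  have hs0 : s ≠ 0 := by rintro rfl; simp at hs
  have hqE : q ∈ fixedField σ := h.sigma_q
  set c : fixedField σ := ⟨q, hqE⟩ ^ n with hc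
  have hcM : algebraMap (fixedField σ) M c = q ^ n := rfl
  have hs1 : Polynomial.aeval (l + 1) s ≠ 0 := by
    rw [← h.sigma_l, ← aeval_fixed]
    exact (map_ne_zero σ).2 hs
  have hcomp : ∀ r : Polynomial (fixedField σ),
      Polynomial.aeval l (r.comp (Polynomial.X + Polynomial.C 1)) = Polynomial.aeval (l + 1) r := by
    intro r
    rw [Polynomial.aeval_comp]
    simp
  rw [map_div₀, aeval_fixed, aeval_fixed, h.sigma_l] at hσ
  have hpoly : p.comp (Polynomial.X + Polynomial.C 1) * s =
      Polynomial.C c * (p * s.comp (Polynomial.X + Polynomial.C 1)) := by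
    rw [← sub_eq_zero]
    refine transcendental_iff.1 h.transcendental_l _ ?_
    simp only [map_sub, map_mul, hcomp, Polynomial.aeval_C, hcM]
    field_simp at hσ
    linear_combination hσ
  have hlc := congrArg Polynomial.leadingCoeff hpoly
  have hd : (Polynomial.X + Polynomial.C (1 : fixedField σ)).natDegree ≠ 0 := by
    rw [Polynomial.natDegree_X_add_C]; exact one_ne_zero
  simp only [Polynomial.leadingCoeff_mul, Polynomial.leadingCoeff_comp hd,
    Polynomial.leadingCoeff_X_add_C, one_pow, mul_one, Polynomial.leadingCoeff_C] at hlc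
  have hps : p.leadingCoeff * s.leadingCoeff ≠ 0 := by simp [hp0, hs0]
  have hc1 : c = 1 := by
    have : (c - 1) * (p.leadingCoeff * s.leadingCoeff) = 0 := by linear_combination -hlc
    exact sub_eq_zero.1 ((mul_eq_zero.1 this).resolve_right hps)
  refine h.q_pow n hn ?_
  rw [← hcM, hc1, map_one]

/-- If p were the minimal polynomial of x, of degree n, then p^σ(qX) − q^n p would vanish at x and
have degree below n, hence be zero. Its constant term says that σ multiplies the nonzero p(0) by
q^n, contradicting `eq_zero_of_sigma_eq`. -/
theorem transcendental_x [CharZero M] (h : IsTateSystem σ D k₀ k q x l κ) :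
    Transcendental (fieldL σ l) x := by
  intro halg
  have hint : IsIntegral (fieldL σ l) x := halg.isIntegral
  set p := minpoly (fieldL σ l) x with hp
  set τ : fieldL σ l →+* fieldL σ l := σ.restrict _ _ (fun z hz => h.sigma_L hz) with hτ
  have hqL : q ∈ fieldL σ l := h.k_le_L (h.k₀_le h.q_mem)
  set c : fieldL σ l := ⟨q, hqL⟩ with hc
  have hn : p.natDegree ≠ 0 := (minpoly.natDegree_pos hint).ne'
  set n := p.natDegree with hnd
  set r := (p.map τ).comp (Polynomial.C c * Polynomial.X) - Polynomial.C (c ^ n) * p with hr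
  have hcoef : ∀ i, r.coeff i = τ (p.coeff i) * c ^ i - c ^ n * p.coeff i := by
    intro i
    rw [hr, Polynomial.coeff_sub, Polynomial.comp_C_mul_X_coeff, Polynomial.coeff_map,
      Polynomial.coeff_C_mul]
  have hr0 : r = 0 := by
    by_contra hne
    have h1 : Polynomial.aeval x r = 0 := by
      rw [hr, map_sub, map_mul, minpoly.aeval, mul_zero, sub_zero, Polynomial.aeval_comp, map_mul,
        Polynomial.aeval_C, Polynomial.aeval_X]
      change Polynomial.aeval (q * x) _ = 0
      rw [← h.sigma_x, hτ, ← map_aeval_restrict, minpoly.aeval, map_zero]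
    have h2 := minpoly.degree_le_of_ne_zero _ _ hne h1
    rw [← hp, Polynomial.degree_eq_natDegree (minpoly.ne_zero hint)] at h2
    refine absurd h2 (not_le.2 ((Polynomial.degree_lt_iff_coeff_zero _ _).2 fun m hm => ?_))
    rw [hcoef]
    rcases hm.eq_or_lt with rfl | hm
    · have : p.coeff p.natDegree = 1 := minpoly.monic hint
      rw [← hnd, this, map_one]
      ring
    · rw [Polynomial.coeff_eq_zero_of_natDegree_lt hm]
      simp
  have h0 := hcoef 0
  rw [hr0, Polynomial.coeff_zero, pow_zero, mul_one] at h0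
  have hc0 : p.coeff 0 ≠ 0 := minpoly.coeff_zero_ne_zero hint h.x_ne_zero
  have h1 : σ (p.coeff 0 : M) = q ^ n * (p.coeff 0 : M) := by
    have := congrArg Subtype.val (sub_eq_zero.1 h0.symm)
    exact this
  exact hc0 (Subtype.ext (h.eq_zero_of_sigma_eq hn (p.coeff 0).2 h1))

end IsTateSystem
end System

/-! ### The local ring of L(x) at a point x = β -/

section Regular

open Polynomial

variable {M : Type*} [Field M]

/-- The functions rational in `x` over `L` that are regular at `x = β`. -/
def regularAt (L : Subfield M) (x β : M) : Subring M where
  carrier := {f | ∃ p s : L[X], aeval β s ≠ 0 ∧ aeval x s ≠ 0 ∧ f * aeval x s = aeval x p}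
  one_mem' := ⟨1, 1, by simp, by simp, by simp⟩
  zero_mem' := ⟨0, 1, by simp, by simp, by simp⟩
  neg_mem' := by
    rintro f ⟨p, s, h1, h2, h3⟩
    exact ⟨-p, s, h1, h2, by rw [map_neg, neg_mul, h3]⟩
  mul_mem' := by
    rintro f g ⟨p, s, h1, h2, h3⟩ ⟨p', s', h1', h2', h3'⟩
    refine ⟨p * p', s * s', by rw [map_mul]; exact mul_ne_zero h1 h1',
      by rw [map_mul]; exact mul_ne_zero h2 h2', ?_⟩
    rw [map_mul, map_mul, ← h3, ← h3']
    ring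
  add_mem' := by
    rintro f g ⟨p, s, h1, h2, h3⟩ ⟨p', s', h1', h2', h3'⟩
    refine ⟨p * s' + p' * s, s * s', by rw [map_mul]; exact mul_ne_zero h1 h1',
      by rw [map_mul]; exact mul_ne_zero h2 h2', ?_⟩
    rw [map_add, map_mul, map_mul, map_mul, ← h3, ← h3']
    ring

variable {L : Subfield M} {x β : M}

theorem aeval_mem_regularAt (p : L[X]) : aeval x p ∈ regularAt L x β :=
  ⟨p, 1, by simp, by simp, by simp⟩

theorem mem_regularAt_of_mem {z : M} (hz : z ∈ L) : z ∈ regularAt L x β := by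
  have := aeval_mem_regularAt (x := x) (β := β) (C (⟨z, hz⟩ : L))
  rwa [aeval_C] at this

theorem self_mem_regularAt : x ∈ regularAt L x β := by
  have := aeval_mem_regularAt (L := L) (x := x) (β := β) X
  rwa [aeval_X] at this

theorem inv_aeval_mem_regularAt (hx : Transcendental L x) {s : L[X]} (hs : aeval β s ≠ 0) :
    (aeval x s)⁻¹ ∈ regularAt L x β := by
  have hs0 : aeval x s ≠ 0 := fun h => hs (by rw [transcendental_iff.1 hx s h, map_zero])
  exact ⟨1, s, hs, hs0, by rw [inv_mul_cancel₀ hs0, map_one]⟩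

/-- Clearing denominators would give s = p·(X − β) as polynomials, by transcendence of x, although s
does not vanish at β. This is how every contradiction about poles is reached. -/
theorem inv_sub_notMem_regularAt (hx : Transcendental L x) (hβ : β ∈ L) :
    (x - β)⁻¹ ∉ regularAt L x β := by
  rintro ⟨p, s, h1, h2, h3⟩
  have hne : x - β ≠ 0 := by
    intro h
    have := transcendental_iff.1 hx (X - C (⟨β, hβ⟩ : L)) (by
      rw [map_sub, aeval_X, aeval_C]; exact h)
    exact X_sub_C_ne_zero _ this
  have : s - p * (X - C (⟨β, hβ⟩ : L)) = 0 := by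
    refine transcendental_iff.1 hx _ ?_
    rw [map_sub, map_mul, map_sub, aeval_X, aeval_C, ← h3]
    change _ - _ * (x - β) = 0
    field_simp
    ring
  rw [sub_eq_zero] at this
  refine h1 ?_
  rw [this, map_mul, map_sub, aeval_X, aeval_C]
  change _ * (β - β) = 0
  ring

theorem exists_eq_pow_mul (hβ : β ∈ L) {p : L[X]} (hp : p ≠ 0) :
    ∃ (n : ℕ) (r : L[X]), aeval β r ≠ 0 ∧ aeval x p = (x - β) ^ n * aeval x r := by
  obtain ⟨r, hr, hr'⟩ := exists_eq_pow_rootMultiplicity_mul_and_not_dvd p hp (⟨β, hβ⟩ : L)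
  refine ⟨p.rootMultiplicity ⟨β, hβ⟩, r, fun h => hr' ?_, ?_⟩
  · rw [dvd_iff_isRoot, IsRoot.def]
    have := aeval_algebraMap_apply M (⟨β, hβ⟩ : L) r
    change aeval β r = _ at this
    rw [h] at this
    exact (FaithfulSMul.algebraMap_eq_zero_iff L M).1 this.symm
  · conv_lhs => rw [hr]
    rw [map_mul, map_pow, map_sub, aeval_X, aeval_C]
    rfl

/-- A nonzero rational function is a power of the uniformizer times a unit. -/
theorem exists_eq_zpow_mul (hx : Transcendental L x) (hβ : β ∈ L) {f : M} (hf : f ≠ 0)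
    (hfL : f ∈ L ⊔ Subfield.closure {x}) :
    ∃ (n : ℤ) (w : M), w ∈ regularAt L x β ∧ w⁻¹ ∈ regularAt L x β ∧ f = (x - β) ^ n * w := by
  obtain ⟨p, s, rfl⟩ := (mem_sup_closure_singleton _ _ _).1 hfL
  have hp : p ≠ 0 := by rintro rfl; simp at hf
  have hs : s ≠ 0 := by rintro rfl; simp at hf
  obtain ⟨n, r, hr, hr'⟩ := exists_eq_pow_mul (x := x) hβ hp
  obtain ⟨m, t, ht, ht'⟩ := exists_eq_pow_mul (x := x) hβ hs
  have hne : x - β ≠ 0 := fun h =>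
    inv_sub_notMem_regularAt hx hβ (by rw [h, inv_zero]; exact zero_mem _)
  refine ⟨n - m, aeval x r * (aeval x t)⁻¹,
    mul_mem (aeval_mem_regularAt r) (inv_aeval_mem_regularAt hx ht), ?_, ?_⟩
  · rw [mul_inv, inv_inv]
    exact mul_mem (inv_aeval_mem_regularAt hx hr) (aeval_mem_regularAt t)
  · rw [hr', ht', zpow_sub₀ hne, zpow_natCast, zpow_natCast]
    field_simp

/-- The valuation ring property: whatever has a pole at β has an inverse vanishing there. -/
theorem exists_inv_eq_of_notMem (hx : Transcendental L x) (hβ : β ∈ L) {f : M}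
    (hfL : f ∈ L ⊔ Subfield.closure {x}) (hf : f ∉ regularAt L x β) :
    ∃ w ∈ regularAt L x β, f⁻¹ = (x - β) * w := by
  have hf0 : f ≠ 0 := by rintro rfl; exact hf (zero_mem _)
  have hπ : x - β ∈ regularAt L x β := sub_mem self_mem_regularAt (mem_regularAt_of_mem hβ)
  have hne : x - β ≠ 0 := fun h =>
    inv_sub_notMem_regularAt hx hβ (by rw [h, inv_zero]; exact zero_mem _)
  obtain ⟨n, w, hw, hw', rfl⟩ := exists_eq_zpow_mul hx hβ hf0 hfL
  obtain ⟨m, rfl | rfl⟩ := n.eq_nat_or_neg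
  · exact absurd (mul_mem (by rw [zpow_natCast]; exact pow_mem hπ m) hw) hf
  · cases m with
    | zero => exact absurd (by simpa using hw) hf
    | succ m =>
      refine ⟨(x - β) ^ m * w⁻¹, mul_mem (pow_mem hπ m) hw', ?_⟩
      rw [mul_inv, zpow_neg, inv_inv, zpow_natCast, pow_succ]
      ring

end Regular

/-! ### Poles, their behaviour under D and σ, and the orbit argument -/

section Poles

open Polynomial

variable {M : Type*} [Field M] [CharZero M]

namespace IsTateSystem

variable {σ : M →+* M} {D : Der M} {k₀ k : Subfield M} {q x l κ : M}

theorem D_aeval (h : IsTateSystem σ D k₀ k q x l κ) (p : (fieldL σ l)[X]) :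
    ∃ r : (fieldL σ l)[X], D (aeval x p) = aeval x r := by
  induction p using Polynomial.induction_on' with
  | add s t hs ht =>
    obtain ⟨a, ha⟩ := hs
    obtain ⟨b, hb⟩ := ht
    exact ⟨a + b, by rw [map_add, map_add, map_add, ha, hb]⟩
  | monomial n c =>
    refine ⟨C ⟨D c, h.D_L c.2⟩ * X ^ n + C (c * ⟨κ, h.kappa_mem⟩ * n) * X ^ n, ?_⟩
    have e1 : algebraMap (fieldL σ l) M ⟨D c, h.D_L c.2⟩ = D c := rfl
    have e2 : algebraMap (fieldL σ l) M ⟨κ, h.kappa_mem⟩ = κ := rfl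
    have e3 : algebraMap (fieldL σ l) M c = c := rfl
    rw [aeval_monomial, Derivation.leibniz, Derivation.leibniz_pow, h.D_x]
    simp only [map_add, map_mul, aeval_C, aeval_X, map_pow, smul_eq_mul, nsmul_eq_mul, e1, e2, e3,
      map_natCast]
    cases n with
    | zero => simp
    | succ n => rw [Nat.add_sub_cancel]; ring

/-- D maps L[x] to itself, so the quotient rule only squares the denominator and creates no new
poles. -/
theorem D_regularAt (h : IsTateSystem σ D k₀ k q x l κ) {β f : M}
    (hf : f ∈ regularAt (fieldL σ l) x β) : D f ∈ regularAt (fieldL σ l) x β := by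
  obtain ⟨p, s, h1, h2, h3⟩ := hf
  obtain ⟨p', hp'⟩ := h.D_aeval p
  obtain ⟨s', hs'⟩ := h.D_aeval s
  refine ⟨p' * s - p * s', s * s, by rw [map_mul]; exact mul_ne_zero h1 h1,
    by rw [map_mul]; exact mul_ne_zero h2 h2, ?_⟩
  have h4 := congrArg D h3
  rw [Derivation.leibniz, smul_eq_mul, smul_eq_mul, hp', hs'] at h4
  simp only [map_mul, map_sub]
  rw [← h4, ← h3]
  ring

theorem sigma_regularAt (h : IsTateSystem σ D k₀ k q x l κ) {β f : M} (hβ : β ∈ k)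
    (hf : f ∈ regularAt (fieldL σ l) x (q * β)) : σ f ∈ regularAt (fieldL σ l) x β := by
  obtain ⟨p, s, h1, h2, h3⟩ := hf
  set τ := σ.restrict (fieldL σ l) (fieldL σ l) (fun z hz => h.sigma_L hz) with hτ
  have hqL : q ∈ fieldL σ l := h.k_le_L (h.k₀_le h.q_mem)
  have key : ∀ (y : M) (r : (fieldL σ l)[X]),
      aeval y ((r.map τ).comp (C ⟨q, hqL⟩ * X)) = aeval (q * y) (r.map τ) := by
    intro y r
    rw [aeval_comp, map_mul, aeval_C, aeval_X]
    rfl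
  have hσx : ∀ r : (fieldL σ l)[X], aeval x ((r.map τ).comp (C ⟨q, hqL⟩ * X)) = σ (aeval x r) := by
    intro r
    rw [key, ← h.sigma_x, hτ, ← map_aeval_restrict]
  have hσβ : ∀ r : (fieldL σ l)[X],
      aeval β ((r.map τ).comp (C ⟨q, hqL⟩ * X)) = σ (aeval (q * β) r) := by
    intro r
    rw [key, hτ, map_aeval_restrict _ _ (fun z hz => h.sigma_L hz), map_mul, h.sigma_q,
      h.sigma_k β hβ]
  refine ⟨(p.map τ).comp (C ⟨q, hqL⟩ * X), (s.map τ).comp (C ⟨q, hqL⟩ * X), ?_, ?_, ?_⟩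
  · rw [hσβ]; exact (map_ne_zero σ).2 h1
  · rw [hσx]; exact (map_ne_zero σ).2 h2
  · rw [hσx, hσx, ← map_mul, h3]

/-- Since σ need not be surjective, its inverse cannot be applied. Instead, a pole of f at qβ means
1/f = (x − qβ)w with w regular there; σ turns x − qβ into q(x − β), so (x − β)⁻¹ would be a product
of elements regular at β. -/
theorem regularAt_of_sigma (h : IsTateSystem σ D k₀ k q x l κ) {β f : M} (hβ : β ∈ k)
    (hfL : f ∈ fieldL σ l ⊔ Subfield.closure {x}) (hf : σ f ∈ regularAt (fieldL σ l) x β) :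
    f ∈ regularAt (fieldL σ l) x (q * β) := by
  by_contra hcon
  have hqβ : q * β ∈ k := mul_mem (h.k₀_le h.q_mem) hβ
  obtain ⟨w, hw, hfw⟩ := exists_inv_eq_of_notMem h.transcendental_x (h.k_le_L hqβ) hfL hcon
  have hf0 : f ≠ 0 := by rintro rfl; exact hcon (zero_mem _)
  refine inv_sub_notMem_regularAt h.transcendental_x (h.k_le_L hβ) ?_
  have h1 := congrArg σ hfw
  rw [map_inv₀, map_mul, map_sub, h.sigma_x, h.sigma_k _ hqβ] at h1
  have hne : x - β ≠ 0 := fun h0 =>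
    inv_sub_notMem_regularAt h.transcendental_x (h.k_le_L hβ)
      (by rw [h0, inv_zero]; exact zero_mem _)
  have hσ0 : σ f ≠ 0 := (map_ne_zero σ).2 hf0
  have h2 : (x - β)⁻¹ = σ f * (q * σ w) := by
    have h3 : 1 = σ f * ((q * x - q * β) * σ w) := by rw [← h1, mul_inv_cancel₀ hσ0]
    field_simp
    linear_combination h3
  rw [h2]
  exact mul_mem hf (mul_mem (mem_regularAt_of_mem (h.k_le_L (h.k₀_le h.q_mem)))
    (h.sigma_regularAt hβ hw))

theorem zpow_mul_mem (h : IsTateSystem σ D k₀ k q x l κ) {α : M} (hα : α ∈ k) (n : ℤ) :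
    q ^ n * α ∈ k := mul_mem (zpow_mem (h.k₀_le h.q_mem) n) hα

theorem q_zpow_ne_one (h : IsTateSystem σ D k₀ k q x l κ) {n : ℤ} (hn : n ≠ 0) : q ^ n ≠ 1 := by
  obtain ⟨m, rfl | rfl⟩ := n.eq_nat_or_neg
  · rw [zpow_natCast]; exact h.q_pow m (by simpa using hn)
  · rw [zpow_neg, zpow_natCast, Ne, inv_eq_one]; exact h.q_pow m (by simpa using hn)

theorem zpow_mul_injective (h : IsTateSystem σ D k₀ k q x l κ) {α : M} (hα : α ≠ 0) :
    Function.Injective fun n : ℤ => q ^ n * α := by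
  intro m n hmn
  by_contra hne
  refine h.q_zpow_ne_one (sub_ne_zero.2 hne) ?_
  rw [zpow_sub₀ h.q_ne_zero, mul_right_cancel₀ hα hmn,
    div_self (zpow_ne_zero _ h.q_ne_zero)]

/-- Poles lie among the roots of a denominator, and n ↦ q^n α is injective because q is not a root
of unity. -/
theorem finite_notMem_regularAt (h : IsTateSystem σ D k₀ k q x l κ) {α f : M} (hα0 : α ≠ 0)
    (hfL : f ∈ fieldL σ l ⊔ Subfield.closure {x}) :
    {n : ℤ | f ∉ regularAt (fieldL σ l) x (q ^ n * α)}.Finite := by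
  obtain ⟨p, s, rfl⟩ := (mem_sup_closure_singleton _ _ _).1 hfL
  rcases eq_or_ne s 0 with rfl | hs
  · simp
  have hs' : s.map (algebraMap (fieldL σ l) M) ≠ 0 := by rwa [Ne, Polynomial.map_eq_zero]
  refine (((Polynomial.finite_setOfPred_isRoot hs').preimage
    (h.zpow_mul_injective hα0).injOn)).subset fun n hn => ?_
  change Polynomial.eval _ _ = 0
  rw [Polynomial.eval_map_algebraMap]
  by_contra hne
  refine hn ?_
  rw [div_eq_mul_inv]
  exact mul_mem (aeval_mem_regularAt p) (inv_aeval_mem_regularAt h.transcendental_x hne)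

theorem inv_D_sub_mem (h : IsTateSystem σ D k₀ k q x l κ) {α : M} (hα : α ∈ k) (hα0 : α ≠ 0) :
    (D (x - α))⁻¹ ∈ regularAt (fieldL σ l) x α := by
  have e : D (x - α) = aeval x (C (⟨κ, h.kappa_mem⟩ : fieldL σ l) * X -
      C (⟨D α, h.k_le_L (h.D_k α hα)⟩ : fieldL σ l)) := by
    rw [map_sub, h.D_x, map_sub, map_mul, aeval_X, aeval_C, aeval_C]
    rfl
  rw [e]
  refine inv_aeval_mem_regularAt h.transcendental_x ?_
  rw [map_sub, map_mul, aeval_X, aeval_C, aeval_C]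
  exact h.kappa_ne α hα hα0

/-- The iterated derivatives of a simple pole have poles of exact increasing orders. -/
theorem iterate_D_pole (h : IsTateSystem σ D k₀ k q x l κ) {α : M} (hα : α ∈ k) (hα0 : α ≠ 0)
    {b : M} (hb : b * (x - α) ∈ regularAt (fieldL σ l) x α)
    (hb' : b ∉ regularAt (fieldL σ l) x α) (i : ℕ) :
    D^[i] b * (x - α) ^ (i + 1) ∈ regularAt (fieldL σ l) x α ∧
      D^[i] b * (x - α) ^ i ∉ regularAt (fieldL σ l) x α := by
  have hπ : x - α ∈ regularAt (fieldL σ l) x α :=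
    sub_mem self_mem_regularAt (mem_regularAt_of_mem (h.k_le_L hα))
  have hD := h.inv_D_sub_mem hα hα0
  have hDne : D (x - α) ≠ 0 := by
    rw [map_sub, h.D_x]
    intro h0
    have := transcendental_iff.1 h.transcendental_x (C (⟨κ, h.kappa_mem⟩ : fieldL σ l) * X -
      C (⟨D α, h.k_le_L (h.D_k α hα)⟩ : fieldL σ l)) (by
        rw [map_sub, map_mul, aeval_X, aeval_C, aeval_C]; exact h0)
    have h2 := congrArg (aeval α) this
    rw [map_sub, map_mul, aeval_X, aeval_C, aeval_C, map_zero] at h2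
    exact h.kappa_ne α hα hα0 h2
  have hπ0 : x - α ≠ 0 := by
    intro h0
    rw [h0, map_zero] at hDne
    exact hDne rfl
  induction i with
  | zero => simpa using ⟨hb, hb'⟩
  | succ i ih =>
    obtain ⟨h1, h2⟩ := ih
    rw [Function.iterate_succ_apply']
    set B := D^[i] b with hB
    have e := Derivation.leibniz D B ((x - α) ^ (i + 1))
    rw [Derivation.leibniz_pow, Nat.add_sub_cancel] at e
    simp only [smul_eq_mul, nsmul_eq_mul] at e
    have h3 := h.D_regularAt h1
    have hcast : ((i + 1 : ℕ) : M) ≠ 0 := Nat.cast_ne_zero.2 (Nat.succ_ne_zero i)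
    have hcast' : ((i + 1 : ℕ) : M)⁻¹ ∈ regularAt (fieldL σ l) x α :=
      mem_regularAt_of_mem (inv_mem (natCast_mem _ _))
    constructor
    · have : D B * (x - α) ^ (i + 1 + 1) = (x - α) * D (B * (x - α) ^ (i + 1)) -
          ((i + 1 : ℕ) : M) * (B * (x - α) ^ (i + 1)) * D (x - α) := by
        rw [e]; ring
      rw [this]
      exact sub_mem (mul_mem hπ h3) (mul_mem (mul_mem (natCast_mem _ _) h1) (h.D_regularAt hπ))
    · intro h4
      refine h2 ?_
      -- The Leibniz rule for B(x − α)^{i+1} solved for B(x − α)^i, which is possible because i + 1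
      -- and D(x − α) are units at α.
      have : B * (x - α) ^ i = ((i + 1 : ℕ) : M)⁻¹ * (D (x - α))⁻¹ *
          (D (B * (x - α) ^ (i + 1)) - D B * (x - α) ^ (i + 1)) := by
        rw [e]
        field_simp
        ring
      rw [this]
      exact mul_mem (mul_mem hcast' hD) (sub_mem h3 h4)

theorem iterate_D_regularAt (h : IsTateSystem σ D k₀ k q x l κ) {β f : M}
    (hf : f ∈ regularAt (fieldL σ l) x β) (i : ℕ) : D^[i] f ∈ regularAt (fieldL σ l) x β := by
  induction i with
  | zero => exact hf
  | succ i ih => rw [Function.iterate_succ_apply']; exact h.D_regularAt ih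

/-- The logarithmic derivative of a function with a zero or a pole has a simple pole. -/
theorem logDeriv_pole (h : IsTateSystem σ D k₀ k q x l κ) {α a : M} (hα : α ∈ k) (hα0 : α ≠ 0)
    (ha0 : a ≠ 0) (haF : a ∈ fieldL σ l ⊔ Subfield.closure {x})
    (ha : ¬ (a ∈ regularAt (fieldL σ l) x α ∧ a⁻¹ ∈ regularAt (fieldL σ l) x α)) :
    D a / a * (x - α) ∈ regularAt (fieldL σ l) x α ∧ D a / a ∉ regularAt (fieldL σ l) x α := by
  have hπ : x - α ∈ regularAt (fieldL σ l) x α :=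
    sub_mem self_mem_regularAt (mem_regularAt_of_mem (h.k_le_L hα))
  have hD := h.inv_D_sub_mem hα hα0
  have hinv := inv_sub_notMem_regularAt h.transcendental_x (h.k_le_L hα)
  have hπ0 : x - α ≠ 0 := by
    intro h0
    rw [h0, inv_zero] at hinv
    exact hinv (zero_mem _)
  -- Otherwise the derivative of (x − α)⁻¹ would be zero, while it must have a double pole.
  have hDne : D (x - α) ≠ 0 := by
    intro h0
    have := h.iterate_D_pole hα hα0 (b := (x - α)⁻¹)
      (by rw [inv_mul_cancel₀ hπ0]; exact one_mem _) hinv 1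
    rw [Function.iterate_one, derivation_inv_eq, h0] at this
    simp [zero_mem] at this
  obtain ⟨n, w, hw, hw', rfl⟩ := exists_eq_zpow_mul h.transcendental_x (h.k_le_L hα) ha0 haF
  have hw0 : w ≠ 0 := right_ne_zero_of_mul ha0
  have hn : n ≠ 0 := by
    rintro rfl
    exact ha ⟨by simpa using hw, by simpa using hw'⟩
  have hzp : D ((x - α) ^ n) = n * (x - α) ^ n * (D (x - α) * (x - α)⁻¹) := by
    obtain ⟨m, rfl | rfl⟩ := n.eq_nat_or_neg
    · rw [zpow_natCast, Derivation.leibniz_pow]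
      cases m with
      | zero => simp
      | succ m =>
        rw [Nat.add_sub_cancel, smul_eq_mul, nsmul_eq_mul]
        push_cast
        field_simp
        ring
    · rw [zpow_neg, zpow_natCast, derivation_inv_eq, Derivation.leibniz_pow]
      cases m with
      | zero => simp
      | succ m =>
        rw [Nat.add_sub_cancel, smul_eq_mul, nsmul_eq_mul]
        push_cast
        field_simp
        ring
  have hzn : (x - α) ^ n ≠ 0 := zpow_ne_zero _ hπ0
  -- The second summand is regular; the first has a true simple pole since n ≠ 0 and D(x − α) is a
  -- unit at α.
  have e : D ((x - α) ^ n * w) / ((x - α) ^ n * w) =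
      n * D (x - α) * (x - α)⁻¹ + D w * w⁻¹ := by
    rw [Derivation.leibniz, hzp, smul_eq_mul, smul_eq_mul]
    field_simp
    ring
  have hreg : D w * w⁻¹ ∈ regularAt (fieldL σ l) x α := mul_mem (h.D_regularAt hw) hw'
  rw [e]
  constructor
  · have : (n * D (x - α) * (x - α)⁻¹ + D w * w⁻¹) * (x - α) =
        n * D (x - α) + D w * w⁻¹ * (x - α) := by
      field_simp
    rw [this]
    exact add_mem (mul_mem (intCast_mem _ _) (h.D_regularAt hπ)) (mul_mem hreg hπ)
  · intro hcon
    refine hinv ?_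
    have hn' : (n : M) ≠ 0 := Int.cast_ne_zero.2 hn
    have : (x - α)⁻¹ = (n : M)⁻¹ * (D (x - α))⁻¹ *
        ((n * D (x - α) * (x - α)⁻¹ + D w * w⁻¹) - D w * w⁻¹) := by
      field_simp
      ring
    rw [this]
    exact mul_mem (mul_mem (mem_regularAt_of_mem (inv_mem (intCast_mem _ _))) hD)
      (sub_mem hcon hreg)

/-- A telescoper of the logarithmic derivative of `a` forces every orbit of `q` that contains a
zero or a pole of `a` to contain two of them. -/
theorem exists_other_zero_or_pole (h : IsTateSystem σ D k₀ k q x l κ) {α a : M} (hα : α ∈ k)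
    (hα0 : α ≠ 0) (ha0 : a ≠ 0) (haF : a ∈ fieldL σ l ⊔ Subfield.closure {x})
    (ha : ¬ (a ∈ regularAt (fieldL σ l) x α ∧ a⁻¹ ∈ regularAt (fieldL σ l) x α))
    {n : ℕ} (c : Fin n → M) (hc : ∃ i, c i ≠ 0) (hcL : ∀ i, σ (c i) = c i) {g : M}
    (hg : g ∈ fieldL σ l ⊔ Subfield.closure {x})
    (hsum : ∑ i, c i * D^[i] (D a / a) = σ g - g) :
    ∃ m : ℤ, m ≠ 0 ∧ ¬ (a ∈ regularAt (fieldL σ l) x (q ^ m * α) ∧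
      a⁻¹ ∈ regularAt (fieldL σ l) x (q ^ m * α)) := by
  classical
  by_contra! hcon
  have hcL' : ∀ i (β : M), c i ∈ regularAt (fieldL σ l) x β := fun i β =>
    mem_regularAt_of_mem (left_sup_closure _ _ (hcL i))
  -- Where a has neither zero nor pole, the left side of the telescoping relation is regular.
  have hother : ∀ m : ℤ, m ≠ 0 → σ g - g ∈ regularAt (fieldL σ l) x (q ^ m * α) := by
    intro m hm
    obtain ⟨h1, h2⟩ := hcon m hm
    rw [← hsum]
    refine sum_mem fun i _ => mul_mem (hcL' i _) (h.iterate_D_regularAt ?_ i)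
    rw [div_eq_mul_inv]
    exact mul_mem (h.D_regularAt h1) h2
  have hα' : σ g - g ∉ regularAt (fieldL σ l) x α := by
    intro hreg
    obtain ⟨hb, hb'⟩ := h.logDeriv_pole hα hα0 ha0 haF ha
    have hπ : x - α ∈ regularAt (fieldL σ l) x α :=
      sub_mem self_mem_regularAt (mem_regularAt_of_mem (h.k_le_L hα))
    -- With j the last index with c_j ≠ 0, the term c_j D^j(Da/a) has a pole of order j + 1 at α,
    -- and all other nonzero terms have smaller order, so nothing cancels it.
    obtain ⟨j, hj, hjmax⟩ := Finset.exists_max_image (Finset.univ.filter fun i => c i ≠ 0)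
      (fun i => i) (by obtain ⟨i, hi⟩ := hc; exact ⟨i, by simpa using hi⟩)
    have hj0 : c j ≠ 0 := by simpa using hj
    refine (h.iterate_D_pole hα hα0 hb hb' j).2 ?_
    have e : D^[j] (D a / a) * (x - α) ^ (j : ℕ) = (c j)⁻¹ * ((σ g - g) * (x - α) ^ (j : ℕ) -
        ∑ i ∈ Finset.univ.erase j, c i * D^[i] (D a / a) * (x - α) ^ (j : ℕ)) := by
      rw [← hsum, Finset.sum_mul, ← Finset.add_sum_erase _ _ (Finset.mem_univ j)]
      field_simp
      ring
    rw [e]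
    refine mul_mem (mem_regularAt_of_mem (inv_mem (left_sup_closure _ _ (hcL j))))
      (sub_mem (mul_mem hreg (pow_mem hπ _)) (sum_mem fun i hi => ?_))
    rcases eq_or_ne (c i) 0 with h0 | h0
    · rw [h0, zero_mul, zero_mul]; exact zero_mem _
    have hij : i < j := lt_of_le_of_ne (hjmax i (by simpa using h0)) (Finset.ne_of_mem_erase hi)
    obtain ⟨t, ht⟩ := Nat.exists_eq_add_of_lt (Fin.lt_def.1 hij)
    rw [ht, show (i : ℕ) + t + 1 = i + 1 + t by ring, pow_add, mul_assoc, ← mul_assoc (D^[i] _)]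
    exact mul_mem (hcL' i _) (mul_mem (h.iterate_D_pole hα hα0 hb hb' i).1 (pow_mem hπ t))
  -- The exponents of the poles of g on the orbit. Those of σg form the translate A − 1, and the two
  -- sets may interact only at exponent 0.
  set A := {m : ℤ | g ∉ regularAt (fieldL σ l) x (q ^ m * α)} with hA
  have hfin : A.Finite := h.finite_notMem_regularAt hα0 hg
  have hshift : ∀ m : ℤ, σ g ∈ regularAt (fieldL σ l) x (q ^ m * α) ↔ m + 1 ∉ A := by
    intro m
    rw [hA, Set.mem_ofPred_eq, not_not, zpow_add_one₀ h.q_ne_zero, mul_comm (q ^ m) q, mul_assoc]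
    exact ⟨h.regularAt_of_sigma (h.zpow_mul_mem hα m) hg,
      h.sigma_regularAt (h.zpow_mul_mem hα m)⟩
  have hmem : ∀ m : ℤ, g ∈ regularAt (fieldL σ l) x (q ^ m * α) ↔ m ∉ A := fun m => by
    rw [hA, Set.mem_ofPred_eq, not_not]
  have hα'' : σ g - g ∉ regularAt (fieldL σ l) x (q ^ (0 : ℤ) * α) := by simpa using hα'
  rcases A.eq_empty_or_nonempty with hE | hne
  · exact hα'' (sub_mem ((hshift 0).2 (by simp [hE])) ((hmem 0).2 (by simp [hE])))
  obtain ⟨t, ht, htmax⟩ := Set.exists_max_image A (fun m => m) hfin hne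
  obtain ⟨b, hb, hbmin⟩ := Set.exists_min_image A (fun m => m) hfin hne
  -- At the largest pole t of g, σg is regular, so σg − g has a pole there; only exponent 0 allows
  -- that.
  have ht0 : t = 0 := by
    by_contra h0
    have h1 : σ g ∈ regularAt (fieldL σ l) x (q ^ t * α) :=
      (hshift t).2 fun h2 => by have := htmax _ h2; omega
    have h2 := sub_mem h1 (hother t h0)
    rw [sub_sub_cancel, hmem] at h2
    exact h2 ht
  -- At b − 1, with b the smallest pole of g, σg has a pole and g has none, so b − 1 = 0. Then the
  -- minimum 1 of A exceeds its maximum 0.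
  have hb1 : b - 1 = 0 := by
    by_contra h0
    have h1 : g ∈ regularAt (fieldL σ l) x (q ^ (b - 1) * α) :=
      (hmem _).2 fun h2 => by have := hbmin _ h2; omega
    have h2 := add_mem (hother _ h0) h1
    rw [sub_add_cancel, hshift, sub_add_cancel] at h2
    exact h2 hb
  have := hbmin t ht
  omega

end IsTateSystem
end Poles

/-! ### Trivial multipliers and the invariance of telescopers under them -/

section Reduction

open Polynomial

variable {M : Type*} [Field M]

/-- The right hand sides `μ x^r σ(g)/g` of rank one equations with explicit solutions. -/
def IsTrivialMultiplier (σ : M →+* M) (k₀ : Subfield M) (x a : M) : Prop :=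
  ∃ r : ℤ, ∃ g ∈ k₀ ⊔ Subfield.closure {x}, ∃ μ ∈ k₀, μ ≠ 0 ∧ g ≠ 0 ∧ a = μ * x ^ r * (σ g / g)

/-- The logarithmic derivative of `a` admits a telescoper. -/
def HasTelescoper (σ : M →+* M) (D : Der M) (x l a : M) : Prop :=
  ∃ (n : ℕ) (c : Fin n → M), (∃ i, c i ≠ 0) ∧ (∀ i, σ (c i) = c i) ∧
    ∃ g ∈ fieldL σ l ⊔ Subfield.closure {x}, ∑ i, c i * D^[i] (D a / a) = σ g - g

theorem IsTrivialMultiplier.mul {σ : M →+* M} {k₀ : Subfield M} {x a b : M} (hx : x ≠ 0)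
    (ha : IsTrivialMultiplier σ k₀ x a) (hb : IsTrivialMultiplier σ k₀ x b) :
    IsTrivialMultiplier σ k₀ x (a * b) := by
  obtain ⟨r, g, hg, μ, hμ, hμ0, hg0, rfl⟩ := ha
  obtain ⟨r', g', hg', μ', hμ', hμ0', hg0', rfl⟩ := hb
  refine ⟨r + r', g * g', mul_mem hg hg', μ * μ', mul_mem hμ hμ', mul_ne_zero hμ0 hμ0',
    mul_ne_zero hg0 hg0', ?_⟩
  rw [zpow_add₀ hx, map_mul]
  field_simp

theorem IsTrivialMultiplier.inv {σ : M →+* M} {k₀ : Subfield M} {x a : M}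
    (ha : IsTrivialMultiplier σ k₀ x a) : IsTrivialMultiplier σ k₀ x a⁻¹ := by
  obtain ⟨r, g, hg, μ, hμ, hμ0, hg0, rfl⟩ := ha
  refine ⟨-r, g⁻¹, inv_mem hg, μ⁻¹, inv_mem hμ, inv_ne_zero hμ0, inv_ne_zero hg0, ?_⟩
  rw [map_inv₀, mul_inv, mul_inv, zpow_neg, inv_div_inv, inv_div]

theorem IsTrivialMultiplier.const {σ : M →+* M} {k₀ : Subfield M} {x μ : M} (hμ : μ ∈ k₀)
    (hμ0 : μ ≠ 0) : IsTrivialMultiplier σ k₀ x μ :=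
  ⟨0, 1, one_mem _, μ, hμ, hμ0, one_ne_zero, by simp⟩

theorem IsTrivialMultiplier.self {σ : M →+* M} {k₀ : Subfield M} {x : M} :
    IsTrivialMultiplier σ k₀ x x :=
  ⟨1, 1, one_mem _, 1, one_mem _, one_ne_zero, one_ne_zero, by simp⟩

theorem IsTrivialMultiplier.zpow {σ : M →+* M} {k₀ : Subfield M} {x a : M} (hx : x ≠ 0)
    (ha : IsTrivialMultiplier σ k₀ x a) (n : ℤ) : IsTrivialMultiplier σ k₀ x (a ^ n) := by
  have hnat : ∀ m : ℕ, IsTrivialMultiplier σ k₀ x (a ^ m) := by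
    intro m
    induction m with
    | zero => rw [pow_zero]; exact .const (one_mem _) one_ne_zero
    | succ m ih => rw [pow_succ]; exact ih.mul hx ha
  obtain ⟨m, rfl | rfl⟩ := n.eq_nat_or_neg
  · rw [zpow_natCast]; exact hnat m
  · rw [zpow_neg, zpow_natCast]; exact (hnat m).inv

/-- A telescoping product of the quotients σ(σ^i w)/σ^i w. -/
theorem IsTrivialMultiplier.iterate_div {σ : M →+* M} {k₀ : Subfield M} {x w : M} (hx : x ≠ 0)
    (hσ : ∀ z ∈ k₀ ⊔ Subfield.closure {x}, σ z ∈ k₀ ⊔ Subfield.closure {x})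
    (hw : w ∈ k₀ ⊔ Subfield.closure {x}) (hw0 : w ≠ 0) (n : ℕ) :
    IsTrivialMultiplier σ k₀ x (σ^[n] w / w) := by
  have hmem : ∀ n, σ^[n] w ∈ k₀ ⊔ Subfield.closure {x} ∧ σ^[n] w ≠ 0 := by
    intro n
    induction n with
    | zero => exact ⟨hw, hw0⟩
    | succ n ih =>
      rw [Function.iterate_succ_apply']
      exact ⟨hσ _ ih.1, (map_ne_zero σ).2 ih.2⟩
  induction n with
  | zero => rw [Function.iterate_zero, id, div_self hw0]; exact .const (one_mem _) one_ne_zero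
  | succ n ih =>
    obtain ⟨h1, h2⟩ := hmem n
    have : σ^[n + 1] w / w = (σ (σ^[n] w) / σ^[n] w) * (σ^[n] w / w) := by
      rw [Function.iterate_succ_apply']
      field_simp
    rw [this]
    exact IsTrivialMultiplier.mul hx
      ⟨0, _, h1, 1, one_mem _, one_ne_zero, h2, by simp⟩ ih

/-- Each polynomial is the minimal polynomial of its root, and rescaling roots by s and by s⁻¹ gives
one divisibility and the equality of degrees. -/
theorem minpoly_eq_scaleRoots {K : Type*} [Field K] [Algebra K M] {α : M} {s : K} (hs : s ≠ 0)
    {p p' : K[X]} (hp : p.Monic) (hpi : Irreducible p) (hp' : p'.Monic) (hpi' : Irreducible p')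
    (hα : aeval α p = 0) (hα' : aeval (algebraMap K M s * α) p' = 0) : p' = p.scaleRoots s := by
  have e : p = minpoly K α := minpoly.eq_of_irreducible_of_monic hpi hα hp
  have e' : p' = minpoly K (algebraMap K M s * α) :=
    minpoly.eq_of_irreducible_of_monic hpi' hα' hp'
  have h1 : p' ∣ p.scaleRoots s := by
    rw [e']
    exact minpoly.dvd _ _ (scaleRoots_aeval_eq_zero hα)
  have h2 : p ∣ p'.scaleRoots s⁻¹ := by
    nth_rewrite 1 [e]
    refine minpoly.dvd _ _ ?_
    have := scaleRoots_aeval_eq_zero (r := s⁻¹) hα'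
    rwa [← mul_assoc, ← map_mul, inv_mul_cancel₀ hs, map_one, one_mul] at this
  have h3 := natDegree_le_of_dvd h2 ((monic_scaleRoots_iff s⁻¹).2 hp').ne_zero
  rw [natDegree_scaleRoots] at h3
  exact (eq_of_monic_of_dvd_of_natDegree_le hp' ((monic_scaleRoots_iff s).2 hp) h1
    (by rwa [natDegree_scaleRoots])).symm

namespace IsTateSystem

variable {σ : M →+* M} {D : Der M} {k₀ k : Subfield M} {q x l κ : M}

theorem sigma_k₀x (h : IsTateSystem σ D k₀ k q x l κ) {z : M}
    (hz : z ∈ k₀ ⊔ Subfield.closure {x}) : σ z ∈ k₀ ⊔ Subfield.closure {x} := by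
  refine map_mem_sup_of_forall _ _ (fun z hz => ?_) ?_ hz
  · rw [h.sigma_k z (h.k₀_le hz)]; exact left_sup_closure _ _ hz
  · rintro _ rfl
    rw [h.sigma_x]
    exact mul_mem (left_sup_closure _ _ h.q_mem) (subset_sup_closure _ _ rfl)

theorem k₀x_le (h : IsTateSystem σ D k₀ k q x l κ) :
    k₀ ⊔ Subfield.closure {x} ≤ fieldL σ l ⊔ Subfield.closure {x} :=
  sup_le_sup_right (h.k₀_le.trans h.k_le_L) _

theorem D_F (h : IsTateSystem σ D k₀ k q x l κ) {z : M}
    (hz : z ∈ fieldL σ l ⊔ Subfield.closure {x}) : D z ∈ fieldL σ l ⊔ Subfield.closure {x} := by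
  refine derivation_mem_sup_of_forall D _ _ (fun z hz => left_sup_closure _ _ (h.D_L hz)) ?_ hz
  rintro _ rfl
  rw [h.D_x]
  exact mul_mem (left_sup_closure _ _ h.kappa_mem) (subset_sup_closure _ _ rfl)

theorem sigma_F (h : IsTateSystem σ D k₀ k q x l κ) {z : M}
    (hz : z ∈ fieldL σ l ⊔ Subfield.closure {x}) : σ z ∈ fieldL σ l ⊔ Subfield.closure {x} := by
  refine map_mem_sup_of_forall _ _ (fun z hz => left_sup_closure _ _ (h.sigma_L hz)) ?_ hz
  rintro _ rfl
  rw [h.sigma_x]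
  exact mul_mem (left_sup_closure _ _ (h.k_le_L (h.k₀_le h.q_mem))) (subset_sup_closure _ _ rfl)

theorem iterate_D_F (h : IsTateSystem σ D k₀ k q x l κ) {z : M}
    (hz : z ∈ fieldL σ l ⊔ Subfield.closure {x}) (i : ℕ) :
    D^[i] z ∈ fieldL σ l ⊔ Subfield.closure {x} := by
  induction i with
  | zero => exact hz
  | succ i ih => rw [Function.iterate_succ_apply']; exact h.D_F ih

theorem iterate_D_sigma (h : IsTateSystem σ D k₀ k q x l κ) (z : M) (i : ℕ) :
    D^[i] (σ z) = σ (D^[i] z) := by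
  induction i with
  | zero => rfl
  | succ i ih => rw [Function.iterate_succ_apply', Function.iterate_succ_apply', ih, h.comm]

theorem logDeriv_mul {a b : M} (ha : a ≠ 0) (hb : b ≠ 0) :
    D (a * b) / (a * b) = D a / a + D b / b := by
  rw [Derivation.leibniz, smul_eq_mul, smul_eq_mul]
  field_simp
  ring

theorem logDeriv_inv {a : M} (ha : a ≠ 0) : D a⁻¹ / a⁻¹ = -(D a / a) := by
  rw [derivation_inv_eq]
  field_simp

theorem logDeriv_zpow {a : M} (ha : a ≠ 0) (n : ℤ) : D (a ^ n) / a ^ n = n * (D a / a) := by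
  have hnat : ∀ m : ℕ, D (a ^ m) / a ^ m = m * (D a / a) := by
    intro m
    induction m with
    | zero => simp
    | succ m ih =>
      rw [pow_succ, logDeriv_mul (pow_ne_zero _ ha) ha, ih]
      push_cast
      ring
  obtain ⟨m, rfl | rfl⟩ := n.eq_nat_or_neg
  · rw [zpow_natCast, hnat, Int.cast_natCast]
  · rw [zpow_neg, zpow_natCast, logDeriv_inv (pow_ne_zero _ ha), hnat]
    push_cast
    ring

/-- Each factor of μ x^r σ(g)/g contributes to s: the invariant Dμ/μ is the difference of (Dμ/μ)ℓ
because σℓ − ℓ = 1, rκ is a difference by `kappa_eq`, and the last factor contributes Dg/g. -/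
theorem exists_logDeriv_eq (h : IsTateSystem σ D k₀ k q x l κ) {a : M}
    (ha : IsTrivialMultiplier σ k₀ x a) :
    a ≠ 0 ∧ ∃ s ∈ fieldL σ l ⊔ Subfield.closure {x}, D a / a = σ s - s := by
  obtain ⟨r, g, hg, μ, hμ, hμ0, hg0, rfl⟩ := ha
  obtain ⟨t, ht, hκ⟩ := h.kappa_eq
  have hσg : σ g ≠ 0 := (map_ne_zero σ).2 hg0
  have hμk := h.k₀_le hμ
  have hc : D μ / μ ∈ k := div_mem (h.D_k μ hμk) hμk
  refine ⟨mul_ne_zero (mul_ne_zero hμ0 (zpow_ne_zero _ h.x_ne_zero)) (div_ne_zero hσg hg0),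
    D μ / μ * l + r * t + D g / g, ?_, ?_⟩
  · refine add_mem (left_sup_closure _ _ (add_mem (mul_mem (h.k_le_L hc) l_mem_L)
      (mul_mem (intCast_mem _ _) ht))) (div_mem (h.D_F (h.k₀x_le hg)) (h.k₀x_le hg))
  · rw [logDeriv_mul (mul_ne_zero hμ0 (zpow_ne_zero _ h.x_ne_zero)) (div_ne_zero hσg hg0),
      logDeriv_mul hμ0 (zpow_ne_zero _ h.x_ne_zero), logDeriv_zpow h.x_ne_zero, h.D_x,
      div_eq_mul_inv (σ g), logDeriv_mul hσg (inv_ne_zero hg0), logDeriv_inv hg0, h.comm,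
      map_add, map_add, map_mul, map_mul, h.sigma_k _ hc, h.sigma_l, map_intCast, map_div₀,
      mul_div_assoc, div_self h.x_ne_zero, mul_one, ← hκ]
    ring

/-- The part of the relation due to a is ∑ c_i D^i(σs − s), itself a difference since D commutes
with σ and the c_i are invariant; it is absorbed into g. -/
theorem hasTelescoper_of_mul (h : IsTateSystem σ D k₀ k q x l κ) {a b : M}
    (ha : IsTrivialMultiplier σ k₀ x a) (hb : b ≠ 0) (hab : HasTelescoper σ D x l (a * b)) :
    HasTelescoper σ D x l b := by
  obtain ⟨ha0, s, hs, has⟩ := h.exists_logDeriv_eq ha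
  obtain ⟨n, c, hc, hcσ, g, hg, hsum⟩ := hab
  refine ⟨n, c, hc, hcσ, g - ∑ i, c i * D^[i] s, sub_mem hg (sum_mem fun i _ =>
    mul_mem (left_sup_closure _ _ (left_sup_closure _ _ (hcσ i))) (h.iterate_D_F hs i)), ?_⟩
  have hadd : ∀ (i : ℕ) (y z : M), D^[i] (y + z) = D^[i] y + D^[i] z := fun i y z =>
    iterate_map_add (D : M →+ M) i y z
  have hsub : ∀ (i : ℕ) (y z : M), D^[i] (y - z) = D^[i] y - D^[i] z := fun i y z =>
    iterate_map_sub (D : M →+ M) i y z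
  rw [map_sub, map_sum]
  have h1 : ∑ i, c i * D^[i] (D b / b) = ∑ i, c i * D^[i] (D (a * b) / (a * b)) -
      ∑ i, σ (c i * D^[i] s) + ∑ i, c i * D^[i] s := by
    rw [← Finset.sum_sub_distrib, ← Finset.sum_add_distrib]
    refine Finset.sum_congr rfl fun i _ => ?_
    rw [logDeriv_mul ha0 hb, hadd, has, hsub, h.iterate_D_sigma, map_mul, hcσ]
    ring
  rw [h1, hsum]
  ring

end IsTateSystem
end Reduction

/-! ### Factorization of rational functions into monic irreducibles -/

section Factor

open Polynomial

variable {M : Type*} [Field M]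

/-- The monic irreducible polynomials other than `X`. -/
abbrev PrimeFactor (K : Type*) [Field K] : Type _ :=
  {p : K[X] // p.Monic ∧ Irreducible p ∧ p ≠ X}

/-- The rational function with given exponents at the monic irreducible polynomials. -/
noncomputable def factorProd {k₀ : Subfield M} (x : M) (e : PrimeFactor k₀ →₀ ℤ) : M :=
  e.prod fun p n => aeval x p.1 ^ n

variable {k₀ : Subfield M} {x : M}

theorem factorProd_add (hx : Transcendental k₀ x) (e e' : PrimeFactor k₀ →₀ ℤ) :
    factorProd x (e + e') = factorProd x e * factorProd x e' := by
  classical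
  refine Finsupp.prod_add_index' (by simp) fun p m n => zpow_add₀ (fun h => ?_) m n
  exact p.2.1.ne_zero (transcendental_iff.1 hx _ h)

theorem factorProd_single (p : PrimeFactor k₀) (n : ℤ) :
    factorProd x (Finsupp.single p n) = aeval x p.1 ^ n :=
  Finsupp.prod_single_index (by simp)

theorem factorProd_neg (e : PrimeFactor k₀ →₀ ℤ) : factorProd x (-e) = (factorProd x e)⁻¹ := by
  rw [factorProd, Finsupp.prod_neg_index (by simp), factorProd, Finsupp.prod, Finsupp.prod,
    ← Finset.prod_inv_distrib]
  exact Finset.prod_congr rfl fun p _ => zpow_neg _ _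

/-- Leading coefficients and powers of x are themselves trivial multipliers, so they go into u; only
irreducible factors with nonzero roots remain. -/
theorem exists_factorProd_poly {σ : M →+* M} (hx : Transcendental k₀ x) {p : k₀[X]} (hp : p ≠ 0) :
    ∃ (u : M) (e : PrimeFactor k₀ →₀ ℤ), IsTrivialMultiplier σ k₀ x u ∧ aeval x p = u * factorProd x e := by
  have hx0 : x ≠ 0 := fun h => X_ne_zero (transcendental_iff.1 hx X (by rw [aeval_X, h]))
  induction p using WfDvdMonoid.induction_on_irreducible with
  | zero => exact absurd rfl hp
  | unit p hpu =>
    obtain ⟨c, hc, rfl⟩ := Polynomial.isUnit_iff.1 hpu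
    refine ⟨c, 0, .const c.2 (by simpa using hc.ne_zero), ?_⟩
    rw [aeval_C, factorProd, Finsupp.prod_zero_index, mul_one]
    rfl
  | mul a p ha hpi ih =>
    obtain ⟨u, e, hu, he⟩ := ih ha
    have hp0 := hpi.ne_zero
    set c := p.leadingCoeff with hc
    have hc0 : c ≠ 0 := leadingCoeff_ne_zero.2 hp0
    have hmon : (p * C c⁻¹).Monic := monic_mul_leadingCoeff_inv hp0
    have hpi' : Irreducible (p * C c⁻¹) := irreducible_mul_leadingCoeff_inv.2 hpi
    have hpe : aeval x p = c * aeval x (p * C c⁻¹) := by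
      have e1 : ((c⁻¹ : k₀) : M) = (c : M)⁻¹ := rfl
      have e2 : (c : M) ≠ 0 := by simpa using hc0
      rw [map_mul, aeval_C]
      change _ = (c : M) * (_ * ((c⁻¹ : k₀) : M))
      rw [e1]
      field_simp
    have huc : IsTrivialMultiplier σ k₀ x (c : M) := .const c.2 (by simpa using hc0)
    by_cases hX : p * C c⁻¹ = X
    · refine ⟨c * x * u, e, (huc.mul hx0 .self).mul hx0 hu, ?_⟩
      rw [map_mul, he, hpe, hX, aeval_X]
      ring
    · refine ⟨c * u, Finsupp.single ⟨_, hmon, hpi', hX⟩ 1 + e, huc.mul hx0 hu, ?_⟩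
      rw [map_mul, he, hpe, factorProd_add hx, factorProd_single, zpow_one]
      ring

/-- Factorization of rational functions. -/
theorem exists_factorProd {σ : M →+* M} (hx : Transcendental k₀ x) {a : M}
    (ha : a ∈ k₀ ⊔ Subfield.closure {x}) (ha0 : a ≠ 0) :
    ∃ (u : M) (e : PrimeFactor k₀ →₀ ℤ), IsTrivialMultiplier σ k₀ x u ∧ a = u * factorProd x e := by
  have hx0 : x ≠ 0 := fun h => X_ne_zero (transcendental_iff.1 hx X (by rw [aeval_X, h]))
  obtain ⟨p, s, rfl⟩ := (mem_sup_closure_singleton _ _ _).1 ha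
  have hp : p ≠ 0 := by rintro rfl; simp at ha0
  have hs : s ≠ 0 := by rintro rfl; simp at ha0
  obtain ⟨u, e, hu, he⟩ := exists_factorProd_poly (σ := σ) hx hp
  obtain ⟨v, f, hv, hf⟩ := exists_factorProd_poly (σ := σ) hx hs
  refine ⟨u * v⁻¹, e + -f, hu.mul hx0 hv.inv, ?_⟩
  rw [factorProd_add hx, factorProd_neg, he, hf, div_eq_mul_inv, mul_inv]
  ring

end Factor

/-! ### Merging the irreducible factors along orbits of q -/

section Merge

open Polynomial

variable {M : Type*} [Field M] [CharZero M]

namespace IsTateSystem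

variable {σ : M →+* M} {D : Der M} {k₀ k : Subfield M} {q x l κ : M}

theorem aeval_inclusion (h : IsTateSystem σ D k₀ k q x l κ) (y : M) (p : k₀[X]) :
    aeval y (p.map (Subfield.inclusion (h.k₀_le.trans h.k_le_L))) = aeval y p := by
  rw [aeval_def, eval₂_map]
  rfl

theorem transcendental_k₀ (h : IsTateSystem σ D k₀ k q x l κ) : Transcendental k₀ x := by
  rw [transcendental_iff]
  intro p hp
  rw [← h.aeval_inclusion] at hp
  have := transcendental_iff.1 h.transcendental_x _ hp
  rwa [Polynomial.map_eq_zero] at this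

theorem aeval_mem_k₀x (p : k₀[X]) : aeval x p ∈ k₀ ⊔ Subfield.closure {x} :=
  (mem_sup_closure_singleton _ _ _).2 ⟨p, 1, by simp⟩

theorem factorProd_mem (e : PrimeFactor k₀ →₀ ℤ) : factorProd x e ∈ k₀ ⊔ Subfield.closure {x} :=
  prod_mem fun _ _ => zpow_mem (aeval_mem_k₀x _) _

theorem factorProd_ne_zero (h : IsTateSystem σ D k₀ k q x l κ) (e : PrimeFactor k₀ →₀ ℤ) :
    factorProd x e ≠ 0 :=
  Finset.prod_ne_zero_iff.2 fun p _ => zpow_ne_zero _ fun h0 =>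
    p.2.1.ne_zero (transcendental_iff.1 h.transcendental_k₀ _ h0)

theorem aeval_unit_at (h : IsTateSystem σ D k₀ k q x l κ) {β : M} {p : k₀[X]}
    (hp : aeval β p ≠ 0) (n : ℤ) : aeval x p ^ n ∈ regularAt (fieldL σ l) x β := by
  rw [← h.aeval_inclusion] at hp ⊢
  obtain ⟨m, rfl | rfl⟩ := n.eq_nat_or_neg
  · rw [zpow_natCast]; exact pow_mem (aeval_mem_regularAt _) m
  · rw [zpow_neg, zpow_natCast, ← inv_pow]
    exact pow_mem (inv_aeval_mem_regularAt h.transcendental_x hp) m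

theorem factorProd_unit_at (h : IsTateSystem σ D k₀ k q x l κ) {β : M}
    (e : PrimeFactor k₀ →₀ ℤ) (he : ∀ p ∈ e.support, aeval β p.1 ≠ 0) :
    factorProd x e ∈ regularAt (fieldL σ l) x β ∧
      (factorProd x e)⁻¹ ∈ regularAt (fieldL σ l) x β := by
  constructor
  · exact prod_mem fun p hp => h.aeval_unit_at (he p hp) _
  · rw [← factorProd_neg]
    refine prod_mem fun p hp => h.aeval_unit_at (he p ?_) _
    simpa using hp

theorem root_ne_zero (p : PrimeFactor k₀) {α : M} (hα : aeval α p.1 = 0) : α ≠ 0 := by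
  rintro rfl
  have h1 := minpoly.eq_of_irreducible_of_monic p.2.2.1 hα p.2.1
  have h2 := minpoly.eq_of_irreducible_of_monic (x := (0 : M)) irreducible_X (aeval_X _)
    (monic_X (R := k₀))
  exact p.2.2.2 (h1.trans h2.symm)

/-- Distinct monic irreducible polynomials share no root, so p alone among the factors vanishes at
α, and no cancellation can occur. -/
theorem not_unit_at_root (h : IsTateSystem σ D k₀ k q x l κ) (e : PrimeFactor k₀ →₀ ℤ)
    {p : PrimeFactor k₀} (hp : p ∈ e.support) {α : M} (hα : α ∈ k) (hpα : aeval α p.1 = 0) :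
    ¬ (factorProd x e ∈ regularAt (fieldL σ l) x α ∧
      (factorProd x e)⁻¹ ∈ regularAt (fieldL σ l) x α) := by
  classical
  rintro ⟨h1, h2⟩
  have hP0 : aeval x p.1 ≠ 0 := fun h0 =>
    p.2.1.ne_zero (transcendental_iff.1 h.transcendental_k₀ _ h0)
  obtain ⟨h3, h4⟩ := h.factorProd_unit_at (β := α) (e.erase p) (by
    intro p' hp' h0
    rw [Finsupp.support_erase, Finset.mem_erase] at hp'
    refine hp'.1 (Subtype.ext ?_)
    rw [minpoly.eq_of_irreducible_of_monic p.2.2.1 hpα p.2.1,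
      minpoly.eq_of_irreducible_of_monic p'.2.2.1 h0 p'.2.1])
  have hsplit : factorProd x e = aeval x p.1 ^ (e p) * factorProd x (e.erase p) := by
    rw [← factorProd_single, ← factorProd_add h.transcendental_k₀, Finsupp.single_add_erase]
  have h0 := h.factorProd_ne_zero (e.erase p)
  have h5 : aeval x p.1 ^ (e p) ∈ regularAt (fieldL σ l) x α := by
    have : aeval x p.1 ^ (e p) = factorProd x e * (factorProd x (e.erase p))⁻¹ := by
      rw [hsplit]; field_simp
    rw [this]; exact mul_mem h1 h4
  have h6 : (aeval x p.1 ^ (e p))⁻¹ ∈ regularAt (fieldL σ l) x α := by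
    have : (aeval x p.1 ^ (e p))⁻¹ = (factorProd x e)⁻¹ * factorProd x (e.erase p) := by
      rw [hsplit]; field_simp
    rw [this]; exact mul_mem h2 h3
  have hP : aeval x p.1 ∈ regularAt (fieldL σ l) x α := by
    rw [← h.aeval_inclusion]; exact aeval_mem_regularAt _
  have h7 : ∀ m : ℕ, (aeval x p.1 ^ (m + 1))⁻¹ ∈ regularAt (fieldL σ l) x α →
      (aeval x p.1)⁻¹ ∈ regularAt (fieldL σ l) x α := by
    intro m hm
    have : (aeval x p.1)⁻¹ = (aeval x p.1 ^ (m + 1))⁻¹ * aeval x p.1 ^ m := by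
      field_simp
      ring
    rw [this]
    exact mul_mem hm (pow_mem hP m)
  have h8 : (aeval x p.1)⁻¹ ∈ regularAt (fieldL σ l) x α := by
    have hep : e p ≠ 0 := by simpa using hp
    obtain ⟨m, hm | hm⟩ := (e p).eq_nat_or_neg
    · obtain ⟨t, rfl⟩ := Nat.exists_eq_succ_of_ne_zero (n := m) (by rintro rfl; exact hep hm)
      rw [hm, zpow_natCast] at h6
      exact h7 t h6
    · obtain ⟨t, rfl⟩ := Nat.exists_eq_succ_of_ne_zero (n := m)
        (by rintro rfl; exact hep (by simpa using hm))
      rw [hm, zpow_neg, zpow_natCast] at h5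
      exact h7 t h5
  have hαL := h.k_le_L hα
  refine inv_sub_notMem_regularAt h.transcendental_x hαL ?_
  -- Over L the polynomial p is divisible by X − α, so regularity of 1/p(x) at α would make (x −
  -- α)⁻¹ regular as well.
  have hdvd : X - C (⟨α, hαL⟩ : fieldL σ l) ∣
      p.1.map (Subfield.inclusion (h.k₀_le.trans h.k_le_L)) := by
    rw [dvd_iff_isRoot, IsRoot.def]
    have := aeval_algebraMap_apply M (⟨α, hαL⟩ : fieldL σ l)
      (p.1.map (Subfield.inclusion (h.k₀_le.trans h.k_le_L)))
    change aeval α _ = _ at this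
    rw [h.aeval_inclusion, hpα] at this
    exact (FaithfulSMul.algebraMap_eq_zero_iff (fieldL σ l) M).1 this.symm
  obtain ⟨r, hr⟩ := hdvd
  have hPr : aeval x p.1 = (x - α) * aeval x r := by
    rw [← h.aeval_inclusion, hr, map_mul, map_sub, aeval_X, aeval_C]
    rfl
  have hx0 : x - α ≠ 0 := left_ne_zero_of_mul (hPr ▸ hP0)
  have hr0 : aeval x r ≠ 0 := right_ne_zero_of_mul (hPr ▸ hP0)
  have : (x - α)⁻¹ = (aeval x p.1)⁻¹ * aeval x r := by rw [hPr]; field_simp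
  rw [this]
  exact mul_mem h8 (aeval_mem_regularAt r)

/-- σ^n substitutes q^n x for x, and rescaling the roots by q^n is homogeneous of degree
`p.natDegree`. -/
theorem iterate_sigma_aeval (h : IsTateSystem σ D k₀ k q x l κ) (p : k₀[X]) (n : ℕ) :
    σ^[n] (aeval x (p.scaleRoots (⟨q, h.q_mem⟩ ^ n))) = q ^ (n * p.natDegree) * aeval x p := by
  have h1 : ∀ (r : k₀[X]) (n : ℕ), σ^[n] (aeval x r) = aeval (q ^ n * x) r := by
    intro r n
    induction n with
    | zero => simp
    | succ n ih =>
      rw [Function.iterate_succ_apply', ih, aeval_def, hom_eval₂, aeval_def]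
      congr 1
      · ext z; exact h.sigma_k z (h.k₀_le z.2)
      · rw [map_mul, map_pow, h.sigma_q, h.sigma_x, pow_succ]; ring
  rw [h1]
  have := scaleRoots_eval₂_mul (p := p) (algebraMap k₀ M) x (⟨q, h.q_mem⟩ ^ n)
  rw [map_pow] at this
  rw [aeval_def, pow_mul]
  exact this

theorem isTrivialMultiplier_scaleRoots (h : IsTateSystem σ D k₀ k q x l κ) {p : k₀[X]}
    (hp : p ≠ 0) (n : ℕ) :
    IsTrivialMultiplier σ k₀ x (aeval x p / aeval x (p.scaleRoots (⟨q, h.q_mem⟩ ^ n))) := by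
  have hq := h.q_ne_zero
  set w := aeval x (p.scaleRoots (⟨q, h.q_mem⟩ ^ n)) with hw
  have hw0 : w ≠ 0 := fun h0 => scaleRoots_ne_zero hp _
    (transcendental_iff.1 h.transcendental_k₀ _ h0)
  have e := h.iterate_sigma_aeval p n
  have : aeval x p / w = (q ^ (n * p.natDegree))⁻¹ * (σ^[n] w / w) := by
    rw [hw, e]
    field_simp
  rw [this]
  exact (IsTrivialMultiplier.const (inv_mem (pow_mem h.q_mem _))
    (inv_ne_zero (pow_ne_zero _ hq))).mul h.x_ne_zero
    (.iterate_div h.x_ne_zero (fun z hz => h.sigma_k₀x hz) (aeval_mem_k₀x _) hw0 n)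

/-- Constant coefficients would give q^{n deg p} = 1, the constant coefficient being nonzero since p
≠ X. Consequently two different points of one orbit are never roots of the same irreducible factor.
-/
theorem scaleRoots_ne_self (h : IsTateSystem σ D k₀ k q x l κ) (p : PrimeFactor k₀) {n : ℕ}
    (hn : n ≠ 0) : p.1.scaleRoots (⟨q, h.q_mem⟩ ^ n) ≠ p.1 := by
  intro heq
  have h0 := congrArg (fun r => r.coeff 0) heq
  simp only [coeff_scaleRoots, Nat.sub_zero] at h0
  have hd : p.1.natDegree ≠ 0 := p.2.2.1.natDegree_pos.ne'
  have hc : p.1.coeff 0 ≠ 0 := by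
    intro hc
    refine root_ne_zero (M := M) p (α := 0) ?_ rfl
    rw [← coeff_zero_eq_aeval_zero', hc, map_zero]
  have h1 : ((⟨q, h.q_mem⟩ : k₀) ^ n) ^ p.1.natDegree = 1 :=
    mul_left_cancel₀ hc (by rw [h0, mul_one])
  refine h.q_pow (n * p.1.natDegree) (mul_ne_zero hn hd) ?_
  rw [pow_mul]
  exact congrArg Subtype.val h1

/-- Two irreducible polynomials with roots in one orbit of `q` differ by a trivial multiplier. -/
theorem isTrivialMultiplier_div_of_roots (h : IsTateSystem σ D k₀ k q x l κ)
    (p p' : PrimeFactor k₀) {α : M} (hα : aeval α p.1 = 0) {m : ℤ} (hm : m ≠ 0)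
    (hα' : aeval (q ^ m * α) p'.1 = 0) :
    p' ≠ p ∧ IsTrivialMultiplier σ k₀ x (aeval x p'.1 / aeval x p.1) := by
  have hq0 : (⟨q, h.q_mem⟩ : k₀) ≠ 0 := fun h0 => h.q_ne_zero (congrArg Subtype.val h0)
  obtain ⟨n, rfl | rfl⟩ := m.eq_nat_or_neg
  · have hn : n ≠ 0 := by simpa using hm
    have e : p'.1 = p.1.scaleRoots (⟨q, h.q_mem⟩ ^ n) :=
      minpoly_eq_scaleRoots (pow_ne_zero _ hq0) p.2.1 p.2.2.1 p'.2.1 p'.2.2.1 hα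
        (by rw [zpow_natCast] at hα'; exact hα')
    refine ⟨fun h0 => h.scaleRoots_ne_self p hn (by rw [← e, h0]), ?_⟩
    have := (h.isTrivialMultiplier_scaleRoots p.2.1.ne_zero n).inv
    rwa [inv_div, ← e] at this
  · have hn : n ≠ 0 := by simpa using hm
    have hqn : q ^ n ≠ 0 := pow_ne_zero _ h.q_ne_zero
    -- For a negative exponent the roles of p and p' are exchanged, since σ is iterated only a
    -- natural number of times.
    have e : p.1 = p'.1.scaleRoots (⟨q, h.q_mem⟩ ^ n) := by
      refine minpoly_eq_scaleRoots (pow_ne_zero _ hq0) p'.2.1 p'.2.2.1 p.2.1 p.2.2.1 hα' ?_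
      have : algebraMap k₀ M (⟨q, h.q_mem⟩ ^ n) * (q ^ (-(n : ℤ)) * α) = α := by
        change q ^ n * _ = _
        rw [zpow_neg, zpow_natCast]
        field_simp
      rwa [this]
    refine ⟨fun h0 => h.scaleRoots_ne_self p' hn (by rw [← e, h0]), ?_⟩
    have := h.isTrivialMultiplier_scaleRoots p'.2.1.ne_zero n
    rwa [← e] at this

/-- The orbit of a root of any factor p contains a root of a second factor p', and p'/p is a trivial
multiplier. Trading p' for p keeps the telescoper and shrinks the support, so repetition leads to
the empty product. -/
theorem isTrivialMultiplier_factorProd (h : IsTateSystem σ D k₀ k q x l κ)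
    (e : PrimeFactor k₀ →₀ ℤ) (he : HasTelescoper σ D x l (factorProd x e)) :
    IsTrivialMultiplier σ k₀ x (factorProd x e) := by
  classical
  induction hn : e.support.card using Nat.strong_induction_on generalizing e with
  | _ n ih =>
    rcases e.support.eq_empty_or_nonempty with h0 | ⟨p, hp⟩
    · rw [Finsupp.support_eq_empty.1 h0, factorProd, Finsupp.prod_zero_index]
      exact .const (one_mem _) one_ne_zero
    obtain ⟨α, hα, hpα⟩ := h.root p.1 (degree_pos_of_irreducible p.2.2.1).ne'
    have hne := h.factorProd_ne_zero e
    obtain ⟨N, c, hc, hcσ, g, hg, hsum⟩ := id he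
    obtain ⟨m, hm, hm'⟩ := h.exists_other_zero_or_pole hα (root_ne_zero p hpα) hne
      (h.k₀x_le (factorProd_mem e)) (h.not_unit_at_root e hp hα hpα) c hc hcσ hg hsum
    obtain ⟨p', hp', hpα'⟩ : ∃ p' ∈ e.support, aeval (q ^ m * α) p'.1 = 0 := by
      by_contra! hcon
      exact hm' (h.factorProd_unit_at e hcon)
    obtain ⟨hpp, htriv⟩ := h.isTrivialMultiplier_div_of_roots p p' hpα hm hpα'
    have hP0 : aeval x p.1 ≠ 0 := fun h0 =>
      p.2.1.ne_zero (transcendental_iff.1 h.transcendental_k₀ _ h0)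
    -- The whole exponent of p' is transferred to p, where it may even cancel.
    set e' := e.erase p' + Finsupp.single p (e p') with he'
    have heq : factorProd x e = (aeval x p'.1 / aeval x p.1) ^ (e p') * factorProd x e' := by
      rw [he', factorProd_add h.transcendental_k₀, factorProd_single]
      conv_lhs => rw [← Finsupp.single_add_erase p' e, factorProd_add h.transcendental_k₀,
        factorProd_single]
      rw [div_zpow]
      field_simp
    have htriv' := htriv.zpow h.x_ne_zero (e p')
    have hcard : e'.support.card < n := by
      rw [← hn]
      refine Finset.card_lt_card ((Finset.ssubset_iff_of_subset ?_).2 ⟨p', hp', ?_⟩)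
      · refine Finsupp.support_add.trans (Finset.union_subset ?_ ?_)
        · rw [Finsupp.support_erase]; exact Finset.erase_subset _ _
        · exact Finsupp.support_single_subset.trans (Finset.singleton_subset_iff.2 hp)
      · rw [Finsupp.notMem_support_iff, he', Finsupp.add_apply, Finsupp.erase_same,
          Finsupp.single_eq_of_ne hpp, add_zero]
    have he'T : HasTelescoper σ D x l (factorProd x e') :=
      h.hasTelescoper_of_mul htriv' (h.factorProd_ne_zero e') (heq ▸ he)
    rw [heq]
    exact htriv'.mul h.x_ne_zero (ih _ hcard e' he'T rfl)

/-- A rational function whose logarithmic derivative has a telescoper is a trivial multiplier. -/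
theorem isTrivialMultiplier_of_hasTelescoper (h : IsTateSystem σ D k₀ k q x l κ) {a : M}
    (ha : a ∈ k₀ ⊔ Subfield.closure {x}) (ha0 : a ≠ 0) (haT : HasTelescoper σ D x l a) :
    IsTrivialMultiplier σ k₀ x a := by
  obtain ⟨u, e, hu, rfl⟩ := exists_factorProd (σ := σ) h.transcendental_k₀ ha ha0
  exact hu.mul h.x_ne_zero (h.isTrivialMultiplier_factorProd e
    (h.hasTelescoper_of_mul hu (h.factorProd_ne_zero e) haT))

/-- If a solution of `σ u = a u` is differentially algebraic then `a` is a trivial multiplier. -/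
theorem isTrivialMultiplier_of_isDiffAlgebraic (h : IsTateSystem σ D k₀ k q x l κ) {a u : M}
    (ha : a ∈ k₀ ⊔ Subfield.closure {x}) (hu0 : u ≠ 0) (hau : σ u = a * u)
    (hu : IsDiffAlgebraic D (fieldL σ l ⊔ Subfield.closure {x}) u) :
    IsTrivialMultiplier σ k₀ x a := by
  have ha0 : a ≠ 0 := by
    rintro rfl
    rw [zero_mul, map_eq_zero] at hau
    exact hu0 hau
  obtain ⟨n, hn⟩ := exists_not_algebraicIndependent_logDeriv D _ (fun z hz => h.D_F hz) hu
  have haF : D a / a ∈ fieldL σ l ⊔ Subfield.closure {x} :=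
    div_mem (h.D_F (h.k₀x_le ha)) (h.k₀x_le ha)
  -- The multiplicative equation for u becomes additive for its logarithmic derivative, which is the
  -- form Ostrowski's theorem needs.
  have hy : σ (D u / u) = D u / u + D a / a := by
    rw [map_div₀, ← h.comm, hau, logDeriv_mul ha0 hu0, add_comm]
  obtain ⟨c, hc, -, hcσ, g, hg, hsum⟩ := exists_telescoper_of_not_algebraicIndependent σ _
    (fun z hz => h.sigma_F hz) (fun i : Fin n => D^[i] (D u / u)) (fun i => D^[i] (D a / a))
    (fun i => h.iterate_D_F haF i) (fun i => by
      rw [← h.iterate_D_sigma, hy]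
      exact iterate_map_add (D : M →+ M) i _ _) hn
  exact h.isTrivialMultiplier_of_hasTelescoper ha ha0 ⟨n, c, hc, hcσ, g, hg, hsum⟩

end IsTateSystem
end Merge

/-! ### From trivial multipliers to algebraic differential equations -/

section Finite

open Algebra

variable {M : Type*} [Field M]

/-- Any two elements of the subfield `E` satisfy a nontrivial polynomial relation over `k`. -/
def PairwiseDependent (k E : Subfield M) : Prop :=
  ∀ f ∈ E, ∀ g ∈ E, ∃ (n : ℕ) (c : ℕ → ℕ → M), (∀ i j, c i j ∈ k) ∧
    (∃ i ∈ Finset.range n, ∃ j ∈ Finset.range n, c i j ≠ 0) ∧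
    ∑ j ∈ Finset.range n, (∑ i ∈ Finset.range n, c i j * f ^ i) * g ^ j = 0

/-- E has transcendence degree at most one over k, hence contributes at most one over F. If some t ∈
E is transcendental over F, the relation between t and e stays nontrivial as a polynomial in e with
coefficients in F[t]. -/
theorem PairwiseDependent.exists_finset {k E : Subfield M} (hkE : PairwiseDependent k E)
    (F : Subfield M) (hF : k ≤ F) :
    ∃ S : Finset M, ∀ T : Finset M, S ⊆ T → ∀ e ∈ E, IsAlgebraic (adjoin F (T : Set M)) e := by
  classical
  by_cases hall : ∀ e ∈ E, IsAlgebraic F e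
  · exact ⟨∅, fun T _ e he => (hall e he).extendScalars
      (algebraMap F (adjoin F (T : Set M))).injective⟩
  push Not at hall
  obtain ⟨t, ht, htr⟩ := hall
  refine ⟨{t}, fun T hT e he => ?_⟩
  obtain ⟨n, c, hck, ⟨i0, hi0, j0, hj0, hc0⟩, hsum⟩ := hkE t ht e he
  have htT : t ∈ adjoin F (T : Set M) :=
    subset_adjoin (Finset.mem_coe.2 (hT (Finset.mem_singleton_self t)))
  have hmem : ∀ j, ∑ i ∈ Finset.range n, c i j * t ^ i ∈ adjoin F (T : Set M) := fun j =>
    sum_mem fun i _ => mul_mem ((adjoin F (T : Set M)).algebraMap_mem ⟨_, hF (hck i j)⟩)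
      (pow_mem htT i)
  have hne : ∑ i ∈ Finset.range n, c i j0 * t ^ i ≠ 0 := by
    intro h0
    refine hc0 ?_
    have hp := transcendental_iff.1 htr
      (∑ i ∈ Finset.range n, Polynomial.monomial i (⟨c i j0, hF (hck i j0)⟩ : F)) (by
        rw [map_sum, ← h0]
        exact Finset.sum_congr rfl fun i _ => Polynomial.aeval_monomial _)
    have h1 := congrArg (fun p => p.coeff i0) hp
    simp only [Polynomial.finsetSum_coeff, Polynomial.coeff_monomial, Finset.sum_ite_eq', hi0,
      if_true, Polynomial.coeff_zero] at h1
    exact congrArg Subtype.val h1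
  refine ⟨∑ j ∈ Finset.range n, Polynomial.monomial j
    (⟨_, hmem j⟩ : adjoin F (T : Set M)), fun h0 => hne ?_, ?_⟩
  · have h1 := congrArg (fun p => p.coeff j0) h0
    simp only [Polynomial.finsetSum_coeff, Polynomial.coeff_monomial, Finset.sum_ite_eq', hj0,
      if_true, Polynomial.coeff_zero] at h1
    exact congrArg Subtype.val h1
  · rw [map_sum, ← hsum]
    exact Finset.sum_congr rfl fun j _ => Polynomial.aeval_monomial _

theorem isAlgebraic_of_mem_sup {F E : Subfield M} {S : Set M} {s : Set M}
    (hE : ∀ e ∈ E, IsAlgebraic (adjoin F S) e) (hs : s ⊆ adjoin F S) {z : M}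
    (hz : z ∈ E ⊔ Subfield.closure s) : IsAlgebraic (adjoin F S) z := by
  have h : E ⊔ Subfield.closure s = Subfield.closure ((E : Set M) ∪ s) := by
    rw [Subfield.closure_union, Subfield.closure_eq]
  rw [h] at hz
  induction hz using Subfield.closure_induction with
  | mem z hz =>
    exact hz.elim (hE z) fun hz => isAlgebraic_algebraMap (⟨z, hs hz⟩ : adjoin F S)
  | one => exact isAlgebraic_one
  | add a b _ _ ha hb => exact ha.add hb
  | neg a _ ha => exact ha.neg
  | inv a _ ha => exact ha.inv
  | mul a b _ _ ha hb => exact ha.mul hb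

theorem isDiffAlgebraic_of_not_algebraicIndependent {D : Der M} {F : Subfield M} {u : M} {n : ℕ}
    (h : ¬ AlgebraicIndependent F fun i : Fin n => D^[i] u) : IsDiffAlgebraic D F u := by
  by_contra hcon
  refine h (algebraicIndependent_iff.2 fun P hP => ?_)
  by_contra hP0
  refine hcon ⟨MvPolynomial.rename Fin.val P, ?_, ?_⟩
  · rwa [Ne, map_eq_zero_iff _ (MvPolynomial.rename_injective _ Fin.val_injective)]
  · rw [MvPolynomial.aeval_rename]
    exact hP

theorem IsDiffAlgebraic.mono {D : Der M} {F F' : Subfield M} (hF : F ≤ F') {u : M}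
    (h : IsDiffAlgebraic D F u) : IsDiffAlgebraic D F' u := by
  obtain ⟨P, hP, hPu⟩ := h
  refine ⟨MvPolynomial.map (Subfield.inclusion hF) P, ?_, ?_⟩
  · rwa [Ne, map_eq_zero_iff _ (MvPolynomial.map_injective _ (RingHom.injective _))]
  · rw [← hPu, MvPolynomial.aeval_def, MvPolynomial.eval₂_map, MvPolynomial.aeval_def]
    rfl

namespace IsTateSystem

variable {σ : M →+* M} {D : Der M} {k₀ k : Subfield M} {q x l κ : M}

/-- All derivatives of u lie in the D-stable field E(ℓ, x, u), whose transcendence degree over k(x)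
is finite. Hence enough of them are dependent over k(x), which need not be stable under D. -/
theorem isDiffAlgebraic_of_isTrivialMultiplier (h : IsTateSystem σ D k₀ k q x l κ)
    (hkE : PairwiseDependent k (fixedField σ)) {a u : M} (hu0 : u ≠ 0) (hau : σ u = a * u)
    (ha : IsTrivialMultiplier σ k₀ x a) :
    IsDiffAlgebraic D (k ⊔ Subfield.closure {x}) u := by
  classical
  obtain ⟨ha0, s, hs, hsa⟩ := h.exists_logDeriv_eq ha
  have hFB : fieldL σ l ⊔ Subfield.closure {x} ≤ fixedField σ ⊔ Subfield.closure {l, x, u} := by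
    rw [fieldL, sup_assoc, ← Subfield.closure_union]
    refine sup_le_sup_left (Subfield.closure_mono ?_) _
    rintro z (rfl | rfl) <;> simp
  -- Du/u and s solve the same equation σy = y + Da/a.
  have hy : D u / u - s ∈ fixedField σ := by
    rw [mem_fixedField, map_sub, map_div₀, ← h.comm, hau, logDeriv_mul ha0 hu0, hsa]
    ring
  have hyB : D u / u ∈ fixedField σ ⊔ Subfield.closure {l, x, u} := by
    rw [← sub_add_cancel (D u / u) s]
    exact add_mem (left_sup_closure _ _ hy) (hFB hs)
  have hB : ∀ z ∈ fixedField σ ⊔ Subfield.closure {l, x, u},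
      D z ∈ fixedField σ ⊔ Subfield.closure {l, x, u} := fun z hz => by
    refine derivation_mem_sup_of_forall D _ _
      (fun z hz => left_sup_closure _ _ (h.D_fixed hz)) ?_ hz
    rintro z (rfl | rfl | rfl)
    · exact left_sup_closure _ _ h.D_l
    · rw [h.D_x]
      exact mul_mem (hFB (left_sup_closure _ _ h.kappa_mem)) (subset_sup_closure _ _ (by simp))
    · rw [← div_mul_cancel₀ (D z) hu0]
      exact mul_mem hyB (subset_sup_closure _ _ (by simp))
  have hiter : ∀ n : ℕ, D^[n] u ∈ fixedField σ ⊔ Subfield.closure {l, x, u} := by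
    intro n
    induction n with
    | zero => exact subset_sup_closure _ _ (by simp)
    | succ n ih => rw [Function.iterate_succ_apply']; exact hB _ ih
  obtain ⟨S, hS⟩ := hkE.exists_finset (k ⊔ Subfield.closure {x}) le_sup_left
  set T : Finset M := S ∪ {l, x, u} with hT
  refine isDiffAlgebraic_of_not_algebraicIndependent (n := T.card + 1)
    (not_algebraicIndependent_of_isAlgebraic_adjoin _ T (Nat.lt_succ_self _) _ fun i => ?_)
  refine isAlgebraic_of_mem_sup (hS T Finset.subset_union_left) ?_ (hiter i)
  refine fun z hz => subset_adjoin ?_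
  rw [hT]
  simp only [Finset.coe_union, Finset.coe_insert, Finset.coe_singleton]
  exact Or.inr hz

end IsTateSystem
end Finite

/-! ### Ultrametric bounds for infinite sums -/

section Ultrametric

variable {C : Type*} [NormedField C] [IsUltrametricDist C] {ι : Type*}

theorem norm_tsum_le_of_forall_le {t : ι → C} (ht : Summable t) {B : ℝ} (hB : 0 ≤ B)
    (h : ∀ i, ‖t i‖ ≤ B) : ‖∑' i, t i‖ ≤ B := by
  refine le_of_tendsto' ht.hasSum.norm fun s => ?_
  rcases s.eq_empty_or_nonempty with rfl | hs
  · simpa using hB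
  · obtain ⟨i, -, hi⟩ := IsUltrametricDist.exists_norm_finsetSum_le_of_nonempty hs t
    exact hi.trans (h i)

/-- Only finitely many terms reach B/2, so the strict bounds hold uniformly with some B' < B. -/
theorem norm_tsum_lt_of_forall_lt {t : ι → C} (ht : Summable t) {B : ℝ} (hB : 0 < B)
    (h : ∀ i, ‖t i‖ < B) : ‖∑' i, t i‖ < B := by
  classical
  have hfin : {i | B / 2 ≤ ‖t i‖}.Finite := by
    have h1 := ht.tendsto_cofinite_zero.norm
    rw [norm_zero] at h1
    have h2 := h1.eventually (gt_mem_nhds (half_pos hB))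
    rw [Filter.eventually_cofinite] at h2
    exact h2.subset fun i hi => not_lt.2 hi
  obtain ⟨B', h1, h2, h3⟩ : ∃ B', 0 ≤ B' ∧ B' < B ∧ ∀ i, ‖t i‖ ≤ B' := by
    rcases Set.eq_empty_or_nonempty {i | B / 2 ≤ ‖t i‖} with he | hne
    · refine ⟨B / 2, by positivity, by linarith, fun i => ?_⟩
      by_contra! hi
      have : i ∈ {i | B / 2 ≤ ‖t i‖} := hi.le
      rw [he] at this
      exact this
    · obtain ⟨j, hj, hmax⟩ := Set.exists_max_image _ (fun i => ‖t i‖) hfin hne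
      refine ⟨‖t j‖, norm_nonneg _, h j, fun i => ?_⟩
      by_cases hi : B / 2 ≤ ‖t i‖
      · exact hmax i hi
      · exact (not_le.1 hi).le.trans hj
  exact (norm_tsum_le_of_forall_le ht h1 h3).trans_lt h2

end Ultrametric

/-! ### Dominant coefficients and counting zeros in an annulus -/

section LastMax

variable {C : Type*} [NontriviallyNormedField C]

/-- `i` is the last index of a coefficient of maximal norm. -/
def IsLastMax (a : AnFun C) (i : ℤ) : Prop :=
  a.1 i ≠ 0 ∧ (∀ k, ‖a.1 k‖ ≤ ‖a.1 i‖) ∧ ∀ k, i < k → ‖a.1 k‖ < ‖a.1 i‖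

theorem IsLastMax.unique {a : AnFun C} {i j : ℤ} (hi : IsLastMax a i) (hj : IsLastMax a j) :
    i = j := by
  rcases lt_trichotomy i j with h | h | h
  · exact absurd (hj.2.1 i) (not_le.2 (hi.2.2 j h))
  · exact h
  · exact absurd (hi.2.1 j) (not_le.2 (hj.2.2 i h))

variable [CompleteSpace C]

/-- In the coefficient of index i + j the term a_i b_j strictly dominates all others; beyond that
index every term is strictly smaller. This is Gauss's lemma for the norm on the unit circle. -/
theorem IsLastMax.mul [IsUltrametricDist C] {a b : AnFun C} {i j : ℤ} (hi : IsLastMax a i)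
    (hj : IsLastMax b j) : IsLastMax (a * b) (i + j) := by
  classical
  have hpos : 0 < ‖a.1 i‖ * ‖b.1 j‖ := mul_pos (norm_pos_iff.2 hi.1) (norm_pos_iff.2 hj.1)
  have hle : ∀ n k, ‖a.1 k * b.1 (n - k)‖ ≤ ‖a.1 i‖ * ‖b.1 j‖ := fun n k => by
    rw [norm_mul]
    exact mul_le_mul (hi.2.1 k) (hj.2.1 _) (norm_nonneg _) (norm_nonneg _)
  have hlt : ∀ n k, (i < k ∨ j < n - k) → ‖a.1 k * b.1 (n - k)‖ < ‖a.1 i‖ * ‖b.1 j‖ := by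
    rintro n k (h | h)
    · rw [norm_mul]
      exact mul_lt_mul_of_lt_of_le_of_nonneg_of_pos (hi.2.2 k h) (hj.2.1 _)
        (norm_nonneg _) (norm_pos_iff.2 hj.1)
    · rw [norm_mul]
      exact mul_lt_mul_of_le_of_lt_of_nonneg_of_pos (hi.2.1 k) (hj.2.2 _ h)
        (norm_nonneg _) (norm_pos_iff.2 hi.1)
  have htop : ‖(a * b).1 (i + j)‖ = ‖a.1 i‖ * ‖b.1 j‖ := by
    have hs := a.summable_conv b (i + j)
    rw [AnFun.mul_coeff, hs.tsum_eq_add_tsum_ite i, add_sub_cancel_left]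
    have hs' : Summable fun k => if k = i then 0 else a.1 k * b.1 (i + j - k) :=
      (hs.update i 0).congr fun k => by simp [Function.update_apply]
    have h1 : ‖∑' k, if k = i then 0 else a.1 k * b.1 (i + j - k)‖ < ‖a.1 i * b.1 j‖ := by
      rw [norm_mul]
      refine norm_tsum_lt_of_forall_lt hs' hpos fun k => ?_
      split_ifs with hk
      · rwa [norm_zero]
      · exact hlt _ _ (by omega)
    rw [IsUltrametricDist.norm_add_eq_max_of_norm_ne_norm h1.ne', max_eq_left h1.le, norm_mul]
  refine ⟨norm_pos_iff.1 (htop ▸ hpos), fun n => ?_, fun n hn => ?_⟩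
  · rw [htop]
    exact norm_tsum_le_of_forall_le (a.summable_conv b n) hpos.le (hle n)
  · rw [htop]
    exact norm_tsum_lt_of_forall_lt (a.summable_conv b n) hpos fun k => hlt n k (by omega)

/-- The last index of a coefficient of maximal norm. -/
noncomputable def lastMax (a : AnFun C) : ℤ :=
  open Classical in if h : a ≠ 0 then (a.exists_last_max h).choose else 0

theorem isLastMax_lastMax {a : AnFun C} (ha : a ≠ 0) : IsLastMax a (lastMax a) := by
  rw [lastMax, dif_pos ha]
  exact (a.exists_last_max ha).choose_spec

theorem IsLastMax.lastMax_eq {a : AnFun C} {i : ℤ} (h : IsLastMax a i) : lastMax a = i :=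
  (isLastMax_lastMax (fun h0 => h.1 (by rw [h0]; rfl))).unique h

theorem dilate_coeff (y : C) (hy : y ≠ 0) (a : AnFun C) (n : ℤ) :
    (AnFun.dilate y hy a).1 n = y ^ n * a.1 n := rfl

theorem dilate_ne_zero {y : C} (hy : y ≠ 0) {a : AnFun C} (ha : a ≠ 0) :
    AnFun.dilate y hy a ≠ 0 := fun h =>
  ha (AnFun.dilate_injective y hy (by rw [h, map_zero]))

/-- The number of zeros of `a` in an annulus, as the variation of the last maximal index. -/
noncomputable def jump (y : C) (hy : y ≠ 0) (a : AnFun C) : ℤ :=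
  lastMax a - lastMax (AnFun.dilate y hy a)

/-- Shrinking the radius by ‖y‖ < 1 penalizes larger indices more, so the dominant index cannot
grow. -/
theorem jump_nonneg {y : C} (hy : y ≠ 0) (hy1 : ‖y‖ < 1) {a : AnFun C} (ha : a ≠ 0) :
    0 ≤ jump y hy a := by
  rw [jump, sub_nonneg]
  by_contra! hlt
  have h1 := isLastMax_lastMax ha
  have h2 := (isLastMax_lastMax (dilate_ne_zero hy ha)).2.1 (lastMax a)
  set i := lastMax a
  set j := lastMax (AnFun.dilate y hy a)
  rw [dilate_coeff, dilate_coeff, norm_mul, norm_mul, norm_zpow, norm_zpow] at h2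
  have hy0 : 0 < ‖y‖ := norm_pos_iff.2 hy
  have h3 := h1.2.2 j hlt
  have h4 : ‖y‖ ^ j ≤ ‖y‖ ^ i := (zpow_right_strictAnti₀ hy0 hy1).antitone hlt.le
  have h5 : ‖y‖ ^ j * ‖a.1 j‖ < ‖y‖ ^ i * ‖a.1 i‖ :=
    mul_lt_mul_of_le_of_lt_of_nonneg_of_pos h4 h3 (norm_nonneg _) (zpow_pos hy0 _)
  linarith

variable [IsUltrametricDist C]

theorem lastMax_mul {a b : AnFun C} (ha : a ≠ 0) (hb : b ≠ 0) :
    lastMax (a * b) = lastMax a + lastMax b :=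
  ((isLastMax_lastMax ha).mul (isLastMax_lastMax hb)).lastMax_eq

theorem jump_mul {y : C} (hy : y ≠ 0) {a b : AnFun C} (ha : a ≠ 0) (hb : b ≠ 0) :
    jump y hy (a * b) = jump y hy a + jump y hy b := by
  rw [jump, map_mul, lastMax_mul ha hb, lastMax_mul (dilate_ne_zero hy ha) (dilate_ne_zero hy hb),
    jump, jump]
  ring

theorem jump_pow {y : C} (hy : y ≠ 0) {a : AnFun C} (ha : a ≠ 0) (n : ℕ) :
    jump y hy (a ^ n) = n * jump y hy a := by
  induction n with
  | zero =>
    have h1 : jump y hy (1 : AnFun C) = jump y hy 1 + jump y hy 1 := by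
      rw [← jump_mul hy one_ne_zero one_ne_zero, mul_one]
    rw [pow_zero, Nat.cast_zero]
    linarith
  | succ n ih =>
    rw [pow_succ, jump_mul hy (pow_ne_zero _ ha) ha, ih]
    push_cast
    ring

theorem xSubOne_coeff (n : ℤ) : (AnFun.monomial 1 1 - 1 : AnFun C).1 n =
    (if n = 1 then 1 else 0) - (if n = 0 then 1 else 0) := by
  change (Pi.single 1 1 : ℤ → C) n - (Pi.single 0 1 : ℤ → C) n = _
  rw [Pi.single_apply, Pi.single_apply]

theorem xSubOne_ne_zero : (AnFun.monomial 1 1 - 1 : AnFun C) ≠ 0 := by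
  intro h
  have := xSubOne_coeff (C := C) 1
  rw [h] at this
  simp at this

/-- The dominant index is 1 on the unit circle and 0 on the smaller circle, which detects the single
zero at 1. -/
theorem jump_xSubOne {y : C} (hy : y ≠ 0) (hy1 : ‖y‖ < 1) :
    jump y hy (AnFun.monomial 1 1 - 1) = 1 := by
  have h1 : IsLastMax (AnFun.monomial 1 1 - 1 : AnFun C) 1 := by
    refine ⟨by simp [xSubOne_coeff], fun k => ?_, fun k hk => ?_⟩
    · simp only [xSubOne_coeff]
      split_ifs <;> simp_all
    · simp only [xSubOne_coeff]
      rw [if_neg (by omega), if_neg (by omega)]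
      simp
  have h0 : IsLastMax (AnFun.dilate y hy (AnFun.monomial 1 1 - 1 : AnFun C)) 0 := by
    refine ⟨by rw [dilate_coeff, xSubOne_coeff]; simp, fun k => ?_, fun k hk => ?_⟩
    · simp only [dilate_coeff, xSubOne_coeff]
      split_ifs <;> simp_all [hy1.le]
    · simp only [dilate_coeff, xSubOne_coeff]
      rw [if_neg (show k ≠ 0 by omega)]
      split_ifs <;> simp_all
  rw [jump, h1.lastMax_eq, h0.lastMax_eq, sub_zero]

end LastMax

/-! ### Division by x − 1 and vanishing to high order at 1 -/

section Division

variable {C : Type*} [NontriviallyNormedField C] [CompleteSpace C]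

theorem AnFun.summable (a : AnFun C) : Summable a.1 := a.summable_norm_one.of_norm

theorem AnFun.summable_up (a : AnFun C) (n : ℤ) : Summable fun j : ℕ => a.1 (n + j) :=
  a.summable.comp_injective (i := fun j : ℕ => n + j) fun i j h => by simpa using h

theorem AnFun.summable_down (a : AnFun C) (n : ℤ) : Summable fun j : ℕ => a.1 (n - j) :=
  a.summable.comp_injective (i := fun j : ℕ => n - j) fun i j h => by simpa using h

/-- The value at `1`. -/
noncomputable def AnFun.evalOne (a : AnFun C) : C := ∑' n, a.1 n

/-- The coefficients of the divided difference `(a(x) - a(1)) / (x - 1)`. -/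
noncomputable def divCoeff (a : ℤ → C) (n : ℤ) : C :=
  if 0 ≤ n then ∑' j : ℕ, a (n + 1 + j) else -∑' j : ℕ, a (n - j)

variable [IsUltrametricDist C]

theorem divCoeff_mem (a : AnFun C) : divCoeff a.1 ∈ laurentGroup C := by
  refine mem_AnFun_of_summable_norm fun R hR => ?_
  have bdd : ∀ R : ℝ, 0 < R → ∃ M : ℝ, 0 ≤ M ∧ ∀ n, ‖a.1 n‖ * R ^ n ≤ M := by
    intro R hR
    obtain ⟨M, hM⟩ := (Metric.isBounded_range_of_tendsto_cofinite
      (a.summable_norm R hR).tendsto_cofinite_zero).exists_norm_le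
    have hM' : ∀ n, ‖a.1 n‖ * R ^ n ≤ M := fun n =>
      (le_abs_self _).trans (hM _ (Set.mem_range_self n))
    exact ⟨M, le_trans (by positivity) (hM' 0), hM'⟩
  -- The factors 2 and 1/2 provide geometric decay at radius R, while R₁ ≥ 1 and R₂ ≤ 1 let the
  -- first term of each tail bound the whole tail.
  set R₁ := 2 * max R 1 with hR₁
  set R₂ := min R 1 / 2 with hR₂
  have hR₁0 : 1 ≤ R₁ := by have := le_max_right R 1; linarith
  have hR₂0 : 0 < R₂ := by have : 0 < min R 1 := lt_min hR one_pos; positivity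
  have hR₂1 : R₂ ≤ 1 := by have := min_le_right R 1; linarith
  obtain ⟨M, hM0, hM⟩ := bdd R₁ (by linarith)
  obtain ⟨M', hM0', hM'⟩ := bdd R₂ hR₂0
  refine Summable.of_nonneg_of_le (fun n => by positivity) (fun n => ?_)
    (summable_half_pow_natAbs.mul_left (M + M'))
  obtain ⟨m, rfl | rfl⟩ : ∃ m : ℕ, n = m ∨ n = -((m : ℤ) + 1) := by
    rcases le_or_gt 0 n with h | h
    · exact ⟨n.toNat, Or.inl (by omega)⟩
    · exact ⟨(-n - 1).toNat, Or.inr (by omega)⟩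
  · have h1 : ‖divCoeff a.1 m‖ ≤ M * (R₁ ^ m)⁻¹ := by
      rw [divCoeff, if_pos (by omega)]
      refine norm_tsum_le_of_forall_le (a.summable_up _) (by positivity) fun j => ?_
      have h2 := hM ((m : ℤ) + 1 + j)
      rw [show (m : ℤ) + 1 + j = ((m + (1 + j) : ℕ) : ℤ) by push_cast; ring] at h2 ⊢
      rw [zpow_natCast, pow_add] at h2
      have h3 : 1 ≤ R₁ ^ (1 + j) := one_le_pow₀ hR₁0
      rw [← div_eq_mul_inv, le_div_iff₀ (by positivity)]
      refine le_trans ?_ h2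
      refine mul_le_mul_of_nonneg_left ?_ (norm_nonneg _)
      exact le_mul_of_one_le_right (by positivity) h3
    rw [zpow_natCast, Int.natAbs_natCast]
    have h2 : R ^ m ≤ R₁ ^ m * (1 / 2) ^ m := by
      rw [← mul_pow]
      refine pow_le_pow_left₀ hR.le ?_ _
      have := le_max_left R 1
      linarith
    calc _ ≤ M * (R₁ ^ m)⁻¹ * (R₁ ^ m * (1 / 2) ^ m) := by gcongr
      _ = M * (1 / 2) ^ m := by field_simp
      _ ≤ _ := by gcongr; linarith
  · have h1 : ‖divCoeff a.1 (-((m : ℤ) + 1))‖ ≤ M' * R₂ ^ (m + 1) := by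
      rw [divCoeff, if_neg (by omega), norm_neg]
      refine norm_tsum_le_of_forall_le (a.summable_down _) (by positivity) fun j => ?_
      have h2 := hM' (-((m : ℤ) + 1) - j)
      rw [show -((m : ℤ) + 1) - j = -((m + 1 + j : ℕ) : ℤ) by push_cast; ring, zpow_neg,
        zpow_natCast, pow_add, ← div_eq_mul_inv, div_le_iff₀ (by positivity)] at h2
      rw [show -((m : ℤ) + 1) - j = -((m + 1 + j : ℕ) : ℤ) by push_cast; ring]
      refine h2.trans (mul_le_mul_of_nonneg_left ?_ hM0')
      exact mul_le_of_le_one_right (by positivity) (pow_le_one₀ hR₂0.le hR₂1)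
    have h2 : R₂ ^ (m + 1) ≤ R ^ (m + 1) * (1 / 2) ^ (m + 1) := by
      rw [← mul_pow]
      refine pow_le_pow_left₀ hR₂0.le ?_ _
      have := min_le_left R 1
      linarith
    rw [show -((m : ℤ) + 1) = -((m + 1 : ℕ) : ℤ) by push_cast; ring] at h1 ⊢
    rw [zpow_neg, zpow_natCast, Int.natAbs_neg, Int.natAbs_natCast]
    calc _ ≤ M' * (R ^ (m + 1) * (1 / 2) ^ (m + 1)) * (R ^ (m + 1))⁻¹ := by
          gcongr
          exact h1.trans (by gcongr)
      _ = M' * (1 / 2) ^ (m + 1) := by field_simp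
      _ ≤ _ := by gcongr; linarith

/-- The divided difference `(a(x) - a(1)) / (x - 1)`. -/
noncomputable def AnFun.divDiff (a : AnFun C) : AnFun C := ⟨divCoeff a.1, divCoeff_mem a⟩

/-- Away from index 0 the consecutive tails differ by one coefficient. At index 0 the definition
changes from lower to upper tails, and the missing amount is the full sum, the value at 1. -/
theorem AnFun.eq_mul_divDiff_add (a : AnFun C) :
    a = (AnFun.monomial 1 1 - 1) * a.divDiff + AnFun.const a.evalOne := by
  ext n
  have h1 : ((AnFun.monomial 1 1 - 1) * a.divDiff + AnFun.const a.evalOne : AnFun C).1 n =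
      divCoeff a.1 (n - 1) - divCoeff a.1 n + (if n = 0 then a.evalOne else 0) := by
    rw [sub_mul, one_mul, AnFun.add_coeff]
    congr 1
    · change (AnFun.monomial 1 1 * a.divDiff : AnFun C).1 n - a.divDiff.1 n = _
      rw [AnFun.monomial_mul_coeff, one_mul]
      rfl
    · change (Pi.single 0 a.evalOne : ℤ → C) n = _
      rw [Pi.single_apply]
  rw [h1]
  rcases lt_trichotomy n 0 with hn | rfl | hn
  · rw [if_neg hn.ne, add_zero, divCoeff, divCoeff, if_neg (by omega), if_neg (by omega),
      (a.summable_down n).tsum_eq_zero_add]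
    have : ∀ j : ℕ, n - ((j + 1 : ℕ) : ℤ) = n - 1 - j := fun j => by push_cast; ring
    simp only [this]
    push_cast
    rw [sub_zero]
    ring
  · rw [if_pos rfl, divCoeff, divCoeff, if_neg (by omega), if_pos le_rfl, AnFun.evalOne,
      tsum_of_nat_of_neg_add_one (by simpa using a.summable_up 0)
        ((a.summable_down (-1)).congr fun j => congrArg a.1 (by ring))]
    have e0 := (a.summable_up 0).tsum_eq_zero_add
    simp only [zero_add, Nat.cast_zero] at e0
    rw [e0]
    have e1 : ∀ j : ℕ, ((j + 1 : ℕ) : ℤ) = 0 + 1 + j := fun j => by push_cast; ring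
    have e2 : ∀ j : ℕ, -((j : ℤ) + 1) = 0 - 1 - j := fun j => by ring
    simp only [e1, e2]
    ring
  · rw [if_neg hn.ne', add_zero, divCoeff, divCoeff, if_pos (by omega), if_pos hn.le]
    have e0 := (a.summable_up n).tsum_eq_zero_add
    have e1 : ∀ j : ℕ, n + ((j + 1 : ℕ) : ℤ) = n + 1 + j := fun j => by push_cast; ring
    simp only [e1, Nat.cast_zero, add_zero] at e0
    have e2 : ∀ j : ℕ, n - 1 + 1 + (j : ℤ) = n + j := fun j => by ring
    simp only [e2]
    rw [e0]
    ring

theorem const_mul_coeff (c : C) (a : AnFun C) (n : ℤ) : (AnFun.const c * a).1 n = c * a.1 n := by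
  change (AnFun.monomial 0 c * a).1 n = _
  rw [AnFun.monomial_mul_coeff, sub_zero]

theorem AnFun.evalOne_add (a b : AnFun C) : (a + b).evalOne = a.evalOne + b.evalOne :=
  a.summable.tsum_add b.summable

theorem AnFun.evalOne_const_mul (c : C) (a : AnFun C) :
    (AnFun.const c * a).evalOne = c * a.evalOne := by
  rw [AnFun.evalOne, AnFun.evalOne, ← tsum_mul_left]
  exact tsum_congr fun n => const_mul_coeff c a n

theorem AnFun.divDiff_add (a b : AnFun C) : (a + b).divDiff = a.divDiff + b.divDiff := by
  ext n
  change divCoeff (a + b).1 n = divCoeff a.1 n + divCoeff b.1 n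
  simp only [divCoeff]
  split_ifs
  · rw [← (a.summable_up _).tsum_add (b.summable_up _)]
    rfl
  · rw [← neg_add, ← (a.summable_down _).tsum_add (b.summable_down _)]
    rfl

theorem AnFun.divDiff_const_mul (c : C) (a : AnFun C) :
    (AnFun.const c * a).divDiff = AnFun.const c * a.divDiff := by
  ext n
  rw [const_mul_coeff]
  change divCoeff (AnFun.const c * a).1 n = c * divCoeff a.1 n
  simp only [divCoeff, const_mul_coeff]
  split_ifs
  · rw [tsum_mul_left]
  · rw [tsum_mul_left, mul_neg]

/-- The coefficients of the Taylor expansion at `1`, as linear functionals. -/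
noncomputable def taylorOne (m : ℕ) (a : AnFun C) : C := (AnFun.divDiff^[m] a).evalOne

theorem taylorOne_add (m : ℕ) (a b : AnFun C) :
    taylorOne m (a + b) = taylorOne m a + taylorOne m b := by
  have : AnFun.divDiff^[m] (a + b) = AnFun.divDiff^[m] a + AnFun.divDiff^[m] b := by
    induction m with
    | zero => rfl
    | succ m ih => simp only [Function.iterate_succ_apply', ih, AnFun.divDiff_add]
  rw [taylorOne, this, AnFun.evalOne_add]
  rfl

theorem taylorOne_const_mul (m : ℕ) (c : C) (a : AnFun C) :
    taylorOne m (AnFun.const c * a) = c * taylorOne m a := by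
  have : AnFun.divDiff^[m] (AnFun.const c * a) = AnFun.const c * AnFun.divDiff^[m] a := by
    induction m with
    | zero => rfl
    | succ m ih => simp only [Function.iterate_succ_apply', ih, AnFun.divDiff_const_mul]
  rw [taylorOne, this, AnFun.evalOne_const_mul]
  rfl

theorem taylorOne_sum (m : ℕ) {ι : Type*} (s : Finset ι) (c : ι → C) (a : ι → AnFun C) :
    taylorOne m (∑ i ∈ s, AnFun.const (c i) * a i) = ∑ i ∈ s, c i * taylorOne m (a i) := by
  classical
  induction s using Finset.induction_on with
  | empty =>
    have := taylorOne_const_mul m (0 : C) 0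
    rw [map_zero, zero_mul, zero_mul] at this
    simpa using this
  | insert i s hi ih =>
    rw [Finset.sum_insert hi, Finset.sum_insert hi, taylorOne_add, taylorOne_const_mul, ih]

/-- Repeated division: each vanishing Taylor coefficient removes the remainder of one division. -/
theorem pow_dvd_of_taylorOne_eq_zero {m : ℕ} {a : AnFun C} (h : ∀ j < m, taylorOne j a = 0) :
    (AnFun.monomial 1 1 - 1) ^ m ∣ a := by
  suffices a = (AnFun.monomial 1 1 - 1) ^ m * AnFun.divDiff^[m] a from ⟨_, this⟩
  induction m with
  | zero => simp
  | succ m ih =>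
    have h1 := AnFun.eq_mul_divDiff_add (AnFun.divDiff^[m] a)
    have h2 : (AnFun.divDiff^[m] a).evalOne = 0 := h m (Nat.lt_succ_self m)
    rw [h2, map_zero, add_zero] at h1
    rw [Function.iterate_succ_apply', pow_succ, mul_assoc, ← h1]
    exact ih fun j hj => h j (hj.trans (Nat.lt_succ_self m))

/-- More than `m` analytic functions have a nontrivial linear combination vanishing to order `m`
at `1`. -/
theorem exists_combination_pow_dvd {ι : Type*} [Fintype ι] {m : ℕ} (hm : m < Fintype.card ι)
    (a : ι → AnFun C) :
    ∃ c : ι → C, c ≠ 0 ∧ (AnFun.monomial 1 1 - 1) ^ m ∣ ∑ i, AnFun.const (c i) * a i := by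
  let Ψ : (ι → C) →ₗ[C] (Fin m → C) :=
    { toFun := fun c j => ∑ i, c i * taylorOne j (a i)
      map_add' := fun c c' => by
        ext j
        simp [add_mul, Finset.sum_add_distrib]
      map_smul' := fun c c' => by
        ext j
        simp [Finset.mul_sum, mul_assoc] }
  -- Vanishing to order m imposes m linear conditions on more than m unknowns.
  have hker : LinearMap.ker Ψ ≠ ⊥ := LinearMap.ker_ne_bot_of_finrank_lt (by simpa using hm)
  obtain ⟨c, hc, hc0⟩ := Submodule.exists_mem_ne_zero_of_ne_bot hker
  refine ⟨c, hc0, pow_dvd_of_taylorOne_eq_zero fun j hj => ?_⟩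
  rw [taylorOne_sum]
  exact congrFun (LinearMap.mem_ker.1 hc) ⟨j, hj⟩

/-- Each factor x − 1 contributes 1 to the additive zero count, and the cofactor contributes a
nonnegative amount. -/
theorem le_jump_of_pow_dvd {y : C} (hy : y ≠ 0) (hy1 : ‖y‖ < 1) {m : ℕ} {a : AnFun C}
    (ha : a ≠ 0) (h : (AnFun.monomial 1 1 - 1) ^ m ∣ a) : (m : ℤ) ≤ jump y hy a := by
  obtain ⟨b, rfl⟩ := h
  have hb : b ≠ 0 := right_ne_zero_of_mul ha
  rw [jump_mul hy (pow_ne_zero _ xSubOne_ne_zero) hb, jump_pow hy xSubOne_ne_zero,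
    jump_xSubOne hy hy1, mul_one]
  have := jump_nonneg hy hy1 hb
  omega

end Division

/-! ### Rewriting rules for derivations -/

section Der

variable {R : Type*} [CommRing R]

theorem Der.map_mul (D : Der R) (a b : R) : D (a * b) = a * D b + b * D a :=
  Derivation.leibniz D a b

theorem Der.map_one (D : Der R) : D 1 = 0 := Derivation.map_one_eq_zero D

theorem Der.add_apply (D D' : Der R) (a : R) : (D + D') a = D a + D' a := rfl

end Der

/-- The hypothesis says that G/H is invariant under dilation by y; comparing dominant indices of
both sides equates the zero counts of G and H. -/
theorem jump_eq_of_mul_dilate_eq {C : Type*} [NontriviallyNormedField C] [CompleteSpace C]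
    [IsUltrametricDist C] {y : C} (hy : y ≠ 0) {G H : AnFun C} (hG : G ≠ 0) (hH : H ≠ 0)
    (h : G * AnFun.dilate y hy H = H * AnFun.dilate y hy G) : jump y hy G = jump y hy H := by
  have h1 := congrArg lastMax h
  rw [lastMax_mul hG (dilate_ne_zero hy hH), lastMax_mul hH (dilate_ne_zero hy hG)] at h1
  rw [jump, jump]
  omega

/-! ### The concrete operators, the two systems, and the field of elliptic functions -/

section Meromorphic

variable (d : ℝ) [hd : Fact (1 < d)]

theorem algebraMap_Mer_injective : Function.Injective (algebraMap (An d) (Mer d)) :=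
  IsFractionRing.injective (An d) (Mer d)

theorem sigmaQ_algebraMap (a : An d) :
    sigmaQ d (algebraMap (An d) (Mer d) a) =
      algebraMap (An d) (Mer d) (AnFun.dilate (qC d) (qC_ne_zero d) a) :=
  IsFractionRing.lift_algebraMap _ _

theorem partialX_algebraMap (a : An d) :
    partialX d (algebraMap (An d) (Mer d) a) = algebraMap (An d) (Mer d) (AnFun.derivX a) :=
  extendDerivation_algebraMap _ _ a

theorem partialQ_algebraMap (a : An d) :
    partialQ d (algebraMap (An d) (Mer d) a) = algebraMap (An d) (Mer d)
      (AnFun.derivCoeff (derivCC d) (norm_derivCC_le d) a) :=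
  extendDerivation_algebraMap _ _ a

theorem const_coeff (c : CC d) (n : ℤ) : (AnFun.const c).1 n = if n = 0 then c else 0 := by
  change (Pi.single 0 c : ℤ → CC d) n = _
  rw [Pi.single_apply]

theorem sigmaQ_constMer (c : CC d) : sigmaQ d (constMer d c) = constMer d c := by
  rw [constMer, RingHom.comp_apply, sigmaQ_algebraMap]
  congr 1
  ext n
  rw [dilate_coeff, const_coeff]
  split_ifs with h
  · rw [h, zpow_zero, one_mul]
  · rw [mul_zero]

theorem partialX_constMer (c : CC d) : partialX d (constMer d c) = 0 := by
  rw [constMer, RingHom.comp_apply, partialX_algebraMap, ← map_zero (algebraMap (An d) (Mer d))]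
  congr 1
  ext n
  change (n : CC d) * (AnFun.const c).1 n = 0
  rw [const_coeff]
  split_ifs with h
  · rw [h, Int.cast_zero, zero_mul]
  · rw [mul_zero]

theorem partialQ_constMer (c : CC d) : partialQ d (constMer d c) = constMer d (derivCC d c) := by
  rw [constMer, RingHom.comp_apply, RingHom.comp_apply, partialQ_algebraMap]
  congr 1
  ext n
  change derivCC d ((AnFun.const c).1 n) = _
  rw [const_coeff, const_coeff]
  split_ifs
  · rfl
  · rw [map_zero]

theorem monomial_coeff (m : ℤ) (c : CC d) (n : ℤ) :
    (AnFun.monomial m c).1 n = if n = m then c else 0 := by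
  change (Pi.single m c : ℤ → CC d) n = _
  rw [Pi.single_apply]

theorem sigmaQ_xMer : sigmaQ d (xMer d) = constMer d (qC d) * xMer d := by
  rw [constMer, RingHom.comp_apply, xMer, sigmaQ_algebraMap, ← map_mul]
  congr 1
  ext n
  rw [dilate_coeff, const_mul_coeff, monomial_coeff]
  split_ifs with h
  · rw [h, zpow_one]
  · rw [mul_zero, mul_zero]

theorem partialX_xMer : partialX d (xMer d) = xMer d := by
  rw [xMer, partialX_algebraMap]
  congr 1
  ext n
  change (n : CC d) * (AnFun.monomial 1 1).1 n = _
  rw [monomial_coeff]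
  split_ifs with h
  · rw [h, Int.cast_one, one_mul]
  · rw [mul_zero]

theorem partialQ_xMer : partialQ d (xMer d) = 0 := by
  rw [xMer, partialQ_algebraMap, ← map_zero (algebraMap (An d) (Mer d))]
  congr 1
  ext n
  change derivCC d ((AnFun.monomial 1 1).1 n) = 0
  rw [monomial_coeff]
  split_ifs
  · exact Der.map_one _
  · rw [map_zero]

theorem xMer_ne_zero : xMer d ≠ 0 := by
  intro h
  have h1 : (AnFun.monomial 1 1 : An d) = 0 :=
    algebraMap_Mer_injective d (by rw [map_zero]; exact h)
  have h2 := monomial_coeff d 1 1 1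
  rw [h1, if_pos rfl] at h2
  exact zero_ne_one h2

/-- A commutation relation that holds for analytic functions holds for meromorphic functions. -/
theorem derivation_sigmaQ_of_forall (D D' : Der (Mer d))
    (h : ∀ a : An d, D (sigmaQ d (algebraMap (An d) (Mer d) a)) =
      sigmaQ d (D' (algebraMap (An d) (Mer d) a))) (z : Mer d) :
    D (sigmaQ d z) = sigmaQ d (D' z) := by
  obtain ⟨a, b, hb, rfl⟩ := IsFractionRing.div_surjective (A := An d) z
  set A := algebraMap (An d) (Mer d) a
  set B := algebraMap (An d) (Mer d) b
  have hB : B ≠ 0 := fun h0 => nonZeroDivisors.ne_zero hb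
    (algebraMap_Mer_injective d (by rw [map_zero]; exact h0))
  have hB' : sigmaQ d B ≠ 0 := (map_ne_zero _).2 hB
  have hA := h a
  have e : A = A / B * B := (div_mul_cancel₀ A hB).symm
  change D (sigmaQ d A) = sigmaQ d (D' A) at hA
  rw [e, map_mul, Der.map_mul, Der.map_mul, map_add, map_mul, map_mul, h b] at hA
  exact mul_left_cancel₀ hB' (by linear_combination hA)

theorem partialX_sigmaQ (z : Mer d) : partialX d (sigmaQ d z) = sigmaQ d (partialX d z) := by
  refine derivation_sigmaQ_of_forall d _ _ (fun a => ?_) z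
  rw [sigmaQ_algebraMap, partialX_algebraMap, partialX_algebraMap, sigmaQ_algebraMap]
  congr 1
  ext n
  change (n : CC d) * (qC d ^ n * a.1 n) = qC d ^ n * ((n : CC d) * a.1 n)
  ring

theorem derivCC_qC : derivCC d (qC d) = qC d := by
  rw [qC, derivCC_rat, RatC.q, RatC.deriv_poly, Polynomial.derivative_X, mul_one]

theorem derivCC_qC_zpow (n : ℤ) : derivCC d (qC d ^ n) = n * qC d ^ n := by
  have hq := qC_ne_zero d
  have hnat : ∀ m : ℕ, derivCC d (qC d ^ m) = m * qC d ^ m := by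
    intro m
    induction m with
    | zero => rw [pow_zero, Der.map_one, Nat.cast_zero, zero_mul]
    | succ m ih =>
      rw [pow_succ, Der.map_mul, ih, derivCC_qC]
      push_cast
      ring
  obtain ⟨m, rfl | rfl⟩ := n.eq_nat_or_neg
  · rw [zpow_natCast, hnat]
    simp
  · rw [zpow_neg, zpow_natCast, derivation_inv_eq, hnat]
    push_cast
    have := pow_ne_zero m hq
    field_simp

/-- On coefficients, ∂_q(q^n a_n) = q^n(∂_q a_n + n a_n), and the extra term is ∂_x. -/
theorem partialQ_sigmaQ (z : Mer d) :
    partialQ d (sigmaQ d z) = sigmaQ d (partialQ d z) + sigmaQ d (partialX d z) := by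
  have := derivation_sigmaQ_of_forall d (partialQ d) (partialQ d + partialX d) (fun a => ?_) z
  · rw [this, Der.add_apply, map_add]
  rw [sigmaQ_algebraMap, Der.add_apply, partialQ_algebraMap, partialQ_algebraMap,
    partialX_algebraMap, ← map_add, sigmaQ_algebraMap]
  congr 1
  ext n
  change derivCC d (qC d ^ n * a.1 n) = qC d ^ n * (derivCC d (a.1 n) + (n : CC d) * a.1 n)
  rw [Der.map_mul, derivCC_qC_zpow]
  ring

theorem dilate_theta : AnFun.dilate (qC d) (qC_ne_zero d) (theta d) =
    AnFun.monomial 1 (qC d) * theta d := by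
  ext n
  rw [dilate_coeff, AnFun.monomial_mul_coeff]
  change qC d ^ n * qC d ^ (-(n * (n - 1) / 2)) =
    qC d * qC d ^ (-((n - 1) * (n - 1 - 1) / 2))
  have hq := qC_ne_zero d
  rw [← zpow_add₀ hq, ← zpow_one_add₀ hq]
  congr 1
  have h1 : 2 * (n * (n - 1) / 2) = n * (n - 1) :=
    Int.mul_ediv_cancel' (Int.even_mul_pred_self n).two_dvd
  have h2 : 2 * ((n - 1) * (n - 1 - 1) / 2) = (n - 1) * (n - 1 - 1) :=
    Int.mul_ediv_cancel' (Int.even_mul_pred_self (n - 1)).two_dvd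
  have h3 : n * (n - 1) = (n - 1) * (n - 1 - 1) + 2 * (n - 1) := by ring
  omega

theorem theta_ne_zero : theta d ≠ 0 := by
  intro h
  have h1 : (theta d).1 0 = 1 := by
    change qC d ^ (-((0 : ℤ) * (0 - 1) / 2)) = 1
    simp
  rw [h] at h1
  exact zero_ne_one h1

theorem algebraMap_monomial (c : CC d) :
    algebraMap (An d) (Mer d) (AnFun.monomial 1 c) = constMer d c * xMer d := by
  rw [constMer, RingHom.comp_apply, xMer, ← map_mul]
  congr 1
  ext n
  rw [const_mul_coeff, monomial_coeff, monomial_coeff]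
  split_ifs <;> simp

/-- The logarithmic derivative of the functional equation θ_q(qx) = q x θ_q(x). -/
theorem sigmaQ_ellQ : sigmaQ d (ellQ d) = ellQ d + 1 := by
  have hθ : algebraMap (An d) (Mer d) (theta d) ≠ 0 := fun h0 => theta_ne_zero d
    (algebraMap_Mer_injective d (by rw [map_zero]; exact h0))
  have hs : sigmaQ d (algebraMap (An d) (Mer d) (theta d)) =
      constMer d (qC d) * xMer d * algebraMap (An d) (Mer d) (theta d) := by
    rw [sigmaQ_algebraMap, dilate_theta, map_mul, algebraMap_monomial]
  have hq : constMer d (qC d) ≠ 0 := (map_ne_zero _).2 (qC_ne_zero d)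
  have hx := xMer_ne_zero d
  rw [ellQ, map_div₀, ← partialX_sigmaQ, hs, Der.map_mul, Der.map_mul,
    partialX_constMer, partialX_xMer]
  field_simp
  ring

theorem delta_apply (z : Mer d) : delta d z = ellQ d * partialX d z + partialQ d z := rfl

/-- The term added to ∂_q by σ_q is exactly the one produced by σ_q(ℓ_q) = ℓ_q + 1; this is what
dictates the form of δ. -/
theorem delta_sigmaQ (z : Mer d) : delta d (sigmaQ d z) = sigmaQ d (delta d z) := by
  rw [delta_apply, delta_apply, partialX_sigmaQ, partialQ_sigmaQ, map_add, map_mul, sigmaQ_ellQ]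
  ring

theorem charZero_Mer : CharZero (Mer d) :=
  charZero_of_injective_ringHom (constMer d).injective

theorem exists_root_of_degree_ne_zero (p : Polynomial (fieldCq d)) (hp : p.degree ≠ 0) :
    ∃ α ∈ (constMer d).fieldRange, Polynomial.aeval α p = 0 := by
  have := isAlgClosed_CC d
  let e : RatC d ≃+* fieldCq d :=
    RingEquiv.ofBijective ((constMer d).comp (ratToCC d)).rangeRestrictField
      ⟨RingHom.injective _, RingHom.rangeRestrictField_bijective _ |>.2⟩
  let ψ : fieldCq d →+* CC d := (ratToCC d).comp (e.symm : fieldCq d →+* RatC d)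
  have hψ : (constMer d).comp ψ = (fieldCq d).subtype := by
    ext z
    obtain ⟨f, rfl⟩ := e.surjective z
    simp only [ψ, RingHom.comp_apply, RingHom.coe_coe, RingEquiv.symm_apply_apply]
    rfl
  obtain ⟨α, hα⟩ := IsAlgClosed.exists_eval₂_eq_zero_of_injective ψ ψ.injective p hp
  refine ⟨constMer d α, ⟨α, rfl⟩, ?_⟩
  have h1 := congrArg (constMer d) hα
  rw [Polynomial.hom_eval₂, hψ, map_zero] at h1
  exact h1

theorem constMer_qC_mem : constMer d (qC d) ∈ fieldCq d := ⟨RatC.q d, rfl⟩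

theorem fieldCq_le : fieldCq d ≤ (constMer d).fieldRange := by
  rintro _ ⟨f, rfl⟩
  exact ⟨ratToCC d f, rfl⟩

theorem constMer_qC_pow_ne_one (n : ℕ) (hn : n ≠ 0) : constMer d (qC d) ^ n ≠ 1 := by
  intro h
  rw [← map_pow, ← map_one (constMer d)] at h
  have h1 := congrArg norm ((constMer d).injective h)
  rw [norm_pow, norm_qC, norm_one] at h1
  exact (one_lt_pow₀ hd.out hn).ne' h1

theorem isTateSystem_partialX : IsTateSystem (sigmaQ d) (partialX d) (fieldCq d)
    (constMer d).fieldRange (constMer d (qC d)) (xMer d) (ellQ d) 1 where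
  comm := partialX_sigmaQ d
  k₀_le := fieldCq_le d
  sigma_k := by rintro _ ⟨c, rfl⟩; exact sigmaQ_constMer d c
  D_k := by rintro _ ⟨c, rfl⟩; rw [partialX_constMer]; exact zero_mem _
  q_mem := constMer_qC_mem d
  q_ne_zero := (map_ne_zero _).2 (qC_ne_zero d)
  q_pow := constMer_qC_pow_ne_one d
  sigma_x := sigmaQ_xMer d
  x_ne_zero := xMer_ne_zero d
  sigma_l := sigmaQ_ellQ d
  D_x := by rw [partialX_xMer, one_mul]
  kappa_ne := by
    rintro _ ⟨c, rfl⟩ hc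
    rwa [partialX_constMer, one_mul, sub_zero]
  kappa_mem := one_mem _
  kappa_eq := ⟨ellQ d, subset_sup_closure _ _ rfl, by rw [sigmaQ_ellQ]; ring⟩
  root := exists_root_of_degree_ne_zero d

theorem isTateSystem_delta : IsTateSystem (sigmaQ d) (delta d) (fieldCq d)
    (constMer d).fieldRange (constMer d (qC d)) (xMer d) (ellQ d) (ellQ d) where
  comm := delta_sigmaQ d
  k₀_le := fieldCq_le d
  sigma_k := by rintro _ ⟨c, rfl⟩; exact sigmaQ_constMer d c
  D_k := by
    rintro _ ⟨c, rfl⟩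
    rw [delta_apply, partialX_constMer, mul_zero, zero_add, partialQ_constMer]
    exact ⟨_, rfl⟩
  q_mem := constMer_qC_mem d
  q_ne_zero := (map_ne_zero _).2 (qC_ne_zero d)
  q_pow := constMer_qC_pow_ne_one d
  sigma_x := sigmaQ_xMer d
  x_ne_zero := xMer_ne_zero d
  sigma_l := sigmaQ_ellQ d
  D_x := by rw [delta_apply, partialX_xMer, partialQ_xMer, add_zero]
  kappa_ne := by
    rintro _ ⟨c, rfl⟩ hc h
    rw [delta_apply, partialX_constMer, mul_zero, zero_add, partialQ_constMer, sub_eq_zero] at h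
    -- ℓ_q times a constant equals a constant; applying σ_q adds the constant c on the left only, so
    -- c = 0.
    have h1 := congrArg (sigmaQ d) h
    rw [map_mul, sigmaQ_ellQ, sigmaQ_constMer, sigmaQ_constMer, ← h] at h1
    exact hc (by linear_combination h1)
  kappa_mem := subset_sup_closure _ _ rfl
  kappa_eq := by
    have h2 : (2 : Mer d) ≠ 0 := by
      have := charZero_Mer d
      exact two_ne_zero
    have hl : ellQ d ∈ fixedField (sigmaQ d) ⊔ Subfield.closure {ellQ d} :=
      subset_sup_closure _ _ rfl
    -- The binomial ℓ(ℓ − 1)/2 is a discrete antiderivative of ℓ under ℓ ↦ ℓ + 1.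
    refine ⟨(ellQ d ^ 2 - ellQ d) / 2, div_mem (sub_mem (pow_mem hl 2) hl) (ofNat_mem _ 2), ?_⟩
    rw [map_div₀, map_sub, map_pow, sigmaQ_ellQ, map_ofNat]
    field_simp
    ring
  root := exists_root_of_degree_ne_zero d

theorem fieldF_eq :
    fieldF d = fieldL (sigmaQ d) (ellQ d) ⊔ Subfield.closure {xMer d} := by
  rw [fieldL, sup_assoc, ← Subfield.closure_union, Set.union_comm]
  rfl

theorem fieldCx_le_fieldF : fieldCx d ≤ fieldF d := by
  refine sup_le_sup ?_ (Subfield.closure_mono (by simp))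
  rintro _ ⟨c, rfl⟩
  exact sigmaQ_constMer d c

theorem dilate_inv_dilate (a : An d) :
    AnFun.dilate (qC d)⁻¹ (inv_ne_zero (qC_ne_zero d))
      (AnFun.dilate (qC d) (qC_ne_zero d) a) = a := by
  ext n
  rw [dilate_coeff, dilate_coeff, inv_zpow,
    inv_mul_cancel_left₀ (zpow_ne_zero _ (qC_ne_zero d))]

/-- The quotient of two analytic functions is not invariant unless they have the same number of
zeros in a fundamental annulus. -/
theorem jump_eq_of_mem_fieldE {R : Mer d} (hR : R ∈ fieldE d) {G H : An d} (hG : G ≠ 0)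
    (hH : H ≠ 0) (h : algebraMap (An d) (Mer d) G = algebraMap (An d) (Mer d) H * R) :
    jump (qC d)⁻¹ (inv_ne_zero (qC_ne_zero d)) G =
      jump (qC d)⁻¹ (inv_ne_zero (qC_ne_zero d)) H := by
  refine jump_eq_of_mul_dilate_eq _ hG hH ?_
  have hR' : sigmaQ d R = R := hR
  have h1 := congrArg (sigmaQ d) h
  rw [map_mul, hR', sigmaQ_algebraMap, sigmaQ_algebraMap] at h1
  have h2 : AnFun.dilate (qC d) (qC_ne_zero d) G * H =
      AnFun.dilate (qC d) (qC_ne_zero d) H * G := by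
    apply algebraMap_Mer_injective d
    rw [map_mul, map_mul, h1, h]
    ring
  have h3 := congrArg (AnFun.dilate (qC d)⁻¹ (inv_ne_zero (qC_ne_zero d))) h2
  rwa [map_mul, map_mul, dilate_inv_dilate, dilate_inv_dilate] at h3

/-- With f = P/Q and g = P'/Q', a polynomial of degree at most N in each of f and g has N² + 2N + 1
coefficients and denominator (QQ')^N. Its invariance forces the numerator to have as many zeros in a
fundamental annulus as the denominator, namely NK. A numerator made to vanish to order NK + 1 at 1
must therefore be zero. -/
theorem exists_relation_of_mem_fieldE {f g : Mer d} (hf : f ∈ fieldE d) (hg : g ∈ fieldE d) :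
    ∃ (N : ℕ) (c : Fin N × Fin N → CC d), c ≠ 0 ∧
      ∑ p, constMer d (c p) * f ^ (p.1 : ℕ) * g ^ (p.2 : ℕ) = 0 := by
  obtain ⟨P, Q, hQ, rfl⟩ := IsFractionRing.div_surjective (A := An d) f
  obtain ⟨P', Q', hQ', rfl⟩ := IsFractionRing.div_surjective (A := An d) g
  have hQ0 := nonZeroDivisors.ne_zero hQ
  have hQ0' := nonZeroDivisors.ne_zero hQ'
  set φ := algebraMap (An d) (Mer d) with hφ
  have hφ0 : φ Q ≠ 0 := fun h0 => hQ0 (algebraMap_Mer_injective d (by rw [map_zero]; exact h0))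
  have hφ0' : φ Q' ≠ 0 := fun h0 => hQ0' (algebraMap_Mer_injective d (by rw [map_zero]; exact h0))
  have hy := inv_ne_zero (qC_ne_zero d)
  have hy1 : ‖(qC d)⁻¹‖ < 1 := by
    rw [norm_inv, norm_qC]
    exact inv_lt_one_of_one_lt₀ hd.out
  obtain ⟨K, hK⟩ := Int.eq_ofNat_of_zero_le (jump_nonneg hy hy1 (mul_ne_zero hQ0 hQ0'))
  -- Large enough for (N + 1)² > NK + 1, so that the linear conditions leave a nontrivial
  -- combination.
  let N := K + 1
  obtain ⟨c, hc, hdvd⟩ := exists_combination_pow_dvd (C := CC d) (m := N * K + 1)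
    (ι := Fin (N + 1) × Fin (N + 1)) (by
      simp only [Fintype.card_prod, Fintype.card_fin, N]
      nlinarith)
    (fun p => P ^ (p.1 : ℕ) * Q ^ (N - p.1) * (P' ^ (p.2 : ℕ) * Q' ^ (N - p.2)))
  refine ⟨N + 1, c, hc, ?_⟩
  set G := ∑ p, AnFun.const (c p) *
    (P ^ (p.1 : ℕ) * Q ^ (N - p.1) * (P' ^ (p.2 : ℕ) * Q' ^ (N - p.2))) with hG
  set R := ∑ p, constMer d (c p) * (φ P / φ Q) ^ (p.1 : ℕ) * (φ P' / φ Q') ^ (p.2 : ℕ) with hR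
  have hRE : R ∈ fieldE d := by
    refine sum_mem fun p _ => mul_mem (mul_mem ?_ (pow_mem hf _)) (pow_mem hg _)
    exact sigmaQ_constMer d _
  have hGR : φ G = φ ((Q * Q') ^ N) * R := by
    rw [hG, hR, map_sum, Finset.mul_sum]
    refine Finset.sum_congr rfl fun p _ => ?_
    have h1 : φ Q ^ N = φ Q ^ (p.1 : ℕ) * φ Q ^ (N - p.1) := by
      rw [← pow_add, Nat.add_sub_cancel' (Nat.lt_succ_iff.1 p.1.2)]
    have h2 : φ Q' ^ N = φ Q' ^ (p.2 : ℕ) * φ Q' ^ (N - p.2) := by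
      rw [← pow_add, Nat.add_sub_cancel' (Nat.lt_succ_iff.1 p.2.2)]
    have h3 : φ (AnFun.const (c p)) = constMer d (c p) := rfl
    simp only [map_mul, map_pow, mul_pow, h1, h2, h3, div_pow]
    field_simp
  have hH0 : (Q * Q') ^ N ≠ 0 := pow_ne_zero _ (mul_ne_zero hQ0 hQ0')
  -- If the combination R is nonzero, then so is its numerator G, which has at least NK + 1 zeros by
  -- divisibility but exactly NK by invariance of R.
  by_contra hR0
  have hG0 : G ≠ 0 := by
    intro h0
    rw [h0, map_zero, eq_comm, mul_eq_zero] at hGR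
    refine hGR.elim (fun h1 => hH0 ?_) hR0
    exact algebraMap_Mer_injective d (by rw [map_zero]; exact h1)
  have h1 := jump_eq_of_mem_fieldE d hRE hG0 hH0 hGR
  have h2 := le_jump_of_pow_dvd hy hy1 hG0 hdvd
  rw [h1, jump_pow hy (mul_ne_zero hQ0 hQ0'), hK] at h2
  push_cast at h2
  linarith

theorem pairwiseDependent_fieldE : PairwiseDependent (constMer d).fieldRange (fieldE d) := by
  intro f hf g hg
  obtain ⟨N, c, hc, h⟩ := exists_relation_of_mem_fieldE d hf hg
  refine ⟨N, fun i j => if hij : i < N ∧ j < N then constMer d (c (⟨i, hij.1⟩, ⟨j, hij.2⟩)) else 0,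
    fun i j => ?_, ?_, ?_⟩
  · dsimp only
    split_ifs
    · exact ⟨_, rfl⟩
    · exact zero_mem _
  · obtain ⟨p, hp⟩ := Function.ne_iff.1 hc
    refine ⟨p.1, Finset.mem_range.2 p.1.2, p.2, Finset.mem_range.2 p.2.2, ?_⟩
    dsimp only
    rw [dif_pos ⟨p.1.2, p.2.2⟩]
    exact (map_ne_zero _).2 hp
  · rw [Fintype.sum_prod_type_right] at h
    refine Eq.trans ?_ h
    rw [Finset.sum_range]
    refine Finset.sum_congr rfl fun j _ => ?_
    rw [Finset.sum_range, Finset.sum_mul]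
    refine Finset.sum_congr rfl fun i _ => ?_
    dsimp only
    rw [dif_pos ⟨i.2, j.2⟩]

end Meromorphic

end QDiff

theorem mainTheorem6 (d : ℝ) [Fact (1 < d)] (a u : QDiff.Mer d) (ha : a ∈ QDiff.fieldCqx d)
    (hu : u ≠ 0) (hau : QDiff.sigmaQ d u = a * u) :
    List.TFAE [
      ∃ r : ℤ, ∃ g ∈ QDiff.fieldCqx d, ∃ μ ∈ QDiff.fieldCq d, g ≠ 0 ∧
        a = μ * QDiff.xMer d ^ r * (QDiff.sigmaQ d g / g),
      QDiff.IsDiffAlgebraic (QDiff.partialX d) (QDiff.fieldF d) u,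
      QDiff.IsDiffAlgebraic (QDiff.partialX d) (QDiff.fieldCx d) u,
      QDiff.IsDiffAlgebraic (QDiff.delta d) (QDiff.fieldF d) u,
      QDiff.IsDiffAlgebraic (QDiff.delta d) (QDiff.fieldCx d) u] := by
  have := QDiff.charZero_Mer d
  have ha0 : a ≠ 0 := by
    rintro rfl
    rw [zero_mul, map_eq_zero] at hau
    exact hu hau
  have htriv : (∃ r : ℤ, ∃ g ∈ QDiff.fieldCqx d, ∃ μ ∈ QDiff.fieldCq d, g ≠ 0 ∧
      a = μ * QDiff.xMer d ^ r * (QDiff.sigmaQ d g / g)) →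
      QDiff.IsTrivialMultiplier (QDiff.sigmaQ d) (QDiff.fieldCq d) (QDiff.xMer d) a := by
    rintro ⟨r, g, hg, μ, hμ, hg0, h⟩
    -- Since u ≠ 0 and σ_q is injective, a ≠ 0, which rules out μ = 0.
    refine ⟨r, g, hg, μ, hμ, ?_, hg0, h⟩
    rintro rfl
    exact ha0 (by rw [h, zero_mul, zero_mul])
  have hof : QDiff.IsTrivialMultiplier (QDiff.sigmaQ d) (QDiff.fieldCq d) (QDiff.xMer d) a →
      ∃ r : ℤ, ∃ g ∈ QDiff.fieldCqx d, ∃ μ ∈ QDiff.fieldCq d, g ≠ 0 ∧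
        a = μ * QDiff.xMer d ^ r * (QDiff.sigmaQ d g / g) := by
    rintro ⟨r, g, hg, μ, hμ, -, hg0, h⟩
    exact ⟨r, g, hg, μ, hμ, hg0, h⟩
  tfae_have 1 → 3 := fun h =>
    (QDiff.isTateSystem_partialX d).isDiffAlgebraic_of_isTrivialMultiplier
      (QDiff.pairwiseDependent_fieldE d) hu hau (htriv h)
  tfae_have 1 → 5 := fun h =>
    (QDiff.isTateSystem_delta d).isDiffAlgebraic_of_isTrivialMultiplier
      (QDiff.pairwiseDependent_fieldE d) hu hau (htriv h)
  tfae_have 3 → 2 := QDiff.IsDiffAlgebraic.mono (QDiff.fieldCx_le_fieldF d)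
  tfae_have 5 → 4 := QDiff.IsDiffAlgebraic.mono (QDiff.fieldCx_le_fieldF d)
  tfae_have 2 → 1 := fun h => by
    rw [QDiff.fieldF_eq] at h
    exact hof ((QDiff.isTateSystem_partialX d).isTrivialMultiplier_of_isDiffAlgebraic ha hu hau h)
  tfae_have 4 → 1 := fun h => by
    rw [QDiff.fieldF_eq] at h
    exact hof ((QDiff.isTateSystem_delta d).isTrivialMultiplier_of_isDiffAlgebraic ha hu hau h)
  tfae_finish
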